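/- Explicit AdS spectrum. Let $n\ge 2$, $\ell>0$ and let $G'(0)$ be a real constant with $4\ell^2G'(0)>-n^2$. Put $s=\sqrt{4\ell^2G'(0)+n^2}>0$ and let $-s/2<\delta<s/2$. On $M=\mathbb R^n$, with $r=|x|$ and $h$ the round metric of the unit sphere $S^{n-1}$, let $$V=\sqrt{1+r^2/\ell^2},\qquad g=V^{-2}dr^2+r^2h ,$$ so that $-V^2dt^2+g$ is the $(n+1)$-dimensional anti-de Sitter metric. Let $P\psi=\frac{V}{\sqrt{\det g}}\,\partial_i\big(V\sqrt{\det g}\,g^{ij}\partial_j\psi\big)$, let $\rho=1/V$, and let $L^2_{\tau}$ be the space of complex functions $\psi$ with $\int_M|\psi|^2\rho^{2\tau}\,d\mu_g<\infty$, functions equal almost everywhere being identified. For $\omega\in\mathbb R$ consider the eigenvalue problem $$P\psi=\big(-\omega^2+V^2G'(0)\big)\psi,\qquad \psi\in L^2_{\delta-1/2},\qquad(*)$$ understood in the sense of distributions on all of $\mathbb R^n$, the origin included (the regular solutions). For $k,K\in\mathbb N=\{0,1,2,\dots\}$ let $$\omega_{k,K}=\frac{n+\sqrt{4\ell^2G'(0)+n^2}+2(k+2K)}{2\ell},$$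 and for $Y$ a spherical harmonic of degree $k$ on $S^{n-1}$ (the restriction of a complex homogeneous harmonic polynomial of degree $k$) let $$\psi_{k,K,Y}(r,\theta)=(\ell^2+r^2)^{-\ell\omega_{k,K}/2}\;r^k\;{}_2F_1\Big(-\tfrac s2-K,\,-K;\,k+\tfrac n2;\,-\tfrac{r^2}{\ell^2}\Big)\,Y(\theta),$$ in which the hypergeometric factor is a polynomial in $r^2$. Then: 1. $(*)$ has a non-zero solution if and only if $\omega=\pm\omega_{k,K}$ for some $k,K\in\mathbb N$. 2. For every $k,K$ and every $Y\ne0$ as above, $\Delta_hY=-k(k+n-2)Y$, and $\psi_{k,K,Y}$ is smooth on $\mathbb R^n$, is not identically zero, satisfies the equation pointwise with $\omega=\omega_{k,K}$, and is a solution of $(*)$. 3. For every $\omega\in\mathbb R$, every spherical harmonic $Y\neq 0$ of degree $k$ and every function $u$ of $r$, the function $u(r)Y(\theta)$ is a non-zero solution of $(*)$ if and only if, for some $K\in\mathbb N$, $\omega=\pm\omega_{k,K}$ and $u(r)Y(\theta)=c\,\psi_{k,K,Y}$ almost everywhere for some constant $c\neq0$. 4. For every $\omega\in\mathbb R$, the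 solutions of $(*)$ are exactly the finite linear combinations of those $\psi_{k,K,Y}$ for which $\omega=\pm\omega_{k,K}$. 5. The eigenvalue $-\omega_{k,K}^2$ is simple (its eigenspace, that is the space of solutions of $(*)$ with $\omega=\omega_{k,K}$, is one-dimensional) if and only if $k=K=0$. -/

import Mathlib

open MeasureTheory

noncomputable section

namespace AdS

/-- The lapse `V = √(1 + r²/ℓ²)`, with `r = ‖x‖`; a slice `t = const` of anti-de Sitter space is
`ℝⁿ`, with Cartesian coordinates `x = r θ`, `θ ∈ S^{n-1}`. -/
def lapse {n : ℕ} (ℓ : ℝ) (x : EuclideanSpace ℝ (Fin n)) : ℝ :=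
  Real.sqrt (‖x‖ ^ 2 / ℓ ^ 2 + 1)

/-- The matrix `g_{ij} = δ_{ij} - x_i x_j / (ℓ² + r²)` of the spatial metric `dr²/V² + r² h`
(`h` the unit round metric on the sphere) in the coordinates `x`. -/
def metric {n : ℕ} (ℓ : ℝ) (x : EuclideanSpace ℝ (Fin n)) : Matrix (Fin n) (Fin n) ℝ :=
  Matrix.of fun i j => (if i = j then 1 else 0) - x i * x j / (ℓ ^ 2 + ‖x‖ ^ 2)

/-- The metric is `dr²/V² + r² h`: at `x ≠ 0`, `dr(v) = ⟪x, v⟫/r` and `r² h(v,v) = |v|² - dr(v)²`. -/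
theorem metric_polar {n : ℕ} {ℓ : ℝ} (hℓ : 0 < ℓ) (x v : EuclideanSpace ℝ (Fin n)) (hx : x ≠ 0) :
    ∑ i, ∑ j, metric ℓ x i j * v i * v j =
      (inner ℝ x v / ‖x‖) ^ 2 / lapse ℓ x ^ 2 + (‖v‖ ^ 2 - (inner ℝ x v / ‖x‖) ^ 2) := by
  have hr : 0 < ‖x‖ := norm_pos_iff.mpr hx
  have h1 : ∑ i, ∑ j, metric ℓ x i j * v i * v j =
      (∑ i, v i * v i) - (∑ i, x i * v i) * (∑ j, x j * v j) / (ℓ ^ 2 + ‖x‖ ^ 2) := by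
    rw [Finset.sum_mul_sum, Finset.sum_div, ← Finset.sum_sub_distrib]
    refine Finset.sum_congr rfl fun i _ => ?_
    have : v i * v i = ∑ j, (if i = j then 1 else 0) * v i * v j := by simp
    rw [this, Finset.sum_div, ← Finset.sum_sub_distrib]
    refine Finset.sum_congr rfl fun j _ => ?_
    simp only [metric, Matrix.of_apply]
    ring
  have h2 : ∑ i, v i * v i = ‖v‖ ^ 2 := by
    rw [EuclideanSpace.norm_sq_eq]
    exact Finset.sum_congr rfl fun i _ => by rw [Real.norm_eq_abs, sq_abs, sq]
  have h3 : ∑ i, x i * v i = inner ℝ x v := by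
    rw [PiLp.inner_apply]
    exact Finset.sum_congr rfl fun i _ => by simp [mul_comm]
  have h4 : lapse ℓ x ^ 2 = ‖x‖ ^ 2 / ℓ ^ 2 + 1 := Real.sq_sqrt (by positivity)
  rw [h1, h2, h3, h4]
  field_simp
  ring

/-- The partial derivative `∂_i f`. -/
def partialD {n : ℕ} {F : Type*} [NormedAddCommGroup F] [NormedSpace ℝ F]
    (i : Fin n) (f : EuclideanSpace ℝ (Fin n) → F) (x : EuclideanSpace ℝ (Fin n)) : F :=
  fderiv ℝ f x (EuclideanSpace.single i 1)

/-- The operator `P f = V / √(det g) ∂_i (V √(det g) g^{ij} ∂_j f)`. -/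
def opP {n : ℕ} {F : Type*} [NormedAddCommGroup F] [NormedSpace ℝ F]
    (ℓ : ℝ) (f : EuclideanSpace ℝ (Fin n) → F) (x : EuclideanSpace ℝ (Fin n)) : F :=
  (lapse ℓ x / Real.sqrt (metric ℓ x).det) •
    ∑ i, partialD i (fun y => (lapse ℓ y * Real.sqrt (metric ℓ y).det) •
      ∑ j, (metric ℓ y)⁻¹ i j • partialD j f y) x

/-- The Riemannian measure `dμ_g = √(det g) dx`. -/
def riemMeasure (n : ℕ) (ℓ : ℝ) : Measure (EuclideanSpace ℝ (Fin n)) :=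
  volume.withDensity fun x => ENNReal.ofReal (Real.sqrt (metric ℓ x).det)

/-- `ρ = 1/V`, a defining function of the conformal boundary. -/
def bdryDef {n : ℕ} (ℓ : ℝ) (x : EuclideanSpace ℝ (Fin n)) : ℝ := (lapse ℓ x)⁻¹

/-- `f` lies in the weighted space `L²_τ`, with norm `‖f‖² = ∫ |f|² ρ^{2τ} dμ_g`. -/
def MemWeightedL2 {n : ℕ} (ℓ τ : ℝ) (f : EuclideanSpace ℝ (Fin n) → ℂ) : Prop :=
  MemLp f 2 ((riemMeasure n ℓ).withDensity fun x => ENNReal.ofReal (bdryDef ℓ x ^ (2 * τ)))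

/-- The exponent `s = √(4 ℓ² G'(0) + n²)`; the parameter `G₁` stands for `G'(0)`. -/
def sExp (n : ℕ) (ℓ G₁ : ℝ) : ℝ := Real.sqrt (4 * ℓ ^ 2 * G₁ + (n : ℝ) ^ 2)

/-- `ψ ∈ L²_{δ-1/2}` solves `P ψ = (-ω² + V² G'(0)) ψ` in the sense of distributions on all of
`ℝⁿ`. The operator `P` is formally self-adjoint for the measure `V⁻¹ dμ_g`, so the equation is
tested against `φ V⁻¹ dμ_g`, with `φ` smooth and compactly supported. -/
def IsEigensolution (n : ℕ) (ℓ G₁ δ ω : ℝ) (ψ : EuclideanSpace ℝ (Fin n) → ℂ) : Prop :=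
  MemWeightedL2 ℓ (δ - 1 / 2) ψ ∧
  ∀ φ : EuclideanSpace ℝ (Fin n) → ℝ, ContDiff ℝ (⊤ : ℕ∞) φ → HasCompactSupport φ →
    ∫ x, ((lapse ℓ x)⁻¹ * opP ℓ φ x) • ψ x ∂(riemMeasure n ℓ) =
      ∫ x, ((lapse ℓ x)⁻¹ * ((-ω ^ 2 + lapse ℓ x ^ 2 * G₁) * φ x)) • ψ x ∂(riemMeasure n ℓ)

/-- The eigenvalue `-ω²` is simple: its eigenspace in `L²_{δ-1/2}` is one-dimensional. -/
def IsSimpleFrequency (n : ℕ) (ℓ G₁ δ ω : ℝ) : Prop :=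
  ∃ ψ₀, IsEigensolution n ℓ G₁ δ ω ψ₀ ∧ ¬ ψ₀ =ᵐ[volume] 0 ∧
    ∀ ψ, IsEigensolution n ℓ G₁ δ ω ψ → ∃ c : ℂ, ψ =ᵐ[volume] c • ψ₀

/-- The frequencies `ω_{k,K} = (n + s + 2 (k + 2K)) / (2ℓ)`. -/
def freq (n : ℕ) (ℓ G₁ : ℝ) (k K : ℕ) : ℝ :=
  ((n : ℝ) + sExp n ℓ G₁ + 2 * ((k : ℝ) + 2 * (K : ℝ))) / (2 * ℓ)

/-- `H` is a homogeneous harmonic polynomial of degree `k`; its restriction to the unit sphere is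
a spherical harmonic of degree `k`. -/
def IsSolidHarmonic {n : ℕ} (k : ℕ) (H : MvPolynomial (Fin n) ℂ) : Prop :=
  H.IsHomogeneous k ∧ ∑ i, MvPolynomial.pderiv i (MvPolynomial.pderiv i H) = 0

/-- The spherical harmonic given by `H`, as a function of the direction `x / ‖x‖`. -/
def angular {n : ℕ} (H : MvPolynomial (Fin n) ℂ) (x : EuclideanSpace ℝ (Fin n)) : ℂ :=
  MvPolynomial.eval (fun i => (((‖x‖⁻¹ • x) i : ℝ) : ℂ)) H

/-- The radial function
`(ℓ² + r²)^{-ℓ ω_{k,K}/2} r^k ₂F₁(-s/2 - K, -K; k + n/2; -r²/ℓ²)`, whose hypergeometric factor is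
a polynomial of degree `K` in `r²`. -/
def radial (n : ℕ) (ℓ G₁ : ℝ) (k K : ℕ) (r : ℝ) : ℝ :=
  (ℓ ^ 2 + r ^ 2) ^ (-(ℓ * freq n ℓ G₁ k K) / 2) * r ^ k *
    ordinaryHypergeometric (-(sExp n ℓ G₁) / 2 - (K : ℝ)) (-(K : ℝ)) ((k : ℝ) + (n : ℝ) / 2)
      (-(r ^ 2) / ℓ ^ 2)

/-- The mode `ψ(r, θ) = radial(r) Y(θ)`, where `Y` is the spherical harmonic given by `H`. -/
def mode (n : ℕ) (ℓ G₁ : ℝ) (k K : ℕ) (H : MvPolynomial (Fin n) ℂ)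
    (x : EuclideanSpace ℝ (Fin n)) : ℂ :=
  (radial n ℓ G₁ k K ‖x‖ : ℂ) * angular H x

end AdS

end

/-!
The operator is `P = V² L` with `L f = ∂ᵢ ((δᵢⱼ + xᵢ xⱼ / ℓ²) ∂ⱼ f)`, and both the measure and the
factor `V²` drop out of the weak equation, which becomes `∫ (L φ - q φ) ψ dx = 0` with
`q = G'(0) - ω² / V²` (`AdS.isEigensolution_iff`). On products `f(r²) H` with `H` a solid harmonic `L`
is an ordinary differential operator in `r²` (`AdS.divOp_radial_mul`). For the functions
`(ℓ² + r²)^{-b} F(-r²/ℓ²) H` it gives the hypergeometric equation, which is why the modes are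
solutions (`AdS.divOp_mode`, `AdS.isEigensolution_mode`).

That there are no other solutions is shown by duality, with neither elliptic regularity nor a study
of the singular points of the radial equation. The exponents `b_j = (n + s)/4 + k/2 + j` are chosen so
that `L - q` maps `(ℓ² + r²)^{-b_j} H` to a combination of just two such functions, of exponents `b_j`
and `b_j + 1`; the coefficient of the first vanishes for `j = 0`, that of the second exactly for
`ω² = ω_{k,j}²`. Since `δ < s/2`, these functions decay fast enough to be used as test functions
(`AdS.IsEigensolution.integral_rpow_mul`). Hence the moments of a solution against
`(ℓ² + r²)^{-b_j - 1} H` obey a two-term recursion, and all of them vanish up to the index `j` at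
which `ω` is a frequency (`AdS.IsEigensolution.moment_eq_zero`). The moments determine the solution:
in the variable `y = x / √(ℓ² + r²)` of the unit ball they are integrals against the products of
solid harmonics in `y` and powers of `1 - |y|²`, which span all polynomials, and polynomials
separate finite measures on the ball (`AdS.ae_eq_zero_of_moment_eq_zero`).

It follows that a solution orthogonal, for the weight `1 / (ℓ² + r²)`, to the modes of its own
frequency is zero (`AdS.IsEigensolution.ae_eq_zero`). There are finitely many linearly independent
modes of a given frequency, because the frequency determines the level `N = k + 2K`, so that the
orthogonal projection of a solution to their span exists, and it is the solution itself
(`AdS.IsEigensolution.exists_mem_modeSpan`). This is the description of all solutions and of the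
possible frequencies. Solutions of the form `u(r) Y(θ)` are then found from the independence of
spherical harmonics of different degrees on a small sphere (`AdS.IsEigensolution.eq_smul_mode`), and
at a level `N ≥ 1` the harmonics `(x₁ ± i x₂)^N` give two independent modes
(`AdS.isSimpleFrequency_iff`).
-/

open MeasureTheory

noncomputable section

namespace AdS

variable {n : ℕ} {ℓ : ℝ}

/-! ### The metric -/

theorem norm_sq_eq_sum (x : EuclideanSpace ℝ (Fin n)) : ‖x‖ ^ 2 = ∑ i, x i * x i := by
  rw [EuclideanSpace.norm_sq_eq]
  exact Finset.sum_congr rfl fun i _ => by rw [Real.norm_eq_abs, sq_abs, sq]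

theorem sq_add_norm_sq_pos (hℓ : 0 < ℓ) (x : EuclideanSpace ℝ (Fin n)) : 0 < ℓ ^ 2 + ‖x‖ ^ 2 := by
  positivity

theorem lapse_sq (hℓ : 0 < ℓ) (x : EuclideanSpace ℝ (Fin n)) :
    lapse ℓ x ^ 2 = (ℓ ^ 2 + ‖x‖ ^ 2) / ℓ ^ 2 := by
  rw [lapse, Real.sq_sqrt (by positivity)]
  field_simp
  ring

theorem lapse_pos (x : EuclideanSpace ℝ (Fin n)) : 0 < lapse ℓ x :=
  Real.sqrt_pos.mpr (by positivity)

theorem continuous_lapse : Continuous (lapse ℓ : EuclideanSpace ℝ (Fin n) → ℝ) := by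
  unfold lapse; fun_prop

theorem det_metric (hℓ : 0 < ℓ) (x : EuclideanSpace ℝ (Fin n)) :
    (metric ℓ x).det = ℓ ^ 2 / (ℓ ^ 2 + ‖x‖ ^ 2) := by
  have hu := sq_add_norm_sq_pos hℓ x
  have h : metric ℓ x = 1 + Matrix.replicateCol Unit (fun i => -(x i) / (ℓ ^ 2 + ‖x‖ ^ 2)) *
      Matrix.replicateRow Unit (fun i => x i) := by
    ext i j
    simp [metric, Matrix.mul_apply, Matrix.one_apply]
    ring
  rw [h, Matrix.det_one_add_replicateCol_mul_replicateRow]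
  have h3 : (fun i => x i) ⬝ᵥ (fun i => -(x i) / (ℓ ^ 2 + ‖x‖ ^ 2)) =
      -(∑ i, x i * x i) / (ℓ ^ 2 + ‖x‖ ^ 2) := by
    rw [dotProduct, ← Finset.sum_neg_distrib, Finset.sum_div]
    exact Finset.sum_congr rfl fun i _ => by ring
  rw [h3, ← norm_sq_eq_sum]
  field_simp
  ring

theorem sqrt_det_metric (hℓ : 0 < ℓ) (x : EuclideanSpace ℝ (Fin n)) :
    Real.sqrt (metric ℓ x).det = (lapse ℓ x)⁻¹ := by
  rw [det_metric hℓ, ← Real.sqrt_sq (inv_pos.mpr (lapse_pos x)).le, inv_pow, lapse_sq hℓ, inv_div]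

theorem inv_metric (hℓ : 0 < ℓ) (x : EuclideanSpace ℝ (Fin n)) :
    (metric ℓ x)⁻¹ = Matrix.of fun i j => (if i = j then 1 else 0) + x i * x j / ℓ ^ 2 := by
  have hu := sq_add_norm_sq_pos hℓ x
  apply Matrix.inv_eq_right_inv
  ext i j
  have h3 : (metric ℓ x * Matrix.of fun i j : Fin n =>
      (if i = j then (1 : ℝ) else 0) + x i * x j / ℓ ^ 2) i j =
      (if i = j then 1 else 0) + x i * x j / ℓ ^ 2 - x i * x j / (ℓ ^ 2 + ‖x‖ ^ 2)
        - (∑ k, x k * x k) * (x i * x j / (ℓ ^ 2 + ‖x‖ ^ 2) / ℓ ^ 2) := by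
    simp only [metric, Matrix.mul_apply, Matrix.of_apply, sub_mul, mul_add, Finset.sum_sub_distrib,
      Finset.sum_add_distrib, Finset.sum_mul]
    have h4 : ∑ k, x i * x k / (ℓ ^ 2 + ‖x‖ ^ 2) * (x k * x j / ℓ ^ 2) =
        ∑ k, x k * x k * (x i * x j / (ℓ ^ 2 + ‖x‖ ^ 2) / ℓ ^ 2) :=
      Finset.sum_congr rfl fun k _ => by ring
    rw [h4]
    simp
    ring
  rw [h3, ← norm_sq_eq_sum, Matrix.one_apply]
  field_simp
  ring

/-- The divergence-form operator `L f = ∂_i ((δ_{ij} + x_i x_j / ℓ²) ∂_j f)`, for which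
`P = V² L`. -/
def divOp {F : Type*} [NormedAddCommGroup F] [NormedSpace ℝ F] (ℓ : ℝ)
    (f : EuclideanSpace ℝ (Fin n) → F) (x : EuclideanSpace ℝ (Fin n)) : F :=
  ∑ i, partialD i (fun y => partialD i f y + (y i / ℓ ^ 2) • ∑ j, y j • partialD j f y) x

theorem opP_eq {F : Type*} [NormedAddCommGroup F] [NormedSpace ℝ F] (hℓ : 0 < ℓ)
    (f : EuclideanSpace ℝ (Fin n) → F) (x : EuclideanSpace ℝ (Fin n)) :
    opP ℓ f x = lapse ℓ x ^ 2 • divOp ℓ f x := by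
  unfold opP divOp
  have h1 : lapse ℓ x / Real.sqrt (metric ℓ x).det = lapse ℓ x ^ 2 := by
    rw [sqrt_det_metric hℓ, div_inv_eq_mul, sq]
  rw [h1]
  congr 1
  refine Finset.sum_congr rfl fun i _ => ?_
  congr 1
  funext y
  rw [sqrt_det_metric hℓ, mul_inv_cancel₀ (lapse_pos y).ne', one_smul, inv_metric hℓ]
  simp only [Matrix.of_apply, add_smul, Finset.sum_add_distrib, Finset.smul_sum, smul_smul]
  congr 1
  · simp
  · exact Finset.sum_congr rfl fun j _ => by congr 1; ring

theorem measurable_sqrt_det (hℓ : 0 < ℓ) :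
    Measurable fun x : EuclideanSpace ℝ (Fin n) => ENNReal.ofReal (Real.sqrt (metric ℓ x).det) := by
  simp only [sqrt_det_metric hℓ]
  exact ENNReal.measurable_ofReal.comp continuous_lapse.measurable.inv

theorem integral_riemMeasure (hℓ : 0 < ℓ) (g : EuclideanSpace ℝ (Fin n) → ℂ) :
    ∫ x, g x ∂(riemMeasure n ℓ) = ∫ x, (lapse ℓ x)⁻¹ • g x := by
  rw [riemMeasure, integral_withDensity_eq_integral_toReal_smul (measurable_sqrt_det hℓ)
    (Filter.Eventually.of_forall fun _ => ENNReal.ofReal_lt_top)]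
  refine integral_congr_ae (Filter.Eventually.of_forall fun x => ?_)
  simp only [sqrt_det_metric hℓ]
  rw [ENNReal.toReal_ofReal (inv_pos.mpr (lapse_pos x)).le]

/-! ### Derivatives of a radial function times a polynomial -/

/-- The value at `x ∈ ℝⁿ` of a polynomial with complex coefficients. -/
def polyEval (p : MvPolynomial (Fin n) ℂ) (x : EuclideanSpace ℝ (Fin n)) : ℂ :=
  MvPolynomial.eval (fun i => ((x i : ℝ) : ℂ)) p

theorem contDiff_polyEval (p : MvPolynomial (Fin n) ℂ) {m : WithTop ℕ∞} :
    ContDiff ℝ m (polyEval p) := by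
  have hX (i : Fin n) : ContDiff ℝ m (fun x : EuclideanSpace ℝ (Fin n) => ((x i : ℝ) : ℂ)) :=
    Complex.ofRealCLM.contDiff.comp (by fun_prop)
  unfold polyEval
  induction p using MvPolynomial.induction_on with
  | C a => simpa using contDiff_const
  | add p q hp hq => simpa using hp.add hq
  | mul_X p i hp => simpa using hp.mul (hX i)

theorem partialD_polyEval (i : Fin n) (p : MvPolynomial (Fin n) ℂ)
    (x : EuclideanSpace ℝ (Fin n)) :
    partialD i (polyEval p) x = polyEval (MvPolynomial.pderiv i p) x := by
  have hd (q : MvPolynomial (Fin n) ℂ) : DifferentiableAt ℝ (polyEval q) x :=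
    (contDiff_polyEval q (m := 1)).differentiable (by norm_num) x
  have hX (j : Fin n) : HasFDerivAt (fun x : EuclideanSpace ℝ (Fin n) => ((x j : ℝ) : ℂ))
      (Complex.ofRealCLM.comp (EuclideanSpace.proj j : EuclideanSpace ℝ (Fin n) →L[ℝ] ℝ)) x :=
    (Complex.ofRealCLM.comp (EuclideanSpace.proj j : EuclideanSpace ℝ (Fin n) →L[ℝ] ℝ)).hasFDerivAt
  unfold partialD
  induction p using MvPolynomial.induction_on with
  | C a =>
    have : polyEval (MvPolynomial.C a) = fun _ : EuclideanSpace ℝ (Fin n) => a := by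
      funext y; simp [polyEval]
    rw [this]
    simp [polyEval]
  | add p q hp hq =>
    have : polyEval (p + q) = polyEval p + polyEval q := by funext y; simp [polyEval]
    rw [this, fderiv_add (hd p) (hd q)]
    simp [hp, hq, polyEval]
  | mul_X p j hp =>
    have : polyEval (p * MvPolynomial.X j) = polyEval p * fun y => ((y j : ℝ) : ℂ) := by
      funext y; simp [polyEval]
    rw [this, fderiv_mul (hd p) (hX j).differentiableAt, (hX j).fderiv]
    simp only [add_apply, smul_apply, hp]
    by_cases hij : j = i
    · subst hij
      simp [polyEval]
    · simp [polyEval, hij]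

theorem hasFDerivAt_radial {f : ℝ → ℝ} {f' : ℝ} {x : EuclideanSpace ℝ (Fin n)}
    (hf : HasDerivAt f f' (‖x‖ ^ 2)) :
    HasFDerivAt (fun y : EuclideanSpace ℝ (Fin n) => ((f (‖y‖ ^ 2) : ℝ) : ℂ))
      (Complex.ofRealCLM.comp (f' • ((2 : ℕ) • innerSL ℝ x))) x :=
  Complex.ofRealCLM.hasFDerivAt.comp x
    (hf.comp_hasFDerivAt x (hasStrictFDerivAt_norm_sq x).hasFDerivAt)

theorem differentiableAt_radial_mul {f : ℝ → ℝ} {f' : ℝ} {x : EuclideanSpace ℝ (Fin n)}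
    (hf : HasDerivAt f f' (‖x‖ ^ 2)) (p : MvPolynomial (Fin n) ℂ) :
    DifferentiableAt ℝ (fun y => ((f (‖y‖ ^ 2) : ℝ) : ℂ) * polyEval p y) x :=
  (hasFDerivAt_radial hf).differentiableAt.mul
    ((contDiff_polyEval p (m := 1)).differentiable (by norm_num) x)

theorem partialD_radial_mul {f : ℝ → ℝ} {f' : ℝ} {x : EuclideanSpace ℝ (Fin n)}
    (hf : HasDerivAt f f' (‖x‖ ^ 2)) (p : MvPolynomial (Fin n) ℂ) (i : Fin n) :
    partialD i (fun y => ((f (‖y‖ ^ 2) : ℝ) : ℂ) * polyEval p y) x =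
      2 * (f' : ℂ) * polyEval (MvPolynomial.X i * p) x +
        (f (‖x‖ ^ 2) : ℂ) * polyEval (MvPolynomial.pderiv i p) x := by
  have h := partialD_polyEval i p x
  unfold partialD at h ⊢
  rw [fderiv_fun_mul (hasFDerivAt_radial hf).differentiableAt
    ((contDiff_polyEval p (m := 1)).differentiable (by norm_num) x), (hasFDerivAt_radial hf).fderiv]
  simp only [add_apply, smul_apply, h]
  simp [polyEval, EuclideanSpace.inner_single_right]
  ring

theorem partialD_congr {F : Type*} [NormedAddCommGroup F] [NormedSpace ℝ F] (i : Fin n)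
    {f g : EuclideanSpace ℝ (Fin n) → F} {x : EuclideanSpace ℝ (Fin n)}
    (h : f =ᶠ[nhds x] g) : partialD i f x = partialD i g x := by
  unfold partialD; rw [h.fderiv_eq]

theorem partialD_add {F : Type*} [NormedAddCommGroup F] [NormedSpace ℝ F] (i : Fin n)
    {f g : EuclideanSpace ℝ (Fin n) → F} {x : EuclideanSpace ℝ (Fin n)}
    (hf : DifferentiableAt ℝ f x) (hg : DifferentiableAt ℝ g x) :
    partialD i (fun y => f y + g y) x = partialD i f x + partialD i g x := by
  unfold partialD; rw [fderiv_fun_add hf hg]; rfl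

theorem eventually_norm_sq {p : ℝ → Prop} {x : EuclideanSpace ℝ (Fin n)}
    (h : ∀ᶠ w in nhds (‖x‖ ^ 2), p w) : ∀ᶠ y in nhds x, p (‖y‖ ^ 2) :=
  (continuous_norm.pow 2).continuousAt.eventually h

theorem polyEval_add (p q : MvPolynomial (Fin n) ℂ) (x : EuclideanSpace ℝ (Fin n)) :
    polyEval (p + q) x = polyEval p x + polyEval q x := by simp [polyEval]

theorem polyEval_mul (p q : MvPolynomial (Fin n) ℂ) (x : EuclideanSpace ℝ (Fin n)) :
    polyEval (p * q) x = polyEval p x * polyEval q x := by simp [polyEval]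

theorem polyEval_X (i : Fin n) (x : EuclideanSpace ℝ (Fin n)) :
    polyEval (MvPolynomial.X i) x = (x i : ℂ) := by simp [polyEval]

theorem polyEval_sum {ι : Type*} (s : Finset ι) (p : ι → MvPolynomial (Fin n) ℂ)
    (x : EuclideanSpace ℝ (Fin n)) :
    polyEval (∑ i ∈ s, p i) x = ∑ i ∈ s, polyEval (p i) x := by simp [polyEval]

theorem ofReal_norm_sq (x : EuclideanSpace ℝ (Fin n)) :
    ((‖x‖ : ℂ)) ^ 2 = ∑ i, (x i : ℂ) * (x i : ℂ) := by
  exact_mod_cast congrArg (fun r : ℝ => (r : ℂ)) (norm_sq_eq_sum x)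

/-- Euler's identity for homogeneous polynomials, evaluated at a point. -/
theorem IsSolidHarmonic.sum_mul_pderiv {k : ℕ} {H : MvPolynomial (Fin n) ℂ}
    (hH : IsSolidHarmonic k H) (x : EuclideanSpace ℝ (Fin n)) :
    ∑ i, (x i : ℂ) * polyEval (MvPolynomial.pderiv i H) x = k * polyEval H x := by
  have h := congrArg (fun p => polyEval p x) hH.1.sum_X_mul_pderiv
  simp only [polyEval_sum, polyEval_mul, polyEval_X] at h
  rw [h]
  simp [polyEval]

theorem partialD_radial_mul_eventuallyEq {f f₁ : ℝ → ℝ} {x : EuclideanSpace ℝ (Fin n)}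
    (hf : ∀ᶠ w in nhds (‖x‖ ^ 2), HasDerivAt f (f₁ w) w) (p : MvPolynomial (Fin n) ℂ) (i : Fin n) :
    (partialD i fun y => ((f (‖y‖ ^ 2) : ℝ) : ℂ) * polyEval p y) =ᶠ[nhds x] fun y =>
      ((2 * f₁ (‖y‖ ^ 2) : ℝ) : ℂ) * polyEval (MvPolynomial.X i * p) y +
        (f (‖y‖ ^ 2) : ℂ) * polyEval (MvPolynomial.pderiv i p) y := by
  filter_upwards [eventually_norm_sq hf] with y hy
  rw [partialD_radial_mul hy]
  push_cast; rfl

theorem partialD_partialD_radial_mul {f f₁ : ℝ → ℝ} {f₂ : ℝ} {x : EuclideanSpace ℝ (Fin n)}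
    (hf : ∀ᶠ w in nhds (‖x‖ ^ 2), HasDerivAt f (f₁ w) w) (hf₁ : HasDerivAt f₁ f₂ (‖x‖ ^ 2))
    (p : MvPolynomial (Fin n) ℂ) (i : Fin n) :
    partialD i (partialD i fun y => ((f (‖y‖ ^ 2) : ℝ) : ℂ) * polyEval p y) x =
      4 * (f₂ : ℂ) * ((x i : ℂ) * (x i : ℂ)) * polyEval p x + 2 * (f₁ (‖x‖ ^ 2) : ℂ) * polyEval p x
        + 4 * (f₁ (‖x‖ ^ 2) : ℂ) * ((x i : ℂ) * polyEval (MvPolynomial.pderiv i p) x)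
        + (f (‖x‖ ^ 2) : ℂ) * polyEval (MvPolynomial.pderiv i (MvPolynomial.pderiv i p)) x := by
  have h2 : HasDerivAt (fun w => 2 * f₁ w) (2 * f₂) (‖x‖ ^ 2) := hf₁.const_mul 2
  rw [partialD_congr i (partialD_radial_mul_eventuallyEq hf p i), partialD_add i (differentiableAt_radial_mul h2 _)
    (differentiableAt_radial_mul hf.self_of_nhds _), partialD_radial_mul h2,
    partialD_radial_mul hf.self_of_nhds]
  simp only [Derivation.leibniz, MvPolynomial.pderiv_X_self, smul_eq_mul, polyEval_mul,
    polyEval_add, polyEval_X, mul_one]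
  push_cast
  ring

/-- The Laplacian of `f(r²) H` for a solid harmonic `H`, as a sum of second partial derivatives. -/
theorem sum_partialD_partialD_radial_mul {k : ℕ} {H : MvPolynomial (Fin n) ℂ}
    (hH : IsSolidHarmonic k H) {f f₁ : ℝ → ℝ} {f₂ : ℝ} {x : EuclideanSpace ℝ (Fin n)}
    (hf : ∀ᶠ w in nhds (‖x‖ ^ 2), HasDerivAt f (f₁ w) w) (hf₁ : HasDerivAt f₁ f₂ (‖x‖ ^ 2)) :
    ∑ i, partialD i (partialD i fun y => ((f (‖y‖ ^ 2) : ℝ) : ℂ) * polyEval H y) x =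
      (4 * ‖x‖ ^ 2 * f₂ + (2 * n + 4 * k) * f₁ (‖x‖ ^ 2) : ℝ) * polyEval H x := by
  have h := congrArg (fun p => polyEval p x) hH.2
  simp only [polyEval_sum] at h
  have h0 : polyEval (0 : MvPolynomial (Fin n) ℂ) x = 0 := by simp [polyEval]
  simp only [partialD_partialD_radial_mul hf hf₁, Finset.sum_add_distrib, ← Finset.mul_sum,
    ← Finset.sum_mul, hH.sum_mul_pderiv, ← ofReal_norm_sq, h, h0]
  simp
  ring

theorem sum_mul_partialD_radial_mul {k : ℕ} {H : MvPolynomial (Fin n) ℂ}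
    (hH : IsSolidHarmonic k H) {f : ℝ → ℝ} {f₁ : ℝ} {x : EuclideanSpace ℝ (Fin n)}
    (hf : HasDerivAt f f₁ (‖x‖ ^ 2)) :
    ∑ i, (x i : ℂ) * partialD i (fun y => ((f (‖y‖ ^ 2) : ℝ) : ℂ) * polyEval H y) x =
      (2 * ‖x‖ ^ 2 * f₁ + k * f (‖x‖ ^ 2) : ℝ) * polyEval H x := by
  have h (i : Fin n) : (x i : ℂ) * partialD i (fun y => ((f (‖y‖ ^ 2) : ℝ) : ℂ) * polyEval H y) x =
      2 * f₁ * ((x i : ℂ) * (x i : ℂ)) * polyEval H x +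
      (f (‖x‖ ^ 2) : ℂ) * ((x i : ℂ) * polyEval (MvPolynomial.pderiv i H) x) := by
    rw [partialD_radial_mul hf, polyEval_mul, polyEval_X]; ring
  simp only [h, Finset.sum_add_distrib, ← Finset.mul_sum, ← Finset.sum_mul, hH.sum_mul_pderiv,
    ← ofReal_norm_sq]
  push_cast
  ring

/-- The radial part of the operator `L` on functions `f(r²) H` with `H` a solid harmonic of
degree `k`, in terms of `w = r²` and the values `f₀, f₁, f₂` of `f, f', f''` at `w`. -/
def radOp (n : ℕ) (ℓ : ℝ) (k : ℕ) (w f₀ f₁ f₂ : ℝ) : ℝ :=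
  4 * w * f₂ + (2 * n + 4 * k) * f₁ +
    (4 * w ^ 2 * f₂ + (4 + 4 * k + 2 * n) * w * f₁ + k * (k + n) * f₀) / ℓ ^ 2

theorem divOp_radial_mul {k : ℕ} {H : MvPolynomial (Fin n) ℂ}
    (hH : IsSolidHarmonic k H) {f f₁ : ℝ → ℝ} {f₂ : ℝ} {x : EuclideanSpace ℝ (Fin n)}
    (hf : ∀ᶠ w in nhds (‖x‖ ^ 2), HasDerivAt f (f₁ w) w) (hf₁ : HasDerivAt f₁ f₂ (‖x‖ ^ 2)) :
    divOp ℓ (fun y => ((f (‖y‖ ^ 2) : ℝ) : ℂ) * polyEval H y) x =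
      (radOp n ℓ k (‖x‖ ^ 2) (f (‖x‖ ^ 2)) (f₁ (‖x‖ ^ 2)) f₂ : ℝ) * polyEval H x := by
  set w₀ := ‖x‖ ^ 2 with hw₀
  -- by Euler's identity `(x · ∇)(f(r²) H) / ℓ² = g(r²) H`
  set g : ℝ → ℝ := fun w => (2 * w * f₁ w + k * f w) / ℓ ^ 2 with hg
  set g' : ℝ := (2 * f₁ w₀ + 2 * w₀ * f₂ + k * f₁ w₀) / ℓ ^ 2 with hg'
  have hgd : HasDerivAt g g' w₀ := by
    have := ((((hasDerivAt_id w₀).const_mul 2).mul hf₁).add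
      (hf.self_of_nhds.const_mul (k : ℝ))).div_const (ℓ ^ 2)
    exact this.congr_deriv (by simp [hg'])
  have h1 (i : Fin n) : partialD i (fun y => partialD i (fun y => ((f (‖y‖ ^ 2) : ℝ) : ℂ) *
      polyEval H y) y + (y i / ℓ ^ 2) • ∑ j, y j • partialD j (fun y => ((f (‖y‖ ^ 2) : ℝ) : ℂ) *
      polyEval H y) y) x = partialD i (partialD i fun y => ((f (‖y‖ ^ 2) : ℝ) : ℂ) * polyEval H y) x
      + (2 * (g' : ℂ) * ((x i : ℂ) * (x i : ℂ)) * polyEval H x + (g w₀ : ℂ) * polyEval H x +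
        (g w₀ : ℂ) * ((x i : ℂ) * polyEval (MvPolynomial.pderiv i H) x)) := by
    have e : (fun y => partialD i (fun y => ((f (‖y‖ ^ 2) : ℝ) : ℂ) *
        polyEval H y) y + (y i / ℓ ^ 2) • ∑ j, y j • partialD j (fun y => ((f (‖y‖ ^ 2) : ℝ) : ℂ) *
        polyEval H y) y) =ᶠ[nhds x] fun y => partialD i (fun y => ((f (‖y‖ ^ 2) : ℝ) : ℂ) *
        polyEval H y) y + ((g (‖y‖ ^ 2) : ℝ) : ℂ) * polyEval (MvPolynomial.X i * H) y := by
      filter_upwards [eventually_norm_sq hf] with y hy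
      simp only [Complex.real_smul]
      rw [sum_mul_partialD_radial_mul hH hy, polyEval_mul, polyEval_X, hg]
      push_cast
      ring
    have hd : DifferentiableAt ℝ (partialD i fun y => ((f (‖y‖ ^ 2) : ℝ) : ℂ) * polyEval H y) x :=
      ((differentiableAt_radial_mul (hf₁.const_mul 2) _).add
        (differentiableAt_radial_mul hf.self_of_nhds _)).congr_of_eventuallyEq
          (partialD_radial_mul_eventuallyEq hf H i)
    rw [partialD_congr i e, partialD_add i hd (differentiableAt_radial_mul hgd _),
      partialD_radial_mul hgd]
    simp only [Derivation.leibniz, MvPolynomial.pderiv_X_self, smul_eq_mul, polyEval_mul,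
      polyEval_add, polyEval_X, mul_one]
    ring
  unfold divOp
  simp only [h1, Finset.sum_add_distrib, ← Finset.mul_sum, ← Finset.sum_mul, hH.sum_mul_pderiv,
    ← ofReal_norm_sq, sum_partialD_partialD_radial_mul hH hf hf₁]
  simp only [radOp, hg, hg', hw₀, Finset.sum_const, Finset.card_univ, Fintype.card_fin,
    nsmul_eq_mul]
  push_cast
  ring

/-- The Laplacian of a twice continuously differentiable function is the sum of its second partial
derivatives. -/
theorem laplacian_eq_sum_partialD {f : EuclideanSpace ℝ (Fin n) → ℂ}
    {x : EuclideanSpace ℝ (Fin n)} (hf : ContDiffAt ℝ 2 f x) :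
    Laplacian.laplacian f x = ∑ i, partialD i (partialD i f) x := by
  rw [InnerProductSpace.laplacian_eq_iteratedFDeriv_orthonormalBasis f
    (EuclideanSpace.basisFun (Fin n) ℝ)]
  refine Finset.sum_congr rfl fun i _ => ?_
  rw [iteratedFDeriv_two_apply]
  have hd : DifferentiableAt ℝ (fderiv ℝ f) x :=
    (hf.fderiv_right (m := 1) (by norm_num)).differentiableAt (by norm_num)
  unfold partialD
  rw [fderiv_clm_apply hd (differentiableAt_const _)]
  simp

/-! ### The angular factor -/

theorem eval_mul_of_isHomogeneous {k : ℕ} {H : MvPolynomial (Fin n) ℂ} (hH : H.IsHomogeneous k)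
    (c : ℂ) (v : Fin n → ℂ) :
    MvPolynomial.eval (fun i => c * v i) H = c ^ k * MvPolynomial.eval v H := by
  rw [MvPolynomial.eval_eq', MvPolynomial.eval_eq', Finset.mul_sum]
  refine Finset.sum_congr rfl fun d hd => ?_
  have hdeg : d.degree = k := by
    by_contra h
    exact MvPolynomial.mem_support_iff.mp hd (hH.coeff_eq_zero h)
  rw [Finsupp.degree_eq_sum] at hdeg
  simp only [mul_pow, Finset.prod_mul_distrib, Finset.prod_pow_eq_pow_sum, hdeg]
  ring

theorem angular_eq {k : ℕ} {H : MvPolynomial (Fin n) ℂ} (hH : H.IsHomogeneous k)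
    (x : EuclideanSpace ℝ (Fin n)) : angular H x = ((‖x‖ : ℂ)⁻¹) ^ k * polyEval H x := by
  unfold angular polyEval
  rw [← eval_mul_of_isHomogeneous hH]
  simp

theorem norm_pow_mul_angular {k : ℕ} {H : MvPolynomial (Fin n) ℂ} (hH : H.IsHomogeneous k)
    (x : EuclideanSpace ℝ (Fin n)) : (‖x‖ : ℂ) ^ k * angular H x = polyEval H x := by
  have h : angular H x = MvPolynomial.eval (fun i => (‖x‖ : ℂ)⁻¹ * ((x i : ℝ) : ℂ)) H := by
    simp [angular]
  rw [h, ← eval_mul_of_isHomogeneous hH, polyEval]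
  congr 2
  funext i
  by_cases hx : x = 0
  · simp [hx]
  · have : (‖x‖ : ℂ) ≠ 0 := by exact_mod_cast norm_ne_zero_iff.mpr hx
    field_simp

/-- A spherical harmonic of degree `k` is an eigenfunction of the Laplacian on the sphere. -/
theorem laplacian_angular {k : ℕ} {H : MvPolynomial (Fin n) ℂ} (hH : IsSolidHarmonic k H)
    {θ : EuclideanSpace ℝ (Fin n)} (hθ : ‖θ‖ = 1) :
    Laplacian.laplacian (angular H) θ = -((k : ℂ) * ((k : ℂ) + (n : ℂ) - 2)) * angular H θ := by
  set c : ℝ := -(k : ℝ) / 2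
  have hpos : (0 : ℝ) < ‖θ‖ ^ 2 := by rw [hθ]; norm_num
  have e : angular H =ᶠ[nhds θ] fun y => (((‖y‖ ^ 2) ^ c : ℝ) : ℂ) * polyEval H y := by
    filter_upwards [eventually_norm_sq (lt_mem_nhds hpos)] with y hy
    have hy' : 0 < ‖y‖ := by by_contra h; simp at h; simp [h] at hy
    rw [angular_eq hH.1, ← Real.rpow_natCast, ← Real.rpow_mul hy'.le]
    have : ((2 : ℕ) : ℝ) * c = -(k : ℝ) := by simp only [c]; push_cast; ring
    rw [this, Real.rpow_neg hy'.le, Real.rpow_natCast]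
    push_cast
    rw [inv_pow]
  have hd (a : ℝ) {w : ℝ} (hw : 0 < w) : HasDerivAt (fun w : ℝ => w ^ a) (a * w ^ (a - 1)) w :=
    Real.hasDerivAt_rpow_const (Or.inl hw.ne')
  have hC : ContDiffAt ℝ 2 (fun y => (((‖y‖ ^ 2) ^ c : ℝ) : ℂ) * polyEval H y) θ :=
    (Complex.ofRealCLM.contDiff.contDiffAt.comp θ
      ((contDiff_norm_sq ℝ).contDiffAt.rpow_const_of_ne hpos.ne')).mul
      (contDiff_polyEval H).contDiffAt
  rw [(InnerProductSpace.laplacian_congr_nhds e).self_of_nhds, laplacian_eq_sum_partialD hC,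
    sum_partialD_partialD_radial_mul hH (f := fun w => w ^ c) (f₁ := fun w => c * w ^ (c - 1))
      ((lt_mem_nhds hpos).mono fun w hw => hd c hw) ((hd (c - 1) hpos).const_mul c), angular_eq hH.1,
    hθ]
  simp [c]
  ring

/-! ### Weighted integrability -/

/-- The weighted `L²` condition in terms of Lebesgue measure: `ρ^{2δ-1} dμ_g` is a constant multiple
of `(ℓ² + r²)^{-δ} dx`. -/
theorem memWeightedL2_iff (hℓ : 0 < ℓ) {δ : ℝ} {ψ : EuclideanSpace ℝ (Fin n) → ℂ} :
    MemWeightedL2 ℓ (δ - 1 / 2) ψ ↔ AEStronglyMeasurable ψ volume ∧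
      Integrable (fun x => (ℓ ^ 2 + ‖x‖ ^ 2) ^ (-δ) * ‖ψ x‖ ^ 2) volume := by
  set d₁ : EuclideanSpace ℝ (Fin n) → ENNReal :=
    fun x => ENNReal.ofReal (Real.sqrt (metric ℓ x).det) with hd₁
  set d₂ : EuclideanSpace ℝ (Fin n) → ENNReal :=
    fun x => ENNReal.ofReal (bdryDef ℓ x ^ (2 * (δ - 1 / 2))) with hd₂
  have hm₁ : Measurable d₁ := measurable_sqrt_det hℓ
  have hm₂ : Measurable d₂ :=
    ENNReal.measurable_ofReal.comp (continuous_lapse.measurable.inv.pow_const _)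
  have hp₁ (x : EuclideanSpace ℝ (Fin n)) : 0 < Real.sqrt (metric ℓ x).det := by
    rw [sqrt_det_metric hℓ]; exact inv_pos.mpr (lapse_pos x)
  have hp₂ (x : EuclideanSpace ℝ (Fin n)) : 0 < bdryDef ℓ x ^ (2 * (δ - 1 / 2)) :=
    Real.rpow_pos_of_pos (inv_pos.mpr (lapse_pos x)) _
  have ac₁ : riemMeasure n ℓ ≪ volume := withDensity_absolutelyContinuous _ _
  have ac₂ : (riemMeasure n ℓ).withDensity d₂ ≪ riemMeasure n ℓ :=
    withDensity_absolutelyContinuous _ _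
  have ac₃ : volume ≪ riemMeasure n ℓ := withDensity_absolutelyContinuous' hm₁.aemeasurable
    (Filter.Eventually.of_forall fun x => (ENNReal.ofReal_pos.mpr (hp₁ x)).ne')
  have ac₄ : riemMeasure n ℓ ≪ (riemMeasure n ℓ).withDensity d₂ :=
    withDensity_absolutelyContinuous' hm₂.aemeasurable
    (Filter.Eventually.of_forall fun x => (ENNReal.ofReal_pos.mpr (hp₂ x)).ne')
  have key (hψ : AEStronglyMeasurable ψ volume) :
      MemLp ψ 2 ((riemMeasure n ℓ).withDensity d₂) ↔
        Integrable (fun x => (ℓ ^ 2 + ‖x‖ ^ 2) ^ (-δ) * ‖ψ x‖ ^ 2) volume := by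
    rw [memLp_two_iff_integrable_sq_norm (hψ.mono_ac (ac₂.trans ac₁)),
      integrable_withDensity_iff_integrable_smul' hm₂
        (Filter.Eventually.of_forall fun _ => ENNReal.ofReal_lt_top), riemMeasure,
      integrable_withDensity_iff_integrable_smul' hm₁
        (Filter.Eventually.of_forall fun _ => ENNReal.ofReal_lt_top)]
    have e : (fun x => (d₁ x).toReal • (d₂ x).toReal • ‖ψ x‖ ^ 2) =
        fun x => (ℓ ^ 2) ^ δ * ((ℓ ^ 2 + ‖x‖ ^ 2) ^ (-δ) * ‖ψ x‖ ^ 2) := by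
      funext x
      have hV := lapse_pos (ℓ := ℓ) x
      have hu := sq_add_norm_sq_pos hℓ x
      have h1 : (lapse ℓ x)⁻¹ * bdryDef ℓ x ^ (2 * (δ - 1 / 2)) =
          (ℓ ^ 2) ^ δ * (ℓ ^ 2 + ‖x‖ ^ 2) ^ (-δ) := by
        have h2 : bdryDef ℓ x ^ (2 * (δ - 1 / 2)) = (lapse ℓ x ^ 2) ^ (-δ) * lapse ℓ x := by
          rw [bdryDef, Real.inv_rpow hV.le, ← Real.rpow_neg hV.le, ← Real.rpow_natCast,
            ← Real.rpow_mul hV.le]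
          conv_rhs => rw [← Real.rpow_one (lapse ℓ x), ← Real.rpow_mul hV.le]
          rw [← Real.rpow_add hV]
          congr 1
          push_cast
          ring
        rw [h2, lapse_sq hℓ, Real.div_rpow hu.le (by positivity), Real.rpow_neg (sq_nonneg ℓ)]
        field_simp
      simp only [hd₁, hd₂, smul_eq_mul]
      rw [ENNReal.toReal_ofReal (hp₁ x).le, ENNReal.toReal_ofReal (hp₂ x).le,
        sqrt_det_metric hℓ, ← mul_assoc, h1, mul_assoc]
    rw [e]
    exact integrable_const_mul_iff (IsUnit.mk0 _ (by positivity)) _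
  constructor
  · intro h
    have hψ : AEStronglyMeasurable ψ volume := h.1.mono_ac (ac₃.trans ac₄)
    exact ⟨hψ, (key hψ).mp h⟩
  · rintro ⟨hψ, h⟩
    exact (key hψ).mpr h

theorem integrable_rpow_sq_add_norm_sq (hℓ : 0 < ℓ) {a : ℝ} (ha : (n : ℝ) / 2 < a) :
    Integrable (fun x : EuclideanSpace ℝ (Fin n) => (ℓ ^ 2 + ‖x‖ ^ 2) ^ (-a)) volume := by
  have ha0 : 0 < a := lt_of_le_of_lt (by positivity) ha
  have h1 : Integrable (fun x : EuclideanSpace ℝ (Fin n) => ((1 : ℝ) + ‖x‖ ^ 2) ^ (-(2 * a) / 2))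
      volume := integrable_rpow_neg_one_add_norm_sq (by rw [finrank_euclideanSpace_fin]; linarith)
  set m := min (ℓ ^ 2) 1 with hm
  have hmp : 0 < m := by positivity
  refine (h1.const_mul (m ^ (-a))).mono' ?_ (Filter.Eventually.of_forall fun x => ?_)
  · refine Continuous.aestronglyMeasurable ?_
    exact Continuous.rpow_const (by fun_prop) fun x => Or.inl (sq_add_norm_sq_pos hℓ x).ne'
  · have hu := sq_add_norm_sq_pos hℓ x
    rw [Real.norm_of_nonneg (by positivity), show -(2 * a) / 2 = -a by ring,
      ← Real.mul_rpow hmp.le (by positivity)]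
    refine Real.rpow_le_rpow_of_nonpos (by positivity) ?_ (by linarith)
    have : m ≤ ℓ ^ 2 := min_le_left _ _
    have : m ≤ 1 := min_le_right _ _
    nlinarith [sq_nonneg ‖x‖]

theorem continuous_rpow_sq_add_norm_sq (hℓ : 0 < ℓ) (a : ℝ) :
    Continuous fun x : EuclideanSpace ℝ (Fin n) => (ℓ ^ 2 + ‖x‖ ^ 2) ^ a :=
  Continuous.rpow_const (by fun_prop) fun x => Or.inl (sq_add_norm_sq_pos hℓ x).ne'

/-- By the Cauchy–Schwarz inequality, `(ℓ² + r²)^{-a} ψ` is integrable for `a` large enough. -/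
theorem integrable_rpow_mul_norm (hℓ : 0 < ℓ) {a δ : ℝ} (ha : (n : ℝ) / 2 < 2 * a - δ)
    {ψ : EuclideanSpace ℝ (Fin n) → ℂ} (hψ : MemWeightedL2 ℓ (δ - 1 / 2) ψ) :
    Integrable (fun x => (ℓ ^ 2 + ‖x‖ ^ 2) ^ (-a) * ‖ψ x‖) volume := by
  obtain ⟨hm, hi⟩ := (memWeightedL2_iff hℓ).mp hψ
  refine (hi.add (integrable_rpow_sq_add_norm_sq hℓ ha)).mono'
    ((continuous_rpow_sq_add_norm_sq hℓ _).aestronglyMeasurable.mul hm.norm)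
    (Filter.Eventually.of_forall fun x => ?_)
  have hu := sq_add_norm_sq_pos hℓ x
  rw [Real.norm_of_nonneg (by positivity)]
  have h1 : (ℓ ^ 2 + ‖x‖ ^ 2) ^ (-a) =
      (ℓ ^ 2 + ‖x‖ ^ 2) ^ (-δ / 2) * (ℓ ^ 2 + ‖x‖ ^ 2) ^ (-(2 * a - δ) / 2) := by
    rw [← Real.rpow_add hu]; congr 1; ring
  have h2 (c : ℝ) : (ℓ ^ 2 + ‖x‖ ^ 2) ^ c = ((ℓ ^ 2 + ‖x‖ ^ 2) ^ (c / 2)) ^ 2 := by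
    rw [← Real.rpow_mul_natCast hu.le]; congr 1; push_cast; ring
  simp only [Pi.add_apply]
  -- the inequality is `p q ≤ p² + q²` with `p = u^{-δ/2} |ψ|` and `q = u^{-(2a-δ)/2}`
  rw [h1, h2 (-δ), h2 (-(2 * a - δ))]
  nlinarith [sq_nonneg ((ℓ ^ 2 + ‖x‖ ^ 2) ^ (-δ / 2) * ‖ψ x‖ -
    (ℓ ^ 2 + ‖x‖ ^ 2) ^ (-(2 * a - δ) / 2)), sq_nonneg ((ℓ ^ 2 + ‖x‖ ^ 2) ^ (-δ / 2) * ‖ψ x‖),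
    sq_nonneg ((ℓ ^ 2 + ‖x‖ ^ 2) ^ (-(2 * a - δ) / 2))]

/-- `h` is continuous and of size `O((ℓ² + r²)^{-a})`. -/
def HasDecay (ℓ a : ℝ) (h : EuclideanSpace ℝ (Fin n) → ℂ) : Prop :=
  Continuous h ∧ ∃ C : ℝ, ∀ x, ‖h x‖ ≤ C * (ℓ ^ 2 + ‖x‖ ^ 2) ^ (-a)

theorem HasDecay.integrable_mul (hℓ : 0 < ℓ) {a δ : ℝ} (ha : (n : ℝ) / 2 < 2 * a - δ)
    {h ψ : EuclideanSpace ℝ (Fin n) → ℂ} (hh : HasDecay ℓ a h)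
    (hψ : MemWeightedL2 ℓ (δ - 1 / 2) ψ) : Integrable (fun x => h x * ψ x) volume := by
  obtain ⟨hc, C, hC⟩ := hh
  refine ((integrable_rpow_mul_norm hℓ ha hψ).const_mul C).mono'
    (hc.aestronglyMeasurable.mul ((memWeightedL2_iff hℓ).mp hψ).1)
    (Filter.Eventually.of_forall fun x => ?_)
  rw [norm_mul, ← mul_assoc]
  exact mul_le_mul_of_nonneg_right (hC x) (norm_nonneg _)

theorem HasDecay.of_hasCompactSupport (hℓ : 0 < ℓ) {a : ℝ} {h : EuclideanSpace ℝ (Fin n) → ℂ}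
    (hc : Continuous h) (hs : HasCompactSupport h) : HasDecay ℓ a h := by
  refine ⟨hc, ?_⟩
  have hk : Continuous fun x => ‖h x‖ * (ℓ ^ 2 + ‖x‖ ^ 2) ^ a :=
    hc.norm.mul (continuous_rpow_sq_add_norm_sq hℓ a)
  obtain ⟨C, hC⟩ := hk.bounded_above_of_compact_support (hs.norm.mul_right)
  refine ⟨C, fun x => ?_⟩
  have hu := sq_add_norm_sq_pos hℓ x
  have h1 := (le_abs_self _).trans (hC x)
  rwa [Real.rpow_neg hu.le, ← div_eq_mul_inv, le_div_iff₀ (by positivity)]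

theorem MemWeightedL2.integrable_mul (hℓ : 0 < ℓ) {δ : ℝ} {h ψ : EuclideanSpace ℝ (Fin n) → ℂ}
    (hψ : MemWeightedL2 ℓ (δ - 1 / 2) ψ) (hc : Continuous h) (hs : HasCompactSupport h) :
    Integrable (fun x => h x * ψ x) volume := by
  refine (HasDecay.of_hasCompactSupport hℓ hc hs).integrable_mul hℓ
    (a := (n : ℝ) / 2 + |δ| + 1) ?_ hψ
  have := le_abs_self δ
  have := abs_nonneg δ
  have : (0 : ℝ) ≤ n := n.cast_nonneg
  linarith

theorem HasDecay.add {a : ℝ} {h₁ h₂ : EuclideanSpace ℝ (Fin n) → ℂ}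
    (hh₁ : HasDecay ℓ a h₁) (hh₂ : HasDecay ℓ a h₂) : HasDecay ℓ a (h₁ + h₂) := by
  obtain ⟨c₁, C₁, hC₁⟩ := hh₁
  obtain ⟨c₂, C₂, hC₂⟩ := hh₂
  refine ⟨c₁.add c₂, C₁ + C₂, fun x => ?_⟩
  rw [add_mul]
  exact (norm_add_le _ _).trans (add_le_add (hC₁ x) (hC₂ x))

theorem HasDecay.const_smul {a : ℝ} {h : EuclideanSpace ℝ (Fin n) → ℂ}
    (hh : HasDecay ℓ a h) (c : ℂ) : HasDecay ℓ a (c • h) := by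
  obtain ⟨hc, C, hC⟩ := hh
  refine ⟨hc.const_smul c, ‖c‖ * C, fun x => ?_⟩
  rw [Pi.smul_apply, norm_smul, mul_assoc]
  exact mul_le_mul_of_nonneg_left (hC x) (norm_nonneg _)

/-- A homogeneous polynomial of degree `k` grows at most like `(ℓ² + r²)^{k/2}`. -/
theorem exists_norm_polyEval_le (hℓ : 0 < ℓ) {k : ℕ} {H : MvPolynomial (Fin n) ℂ}
    (hH : H.IsHomogeneous k) :
    ∃ C : ℝ, ∀ x : EuclideanSpace ℝ (Fin n),
      ‖polyEval H x‖ ≤ C * (ℓ ^ 2 + ‖x‖ ^ 2) ^ ((k : ℝ) / 2) := by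
  obtain ⟨C, hC⟩ := (isCompact_closedBall (0 : EuclideanSpace ℝ (Fin n)) 1).exists_bound_of_continuousOn
    (contDiff_polyEval H (m := 0)).continuous.continuousOn
  refine ⟨C, fun x => ?_⟩
  have hu := sq_add_norm_sq_pos hℓ x
  have hC0 : 0 ≤ C := (norm_nonneg _).trans (hC 0 (by simp))
  have h1 : ‖angular H x‖ ≤ C := by
    refine hC (‖x‖⁻¹ • x) ?_
    rw [mem_closedBall_zero_iff, norm_smul, norm_inv, norm_norm]
    exact inv_mul_le_one
  have h2 : ‖x‖ ^ k ≤ (ℓ ^ 2 + ‖x‖ ^ 2) ^ ((k : ℝ) / 2) := by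
    have : ‖x‖ ^ k = (‖x‖ ^ 2) ^ ((k : ℝ) / 2) := by
      rw [← Real.rpow_natCast, ← Real.rpow_natCast, ← Real.rpow_mul (norm_nonneg x)]
      congr 1; push_cast; ring
    rw [this]
    exact Real.rpow_le_rpow (sq_nonneg _) (by nlinarith [sq_nonneg ℓ]) (by positivity)
  rw [← norm_pow_mul_angular hH, norm_mul, norm_pow, Complex.norm_real, norm_norm, mul_comm]
  exact mul_le_mul h1 h2 (by positivity) hC0

theorem hasDecay_rpow_mul_polyEval (hℓ : 0 < ℓ) {k : ℕ} {H : MvPolynomial (Fin n) ℂ}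
    (hH : H.IsHomogeneous k) {a b : ℝ} (hab : a + k / 2 ≤ b) :
    HasDecay ℓ a fun x => (((ℓ ^ 2 + ‖x‖ ^ 2) ^ (-b) : ℝ) : ℂ) * polyEval H x := by
  obtain ⟨C, hC⟩ := exists_norm_polyEval_le hℓ hH
  refine ⟨(Complex.continuous_ofReal.comp (continuous_rpow_sq_add_norm_sq hℓ _)).mul
    (contDiff_polyEval H (m := 0)).continuous, (ℓ ^ 2) ^ (a + k / 2 - b) * C, fun x => ?_⟩
  have hu := sq_add_norm_sq_pos hℓ x
  have hl : ℓ ^ 2 ≤ ℓ ^ 2 + ‖x‖ ^ 2 := by nlinarith [sq_nonneg ‖x‖]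
  have hC0 : 0 ≤ C := by
    by_contra h
    push Not at h
    have := hC x
    have h3 := norm_nonneg (polyEval H x)
    have h4 : 0 < (ℓ ^ 2 + ‖x‖ ^ 2) ^ ((k : ℝ) / 2) := by positivity
    nlinarith
  rw [norm_mul, Complex.norm_real, Real.norm_of_nonneg (by positivity)]
  have h1 : (ℓ ^ 2 + ‖x‖ ^ 2) ^ (a + k / 2 - b) ≤ (ℓ ^ 2) ^ (a + k / 2 - b) :=
    Real.rpow_le_rpow_of_nonpos (by positivity) hl (by linarith)
  calc (ℓ ^ 2 + ‖x‖ ^ 2) ^ (-b) * ‖polyEval H x‖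
      ≤ (ℓ ^ 2 + ‖x‖ ^ 2) ^ (-b) * (C * (ℓ ^ 2 + ‖x‖ ^ 2) ^ ((k : ℝ) / 2)) := by
        gcongr; exact hC x
    _ = (ℓ ^ 2 + ‖x‖ ^ 2) ^ (a + k / 2 - b) * C * (ℓ ^ 2 + ‖x‖ ^ 2) ^ (-a) := by
        rw [show (ℓ ^ 2 + ‖x‖ ^ 2) ^ (-b) = (ℓ ^ 2 + ‖x‖ ^ 2) ^ (a + k / 2 - b) *
          (ℓ ^ 2 + ‖x‖ ^ 2) ^ (-((k : ℝ) / 2)) * (ℓ ^ 2 + ‖x‖ ^ 2) ^ (-a) by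
            rw [← Real.rpow_add hu, ← Real.rpow_add hu]; congr 1; ring,
          Real.rpow_neg hu.le ((k : ℝ) / 2)]
        field_simp
    _ ≤ _ := by gcongr

/-- Decaying functions lie in the weighted space. -/
theorem HasDecay.memWeightedL2 (hℓ : 0 < ℓ) {a δ : ℝ} (ha : (n : ℝ) / 2 < 2 * a + δ)
    {h : EuclideanSpace ℝ (Fin n) → ℂ} (hh : HasDecay ℓ a h) :
    MemWeightedL2 ℓ (δ - 1 / 2) h := by
  obtain ⟨hc, C, hC⟩ := hh
  refine (memWeightedL2_iff hℓ).mpr ⟨hc.aestronglyMeasurable, ?_⟩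
  refine ((integrable_rpow_sq_add_norm_sq hℓ ha).const_mul (C ^ 2)).mono'
    ((continuous_rpow_sq_add_norm_sq hℓ _).mul (hc.norm.pow 2)).aestronglyMeasurable
    (Filter.Eventually.of_forall fun x => ?_)
  have hu := sq_add_norm_sq_pos hℓ x
  rw [Real.norm_of_nonneg (by positivity)]
  have h1 : ‖h x‖ ^ 2 ≤ C ^ 2 * (ℓ ^ 2 + ‖x‖ ^ 2) ^ (-(2 * a)) := by
    have := pow_le_pow_left₀ (norm_nonneg _) (hC x) 2
    rwa [mul_pow, ← Real.rpow_mul_natCast hu.le, show -a * ((2 : ℕ) : ℝ) = -(2 * a) by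
      push_cast; ring] at this
  calc _ ≤ (ℓ ^ 2 + ‖x‖ ^ 2) ^ (-δ) * (C ^ 2 * (ℓ ^ 2 + ‖x‖ ^ 2) ^ (-(2 * a))) := by gcongr
    _ = _ := by
      rw [show -(2 * a + δ) = -δ + -(2 * a) by ring, Real.rpow_add hu]; ring

/-! ### The weak equation -/

theorem contDiff_partialD {F : Type*} [NormedAddCommGroup F] [NormedSpace ℝ F] (i : Fin n)
    {f : EuclideanSpace ℝ (Fin n) → F} (hf : ContDiff ℝ (⊤ : ℕ∞) f) :
    ContDiff ℝ (⊤ : ℕ∞) (partialD i f) :=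
  (hf.fderiv_right (m := (⊤ : ℕ∞)) (by norm_cast)).clm_apply contDiff_const

theorem hasCompactSupport_partialD {F : Type*} [NormedAddCommGroup F] [NormedSpace ℝ F] (i : Fin n)
    {f : EuclideanSpace ℝ (Fin n) → F} (hf : HasCompactSupport f) :
    HasCompactSupport (partialD i f) :=
  hf.fderiv_apply ℝ _

theorem partialD_clm_comp {F G : Type*} [NormedAddCommGroup F] [NormedSpace ℝ F]
    [NormedAddCommGroup G] [NormedSpace ℝ G] (L : F →L[ℝ] G) (i : Fin n)
    {f : EuclideanSpace ℝ (Fin n) → F} {x : EuclideanSpace ℝ (Fin n)}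
    (hf : DifferentiableAt ℝ f x) : partialD i (fun y => L (f y)) x = L (partialD i f x) := by
  unfold partialD
  have := (L.hasFDerivAt.comp x hf.hasFDerivAt).fderiv
  rw [show (fun y => L (f y)) = L ∘ f from rfl, this]
  rfl

/-- The flux `∂_i f + x_i / ℓ² (x · ∇f)`, of which `L f` is the divergence. -/
def flux {F : Type*} [NormedAddCommGroup F] [NormedSpace ℝ F] (ℓ : ℝ)
    (f : EuclideanSpace ℝ (Fin n) → F) (i : Fin n) (y : EuclideanSpace ℝ (Fin n)) : F :=
  partialD i f y + (y i / ℓ ^ 2) • ∑ j, y j • partialD j f y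

section

variable {F : Type*} [NormedAddCommGroup F] [NormedSpace ℝ F]
  {f : EuclideanSpace ℝ (Fin n) → F}

theorem contDiff_flux (hf : ContDiff ℝ (⊤ : ℕ∞) f) (i : Fin n) :
    ContDiff ℝ (⊤ : ℕ∞) (flux ℓ f i) := by
  unfold flux
  refine (contDiff_partialD i hf).add (ContDiff.smul (by fun_prop) (ContDiff.sum fun j _ => ?_))
  exact ContDiff.smul (by fun_prop) (contDiff_partialD j hf)

theorem hasCompactSupport_flux (hf : HasCompactSupport f) (i : Fin n) :
    HasCompactSupport (flux ℓ f i) := by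
  refine HasCompactSupport.intro hf fun y hy => ?_
  have : fderiv ℝ f y = 0 := fderiv_of_notMem_tsupport (𝕜 := ℝ) hy
  simp [flux, partialD, this]

theorem divOp_eq (x : EuclideanSpace ℝ (Fin n)) :
    divOp ℓ f x = ∑ i, partialD i (flux ℓ f i) x := rfl

theorem contDiff_divOp (hf : ContDiff ℝ (⊤ : ℕ∞) f) : ContDiff ℝ (⊤ : ℕ∞) (divOp ℓ f) :=
  ContDiff.sum fun i _ => contDiff_partialD i (contDiff_flux hf i)

theorem hasCompactSupport_divOp (hf : HasCompactSupport f) : HasCompactSupport (divOp ℓ f) := by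
  have h (s : Finset (Fin n)) :
      HasCompactSupport fun x => ∑ i ∈ s, partialD i (flux ℓ f i) x := by
    classical
    induction s using Finset.induction_on with
    | empty => simp only [Finset.sum_empty]; exact HasCompactSupport.zero
    | insert i s hi ih =>
      simp only [Finset.sum_insert hi]
      exact (hasCompactSupport_partialD i (hasCompactSupport_flux hf i)).add ih
  exact h Finset.univ

theorem divOp_clm_comp {G : Type*} [NormedAddCommGroup G] [NormedSpace ℝ G] (L : F →L[ℝ] G)
    (hf : ContDiff ℝ (⊤ : ℕ∞) f) (x : EuclideanSpace ℝ (Fin n)) :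
    divOp ℓ (fun y => L (f y)) x = L (divOp ℓ f x) := by
  have h1 (i : Fin n) : flux ℓ (fun y => L (f y)) i = fun y => L (flux ℓ f i y) := by
    funext y
    have hd : DifferentiableAt ℝ f y := hf.differentiable (by norm_num) y
    simp [flux, partialD_clm_comp L _ hd]
  rw [divOp_eq, divOp_eq, map_sum]
  refine Finset.sum_congr rfl fun i _ => ?_
  rw [h1, partialD_clm_comp L i ((contDiff_flux hf i).differentiable (by norm_num) x)]

end

/-- The zeroth-order coefficient of the equation `L ψ = q ψ`, where `q = G'(0) - ω² / V²`. -/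
def potential (ℓ G₁ ω : ℝ) (x : EuclideanSpace ℝ (Fin n)) : ℝ :=
  G₁ - ω ^ 2 * ℓ ^ 2 / (ℓ ^ 2 + ‖x‖ ^ 2)

theorem continuous_potential (hℓ : 0 < ℓ) (G₁ ω : ℝ) :
    Continuous (potential ℓ G₁ ω : EuclideanSpace ℝ (Fin n) → ℝ) :=
  continuous_const.sub (continuous_const.div (by fun_prop) fun x => (sq_add_norm_sq_pos hℓ x).ne')

/-- The weak equation in terms of Lebesgue measure: the weight `V⁻¹ dμ_g` and the factor `V²` of `P`
cancel. -/
theorem isEigensolution_iff (hℓ : 0 < ℓ) {G₁ δ ω : ℝ} {ψ : EuclideanSpace ℝ (Fin n) → ℂ} :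
    IsEigensolution n ℓ G₁ δ ω ψ ↔ MemWeightedL2 ℓ (δ - 1 / 2) ψ ∧
      ∀ φ : EuclideanSpace ℝ (Fin n) → ℝ, ContDiff ℝ (⊤ : ℕ∞) φ → HasCompactSupport φ →
        ∫ x, ((divOp ℓ φ x - potential ℓ G₁ ω x * φ x : ℝ) : ℂ) * ψ x = 0 := by
  refine and_congr_right fun hψ => forall_congr' fun φ => forall_congr' fun hφ =>
    forall_congr' fun hs => ?_
  rw [integral_riemMeasure hℓ, integral_riemMeasure hℓ]
  have e1 (x : EuclideanSpace ℝ (Fin n)) :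
      (lapse ℓ x)⁻¹ • (((lapse ℓ x)⁻¹ * opP ℓ φ x) • ψ x) = ((divOp ℓ φ x : ℝ) : ℂ) * ψ x := by
    have hV := (lapse_pos (ℓ := ℓ) x).ne'
    rw [opP_eq hℓ, smul_smul, smul_eq_mul, Complex.real_smul]
    congr 2
    field_simp
  have e2 (x : EuclideanSpace ℝ (Fin n)) :
      (lapse ℓ x)⁻¹ • (((lapse ℓ x)⁻¹ * ((-ω ^ 2 + lapse ℓ x ^ 2 * G₁) * φ x)) • ψ x) =
        ((potential ℓ G₁ ω x * φ x : ℝ) : ℂ) * ψ x := by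
    have hV := (lapse_pos (ℓ := ℓ) x).ne'
    have hu := (sq_add_norm_sq_pos hℓ x).ne'
    have h2 : potential ℓ G₁ ω x = (lapse ℓ x)⁻¹ * (lapse ℓ x)⁻¹ * (-ω ^ 2 + lapse ℓ x ^ 2 * G₁) := by
      rw [← mul_inv, ← sq, lapse_sq hℓ, potential]
      field_simp
      ring
    rw [smul_smul, Complex.real_smul, h2]
    congr 2
    ring
  have i1 : Integrable (fun x => ((divOp ℓ φ x : ℝ) : ℂ) * ψ x) volume :=
    hψ.integrable_mul hℓ (Complex.continuous_ofReal.comp (contDiff_divOp hφ).continuous)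
      ((hasCompactSupport_divOp hs).comp_left (g := Complex.ofReal) Complex.ofReal_zero)
  have i2 : Integrable (fun x => ((potential ℓ G₁ ω x * φ x : ℝ) : ℂ) * ψ x) volume :=
    hψ.integrable_mul hℓ (Complex.continuous_ofReal.comp
      ((continuous_potential hℓ G₁ ω).mul hφ.continuous))
      (hs.mul_left.comp_left (g := Complex.ofReal) Complex.ofReal_zero)
  simp only [e1, e2]
  rw [← sub_eq_zero, ← integral_sub i1 i2]
  simp only [Complex.ofReal_sub, sub_mul]

/-- The integrand of the weak equation is integrable. -/
theorem integrable_weak (hℓ : 0 < ℓ) {G₁ δ ω : ℝ} {ψ : EuclideanSpace ℝ (Fin n) → ℂ}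
    (hψ : MemWeightedL2 ℓ (δ - 1 / 2) ψ) {φ : EuclideanSpace ℝ (Fin n) → ℝ}
    (hφ : ContDiff ℝ (⊤ : ℕ∞) φ) (hs : HasCompactSupport φ) :
    Integrable (fun x => ((divOp ℓ φ x - potential ℓ G₁ ω x * φ x : ℝ) : ℂ) * ψ x) volume :=
  hψ.integrable_mul hℓ (Complex.continuous_ofReal.comp
    ((contDiff_divOp hφ).continuous.sub ((continuous_potential hℓ G₁ ω).mul hφ.continuous)))
    (HasCompactSupport.comp_left (g := Complex.ofReal)
      ((hasCompactSupport_divOp hs).sub hs.mul_left) Complex.ofReal_zero)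

/-- Complex-valued test functions may be used in the weak equation. -/
theorem IsEigensolution.integral_eq_zero (hℓ : 0 < ℓ) {G₁ δ ω : ℝ}
    {ψ : EuclideanSpace ℝ (Fin n) → ℂ} (hψ : IsEigensolution n ℓ G₁ δ ω ψ)
    {φ : EuclideanSpace ℝ (Fin n) → ℂ} (hφ : ContDiff ℝ (⊤ : ℕ∞) φ) (hs : HasCompactSupport φ) :
    ∫ x, (divOp ℓ φ x - potential ℓ G₁ ω x * φ x) * ψ x = 0 := by
  obtain ⟨hm, hw⟩ := (isEigensolution_iff hℓ).mp hψ
  have key (L : ℂ →L[ℝ] ℝ) : Integrable (fun x =>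
      ((divOp ℓ (fun y => L (φ y)) x - potential ℓ G₁ ω x * L (φ x) : ℝ) : ℂ) * ψ x) volume ∧
      ∫ x, ((divOp ℓ (fun y => L (φ y)) x - potential ℓ G₁ ω x * L (φ x) : ℝ) : ℂ) * ψ x = 0 := by
    have h1 : ContDiff ℝ (⊤ : ℕ∞) (fun y => L (φ y)) := L.contDiff.comp hφ
    have h2 : HasCompactSupport (fun y => L (φ y)) := hs.comp_left (g := L) (map_zero L)
    exact ⟨integrable_weak hℓ hm h1 h2, hw _ h1 h2⟩
  obtain ⟨i1, h1⟩ := key Complex.reCLM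
  obtain ⟨i2, h2⟩ := key Complex.imCLM
  have e (x : EuclideanSpace ℝ (Fin n)) : (divOp ℓ φ x - potential ℓ G₁ ω x * φ x) * ψ x =
      ((divOp ℓ (fun y => Complex.reCLM (φ y)) x - potential ℓ G₁ ω x * Complex.reCLM (φ x) : ℝ) : ℂ)
        * ψ x + Complex.I *
      (((divOp ℓ (fun y => Complex.imCLM (φ y)) x - potential ℓ G₁ ω x * Complex.imCLM (φ x) : ℝ) : ℂ)
        * ψ x) := by
    rw [divOp_clm_comp _ hφ, divOp_clm_comp _ hφ]
    simp only [Complex.reCLM_apply, Complex.imCLM_apply]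
    conv_lhs => rw [← Complex.re_add_im (divOp ℓ φ x), ← Complex.re_add_im (φ x)]
    push_cast
    ring
  simp only [e]
  rw [integral_add i1 (i2.const_mul _), integral_const_mul, h1, h2]
  simp

/-! ### The moment recursion -/

/-- A smooth cutoff: `1` on `(-∞, 1)`, `0` on `(2, ∞)`, with bounded first and second derivatives. -/
theorem exists_cutoff : ∃ (χ χ₁ χ₂ : ℝ → ℝ) (D : ℝ), ContDiff ℝ (⊤ : ℕ∞) χ ∧
    (∀ t, HasDerivAt χ (χ₁ t) t) ∧ (∀ t, HasDerivAt χ₁ (χ₂ t) t) ∧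
    (∀ t, t < 1 → χ t = 1 ∧ χ₁ t = 0 ∧ χ₂ t = 0) ∧ (∀ t, 2 < t → χ t = 0 ∧ χ₁ t = 0 ∧ χ₂ t = 0) ∧
    ∀ t, |χ t| ≤ D ∧ |χ₁ t| ≤ D ∧ |χ₂ t| ≤ D := by
  set χ : ℝ → ℝ := fun t => Real.smoothTransition (2 - t) with hχ
  have hc : ContDiff ℝ (⊤ : ℕ∞) χ := Real.smoothTransition.contDiff.comp (by fun_prop)
  have hc1 : ContDiff ℝ (⊤ : ℕ∞) (deriv χ) := by
    have := (contDiff_infty_iff_deriv (𝕜 := ℝ) (f := χ)).mp hc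
    exact this.2
  have hc2 : ContDiff ℝ (⊤ : ℕ∞) (deriv (deriv χ)) :=
    ((contDiff_infty_iff_deriv (𝕜 := ℝ)).mp hc1).2
  have hl (t : ℝ) (ht : t < 1) : χ t = 1 ∧ deriv χ t = 0 ∧ deriv (deriv χ) t = 0 := by
    have h0 (t : ℝ) (ht : t < 1) : χ t = 1 := Real.smoothTransition.one_of_one_le (by linarith)
    have h1 (t : ℝ) (ht : t < 1) : deriv χ t = 0 := by
      have : χ =ᶠ[nhds t] fun _ => 1 := (gt_mem_nhds ht).mono fun s hs => h0 s hs
      rw [this.deriv_eq, deriv_const]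
    have h2 : deriv χ =ᶠ[nhds t] fun _ => 0 := (gt_mem_nhds ht).mono fun s hs => h1 s hs
    exact ⟨h0 t ht, h1 t ht, by rw [h2.deriv_eq, deriv_const]⟩
  have hr (t : ℝ) (ht : 2 < t) : χ t = 0 ∧ deriv χ t = 0 ∧ deriv (deriv χ) t = 0 := by
    have h0 (t : ℝ) (ht : 2 < t) : χ t = 0 := Real.smoothTransition.zero_of_nonpos (by linarith)
    have h1 (t : ℝ) (ht : 2 < t) : deriv χ t = 0 := by
      have : χ =ᶠ[nhds t] fun _ => 0 := (lt_mem_nhds ht).mono fun s hs => h0 s hs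
      rw [this.deriv_eq, deriv_const]
    have h2 : deriv χ =ᶠ[nhds t] fun _ => 0 := (lt_mem_nhds ht).mono fun s hs => h1 s hs
    exact ⟨h0 t ht, h1 t ht, by rw [h2.deriv_eq, deriv_const]⟩
  obtain ⟨D₀, h₀⟩ := (isCompact_Icc (a := (1 : ℝ)) (b := 2)).exists_bound_of_continuousOn
    hc.continuous.continuousOn
  obtain ⟨D₁, h₁⟩ := (isCompact_Icc (a := (1 : ℝ)) (b := 2)).exists_bound_of_continuousOn
    hc1.continuous.continuousOn
  obtain ⟨D₂, h₂⟩ := (isCompact_Icc (a := (1 : ℝ)) (b := 2)).exists_bound_of_continuousOn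
    hc2.continuous.continuousOn
  refine ⟨χ, deriv χ, deriv (deriv χ), max 1 (max D₀ (max D₁ D₂)), hc,
    fun t => (hc.differentiable (by norm_num) t).hasDerivAt,
    fun t => (hc1.differentiable (by norm_num) t).hasDerivAt, hl, hr, fun t => ?_⟩
  rcases lt_or_ge t 1 with h | h
  · obtain ⟨a, b, c⟩ := hl t h
    simp [a, b, c]
  rcases lt_or_ge 2 t with h' | h'
  · obtain ⟨a, b, c⟩ := hr t h'
    simp [a, b, c]
  · have a := h₀ t ⟨h, h'⟩
    have b := h₁ t ⟨h, h'⟩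
    have c := h₂ t ⟨h, h'⟩
    rw [Real.norm_eq_abs] at a b c
    simp only [le_max_iff]
    exact ⟨.inr (.inl a), .inr (.inr (.inl b)), .inr (.inr (.inr c))⟩

/-- The equation applied to the power `(ℓ² + r²)^{-b}`; `U` stands for that power, so that
`-b U / u` and `b (b + 1) U / u²` are its first two derivatives. -/
theorem radOp_rpow (hℓ : 0 < ℓ) (k : ℕ) (b w G₁ ω U : ℝ) (hw : 0 ≤ w) :
    radOp n ℓ k w U (-b * (U / (ℓ ^ 2 + w))) (b * (b + 1) * (U / (ℓ ^ 2 + w) ^ 2)) -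
      (G₁ - ω ^ 2 * ℓ ^ 2 / (ℓ ^ 2 + w)) * U =
    ((2 * b - k) * (2 * b - k - n) / ℓ ^ 2 - G₁) * U +
      (ω ^ 2 * ℓ ^ 2 - 4 * b ^ 2) * (U / (ℓ ^ 2 + w)) := by
  have hu : 0 < ℓ ^ 2 + w := by positivity
  unfold radOp
  field_simp
  ring

/-- The error made by a cutoff is bounded by the function that is cut off: `α₀`, `α₁ / u`,
`α₂ / u²` stand for the values of the cutoff and its derivatives. -/
theorem exists_radOp_cutoff_bound (n : ℕ) (hℓ : 0 < ℓ) (k : ℕ) (b G₁ ω D : ℝ) :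
    ∃ C : ℝ, ∀ w α₀ α₁ α₂ U : ℝ, 0 ≤ w → |α₀| ≤ D → |α₁| ≤ D → |α₂| ≤ D → 0 ≤ U →
      |radOp n ℓ k w (U * α₀) (U / (ℓ ^ 2 + w) * (-b * α₀ + α₁))
          (U / (ℓ ^ 2 + w) ^ 2 * (b * (b + 1) * α₀ - 2 * b * α₁ + α₂)) -
        (G₁ - ω ^ 2 * ℓ ^ 2 / (ℓ ^ 2 + w)) * (U * α₀)| ≤ C * U := by
  -- the quotient by `U` is a continuous function of `w / u`, `1 / u` and the `αᵢ`, all of which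
  -- range over compact intervals
  set F : ℝ × ℝ × ℝ × ℝ × ℝ → ℝ := fun p =>
    4 * p.1 * p.2.1 * (b * (b + 1) * p.2.2.1 - 2 * b * p.2.2.2.1 + p.2.2.2.2) +
      (2 * n + 4 * k) * p.2.1 * (-b * p.2.2.1 + p.2.2.2.1) +
      (4 * p.1 ^ 2 * (b * (b + 1) * p.2.2.1 - 2 * b * p.2.2.2.1 + p.2.2.2.2) +
      (4 + 4 * k + 2 * n) * p.1 * (-b * p.2.2.1 + p.2.2.2.1) + k * (k + n) * p.2.2.1) / ℓ ^ 2 -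
      (G₁ - ω ^ 2 * ℓ ^ 2 * p.2.1) * p.2.2.1 with hF
  have hFc : Continuous F := by fun_prop
  obtain ⟨C, hC⟩ := ((isCompact_Icc (a := (0 : ℝ)) (b := 1)).prod
    ((isCompact_Icc (a := (0 : ℝ)) (b := (ℓ ^ 2)⁻¹)).prod
    ((isCompact_Icc (a := -D) (b := D)).prod ((isCompact_Icc (a := -D) (b := D)).prod
    (isCompact_Icc (a := -D) (b := D)))))).exists_bound_of_continuousOn hFc.continuousOn
  refine ⟨C, fun w α₀ α₁ α₂ U hw h₀ h₁ h₂ hU => ?_⟩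
  have hl : 0 < ℓ ^ 2 := by positivity
  have hu : 0 < ℓ ^ 2 + w := by positivity
  have h := hC (w / (ℓ ^ 2 + w), (ℓ ^ 2 + w)⁻¹, α₀, α₁, α₂)
    ⟨⟨by positivity, by rw [div_le_one hu]; linarith⟩,
      ⟨by positivity, inv_anti₀ hl (by linarith)⟩, abs_le.mp h₀, abs_le.mp h₁, abs_le.mp h₂⟩
  have e : radOp n ℓ k w (U * α₀) (U / (ℓ ^ 2 + w) * (-b * α₀ + α₁))
          (U / (ℓ ^ 2 + w) ^ 2 * (b * (b + 1) * α₀ - 2 * b * α₁ + α₂)) -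
        (G₁ - ω ^ 2 * ℓ ^ 2 / (ℓ ^ 2 + w)) * (U * α₀) =
      F (w / (ℓ ^ 2 + w), (ℓ ^ 2 + w)⁻¹, α₀, α₁, α₂) * U := by
    simp only [hF, radOp]
    field_simp
  rw [e, abs_mul, abs_of_nonneg hU]
  exact mul_le_mul_of_nonneg_right h hU

/-- The first two derivatives of `(ℓ² + w)^{-b} χ(w / R)`, for `χ` a cutoff function as well as for
`χ` a polynomial. -/
theorem hasDerivAt_rpow_mul_comp_div {χ χ₁ χ₂ : ℝ → ℝ} (hχ : ∀ t, HasDerivAt χ (χ₁ t) t)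
    (hχ₁ : ∀ t, HasDerivAt χ₁ (χ₂ t) t) (b R : ℝ) {w : ℝ} (hw : 0 < ℓ ^ 2 + w) :
    HasDerivAt (fun w => (ℓ ^ 2 + w) ^ (-b) * χ (w / R))
      ((ℓ ^ 2 + w) ^ (-b) / (ℓ ^ 2 + w) * (-b * χ (w / R) + (ℓ ^ 2 + w) * χ₁ (w / R) / R)) w ∧
    HasDerivAt (fun w => (ℓ ^ 2 + w) ^ (-b) / (ℓ ^ 2 + w) *
        (-b * χ (w / R) + (ℓ ^ 2 + w) * χ₁ (w / R) / R))
      ((ℓ ^ 2 + w) ^ (-b) / (ℓ ^ 2 + w) ^ 2 * (b * (b + 1) * χ (w / R) -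
        2 * b * ((ℓ ^ 2 + w) * χ₁ (w / R) / R) + (ℓ ^ 2 + w) ^ 2 * χ₂ (w / R) / R ^ 2)) w := by
  have hu : HasDerivAt (fun w : ℝ => ℓ ^ 2 + w) 1 w := (hasDerivAt_id w).const_add _
  have hU : HasDerivAt (fun w : ℝ => (ℓ ^ 2 + w) ^ (-b)) (-b * ((ℓ ^ 2 + w) ^ (-b) / (ℓ ^ 2 + w))) w := by
    refine (hu.rpow_const (p := -b) (Or.inl hw.ne')).congr_deriv ?_
    rw [Real.rpow_sub_one hw.ne']; ring
  have hd : HasDerivAt (fun w : ℝ => w / R) (1 / R) w := (hasDerivAt_id w).div_const R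
  have c0 : HasDerivAt (fun w : ℝ => χ (w / R)) (χ₁ (w / R) * (1 / R)) w := (hχ _).comp w hd
  have c1 : HasDerivAt (fun w : ℝ => χ₁ (w / R)) (χ₂ (w / R) * (1 / R)) w := (hχ₁ _).comp w hd
  constructor
  · refine (hU.mul c0).congr_deriv ?_
    field_simp
  · refine ((hU.div hu hw.ne').mul ((c0.const_mul (-b)).add
      ((hu.mul c1).div_const R))).congr_deriv ?_
    simp only [Pi.div_apply, Pi.add_apply, Pi.mul_apply]
    by_cases hR : R = 0
    · subst hR; simp; field_simp; ring
    · field_simp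
      ring

/-- Testing the equation against `(ℓ² + r²)^{-b} H`. The function is not compactly supported; it is
cut off at radius `√R`, and the limit `R → ∞` is taken by dominated convergence. -/
theorem IsEigensolution.integral_rpow_mul (hℓ : 0 < ℓ) {G₁ δ ω : ℝ}
    {ψ : EuclideanSpace ℝ (Fin n) → ℂ} (hψ : IsEigensolution n ℓ G₁ δ ω ψ) {k : ℕ}
    {H : MvPolynomial (Fin n) ℂ} (hH : IsSolidHarmonic k H) {a b : ℝ}
    (ha : (n : ℝ) / 2 < 2 * a - δ) (hb : a + k / 2 ≤ b) :
    ∫ x, (((((2 * b - k) * (2 * b - k - n) / ℓ ^ 2 - G₁) * (ℓ ^ 2 + ‖x‖ ^ 2) ^ (-b) +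
      (ω ^ 2 * ℓ ^ 2 - 4 * b ^ 2) * ((ℓ ^ 2 + ‖x‖ ^ 2) ^ (-b) / (ℓ ^ 2 + ‖x‖ ^ 2)) : ℝ) : ℂ) *
        polyEval H x) * ψ x = 0 := by
  obtain ⟨χ, χ₁, χ₂, D, hχ, hd, hd₁, hl, hr, hD⟩ := exists_cutoff
  have hD0 : 0 ≤ D := (abs_nonneg _).trans (hD 0).1
  obtain ⟨C, hC⟩ := exists_radOp_cutoff_bound n hℓ k b G₁ ω (D * (ℓ ^ 2 + 2) ^ 2)
  set R : ℕ → ℝ := fun m => (m : ℝ) + 1 with hR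
  have hR1 (m : ℕ) : 1 ≤ R m := by simp [hR]
  set φ : ℕ → EuclideanSpace ℝ (Fin n) → ℂ := fun m y =>
    (((ℓ ^ 2 + ‖y‖ ^ 2) ^ (-b) * χ (‖y‖ ^ 2 / R m) : ℝ) : ℂ) * polyEval H y with hφ
  have hφc (m : ℕ) : ContDiff ℝ (⊤ : ℕ∞) (φ m) := by
    refine (Complex.ofRealCLM.contDiff.comp (ContDiff.mul ?_ ?_)).mul (contDiff_polyEval H)
    · exact (contDiff_const.add (contDiff_norm_sq ℝ)).rpow_const_of_ne
        fun x => (sq_add_norm_sq_pos hℓ x).ne'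
    · exact hχ.comp ((contDiff_norm_sq ℝ).div_const _)
  have hφs (m : ℕ) : HasCompactSupport (φ m) := by
    refine HasCompactSupport.intro (isCompact_closedBall 0 (2 * R m)) fun x hx => ?_
    rw [mem_closedBall_zero_iff, not_le] at hx
    have h1 : 2 < ‖x‖ ^ 2 / R m := by
      rw [lt_div_iff₀ (by linarith [hR1 m])]
      nlinarith [hR1 m]
    simp [hφ, (hr _ h1).1]
  set Z : ℕ → EuclideanSpace ℝ (Fin n) → ℝ := fun m x =>
    radOp n ℓ k (‖x‖ ^ 2) ((ℓ ^ 2 + ‖x‖ ^ 2) ^ (-b) * χ (‖x‖ ^ 2 / R m))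
      ((ℓ ^ 2 + ‖x‖ ^ 2) ^ (-b) / (ℓ ^ 2 + ‖x‖ ^ 2) *
        (-b * χ (‖x‖ ^ 2 / R m) + (ℓ ^ 2 + ‖x‖ ^ 2) * χ₁ (‖x‖ ^ 2 / R m) / R m))
      ((ℓ ^ 2 + ‖x‖ ^ 2) ^ (-b) / (ℓ ^ 2 + ‖x‖ ^ 2) ^ 2 * (b * (b + 1) * χ (‖x‖ ^ 2 / R m) -
        2 * b * ((ℓ ^ 2 + ‖x‖ ^ 2) * χ₁ (‖x‖ ^ 2 / R m) / R m) +
        (ℓ ^ 2 + ‖x‖ ^ 2) ^ 2 * χ₂ (‖x‖ ^ 2 / R m) / R m ^ 2)) -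
      (G₁ - ω ^ 2 * ℓ ^ 2 / (ℓ ^ 2 + ‖x‖ ^ 2)) * ((ℓ ^ 2 + ‖x‖ ^ 2) ^ (-b) * χ (‖x‖ ^ 2 / R m))
    with hZ
  have hZφ (m : ℕ) (x : EuclideanSpace ℝ (Fin n)) :
      divOp ℓ (φ m) x - potential ℓ G₁ ω x * φ m x = (Z m x : ℂ) * polyEval H x := by
    have hpos : ∀ᶠ w in nhds (‖x‖ ^ 2), 0 < ℓ ^ 2 + w :=
      (continuous_const.add continuous_id).continuousAt.eventually
        (lt_mem_nhds (sq_add_norm_sq_pos hℓ x))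
    have := divOp_radial_mul (ℓ := ℓ) hH (x := x)
      (hpos.mono fun w hw => (hasDerivAt_rpow_mul_comp_div hd hd₁ b (R m) hw).1)
      (hasDerivAt_rpow_mul_comp_div hd hd₁ b (R m) (sq_add_norm_sq_pos hℓ x)).2
    rw [hφ]
    simp only at this ⊢
    rw [this, hZ, potential]
    push_cast
    ring
  have hzero (m : ℕ) : ∫ x, ((Z m x : ℂ) * polyEval H x) * ψ x = 0 := by
    rw [← hψ.integral_eq_zero hℓ (hφc m) (hφs m)]
    simp only [hZφ]
  have hcont (m : ℕ) : Continuous fun x => (Z m x : ℂ) * polyEval H x := by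
    simp only [← hZφ]
    exact (contDiff_divOp (hφc m)).continuous.sub
      ((Complex.continuous_ofReal.comp (continuous_potential hℓ G₁ ω)).mul (hφc m).continuous)
  -- The derivatives of the cutoff live where `r² ≤ 2R`, so that `u / R` is bounded there.
  have hbound (m : ℕ) (x : EuclideanSpace ℝ (Fin n)) :
      |Z m x| ≤ C * (ℓ ^ 2 + ‖x‖ ^ 2) ^ (-b) := by
    have hRp : 0 < R m := by linarith [hR1 m]
    have hu := sq_add_norm_sq_pos hℓ x
    obtain ⟨d0, d1, d2⟩ := hD (‖x‖ ^ 2 / R m)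
    have hE : 1 ≤ (ℓ ^ 2 + 2) ^ 2 := by nlinarith [sq_nonneg ℓ]
    have hE1 : ℓ ^ 2 + 2 ≤ (ℓ ^ 2 + 2) ^ 2 := by nlinarith [sq_nonneg ℓ]
    have a0 : |χ (‖x‖ ^ 2 / R m)| ≤ D * (ℓ ^ 2 + 2) ^ 2 := d0.trans (by nlinarith)
    have a12 : |(ℓ ^ 2 + ‖x‖ ^ 2) * χ₁ (‖x‖ ^ 2 / R m) / R m| ≤ D * (ℓ ^ 2 + 2) ^ 2 ∧
        |(ℓ ^ 2 + ‖x‖ ^ 2) ^ 2 * χ₂ (‖x‖ ^ 2 / R m) / R m ^ 2| ≤ D * (ℓ ^ 2 + 2) ^ 2 := by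
      rcases lt_or_ge 2 (‖x‖ ^ 2 / R m) with h | h
      · obtain ⟨-, e1, e2⟩ := hr _ h
        rw [e1, e2]
        simp only [mul_zero, zero_div, abs_zero, and_self]
        positivity
      · have h3 : (ℓ ^ 2 + ‖x‖ ^ 2) / R m ≤ ℓ ^ 2 + 2 := by
          rw [add_div]
          have : ℓ ^ 2 / R m ≤ ℓ ^ 2 := div_le_self (sq_nonneg ℓ) (hR1 m)
          linarith
        have h4 : 0 ≤ (ℓ ^ 2 + ‖x‖ ^ 2) / R m := by positivity
        constructor
        · rw [mul_div_right_comm, abs_mul, abs_of_nonneg h4, mul_comm]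
          exact mul_le_mul d1 (h3.trans hE1) h4 hD0
        · rw [mul_div_right_comm, abs_mul, ← div_pow, abs_of_nonneg (by positivity), mul_comm]
          exact mul_le_mul d2 (pow_le_pow_left₀ h4 h3 2) (by positivity) hD0
    exact hC _ _ _ _ _ (sq_nonneg _) a0 a12.1 a12.2 (by positivity)
  have hdec := (hasDecay_rpow_mul_polyEval hℓ hH.1 hb).integrable_mul hℓ ha hψ.1
  have hlim := tendsto_integral_of_dominated_convergence
    (F := fun m x => ((Z m x : ℂ) * polyEval H x) * ψ x)
    (f := fun x => (((((2 * b - k) * (2 * b - k - n) / ℓ ^ 2 - G₁) * (ℓ ^ 2 + ‖x‖ ^ 2) ^ (-b) +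
      (ω ^ 2 * ℓ ^ 2 - 4 * b ^ 2) * ((ℓ ^ 2 + ‖x‖ ^ 2) ^ (-b) / (ℓ ^ 2 + ‖x‖ ^ 2)) : ℝ) : ℂ) *
        polyEval H x) * ψ x) (μ := volume)
    (fun x => C * ‖(((ℓ ^ 2 + ‖x‖ ^ 2) ^ (-b) : ℝ) : ℂ) * polyEval H x * ψ x‖)
    (fun m => (hcont m).aestronglyMeasurable.mul ((memWeightedL2_iff hℓ).mp hψ.1).1)
    (hdec.norm.const_mul C)
    (fun m => Filter.Eventually.of_forall fun x => by
      have hu := sq_add_norm_sq_pos hℓ x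
      rw [norm_mul, norm_mul, norm_mul, norm_mul, Complex.norm_real, Complex.norm_real,
        Real.norm_eq_abs, Real.norm_of_nonneg (Real.rpow_nonneg hu.le _), ← mul_assoc, ← mul_assoc]
      gcongr
      exact hbound m x)
    (Filter.Eventually.of_forall fun x => by
      refine tendsto_const_nhds.congr' ?_
      obtain ⟨N, hN⟩ := exists_nat_gt (‖x‖ ^ 2)
      filter_upwards [Filter.eventually_ge_atTop N] with m hm
      have h1 : ‖x‖ ^ 2 / R m < 1 := by
        rw [div_lt_one (by linarith [hR1 m])]
        have : (N : ℝ) ≤ m := by exact_mod_cast hm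
        simp only [hR]; linarith
      obtain ⟨e0, e1, e2⟩ := hl _ h1
      rw [hZ]
      simp only [e0, e1, e2]
      rw [← radOp_rpow hℓ k b _ G₁ ω _ (sq_nonneg ‖x‖)]
      simp only [mul_one, mul_zero, zero_div, add_zero, sub_zero]
      congr 5 <;> ring)
  simp only [hzero] at hlim
  exact (tendsto_nhds_unique hlim tendsto_const_nhds)

/-- The moment of `ψ` against `H` and the power `(ℓ² + r²)^{-b_j - 1}`, where
`b_j = k / 2 + (n + s) / 4 + j`. -/
def moment (ℓ G₁ : ℝ) (k : ℕ) (H : MvPolynomial (Fin n) ℂ) (ψ : EuclideanSpace ℝ (Fin n) → ℂ)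
    (j : ℕ) : ℂ :=
  ∫ x, ((((ℓ ^ 2 + ‖x‖ ^ 2) ^ (-(ℓ * freq n ℓ G₁ k j / 2)) / (ℓ ^ 2 + ‖x‖ ^ 2) : ℝ) : ℂ) *
    polyEval H x) * ψ x

theorem mul_freq_succ_div_two (hℓ : 0 < ℓ) (G₁ : ℝ) (k j : ℕ) :
    ℓ * freq n ℓ G₁ k (j + 1) / 2 = ℓ * freq n ℓ G₁ k j / 2 + 1 := by
  unfold freq
  push_cast
  field_simp
  ring

theorem mul_freq_div_two (hℓ : 0 < ℓ) (G₁ : ℝ) (k j : ℕ) :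
    ℓ * freq n ℓ G₁ k j / 2 = ((n : ℝ) + sExp n ℓ G₁) / 4 + k / 2 + j := by
  unfold freq
  field_simp
  ring

theorem freq_pos (hℓ : 0 < ℓ) {G₁ : ℝ} (hG : 0 < 4 * ℓ ^ 2 * G₁ + (n : ℝ) ^ 2) (k K : ℕ) :
    0 < freq n ℓ G₁ k K := by
  have : 0 < sExp n ℓ G₁ := Real.sqrt_pos.mpr hG
  unfold freq
  positivity

theorem sq_eq_freq_sq_iff {G₁ ω : ℝ} {k K : ℕ} :
    ω ^ 2 = freq n ℓ G₁ k K ^ 2 ↔ ω = freq n ℓ G₁ k K ∨ ω = -freq n ℓ G₁ k K :=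
  sq_eq_sq_iff_eq_or_eq_neg

theorem rpow_div_self_eq (hℓ : 0 < ℓ) (b : ℝ) (x : EuclideanSpace ℝ (Fin n)) :
    (ℓ ^ 2 + ‖x‖ ^ 2) ^ (-b) / (ℓ ^ 2 + ‖x‖ ^ 2) = (ℓ ^ 2 + ‖x‖ ^ 2) ^ (-(b + 1)) := by
  rw [neg_add, ← sub_eq_add_neg, Real.rpow_sub_one (sq_add_norm_sq_pos hℓ x).ne']

theorem sExp_sq {G₁ : ℝ} (hG : 0 < 4 * ℓ ^ 2 * G₁ + (n : ℝ) ^ 2) :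
    sExp n ℓ G₁ ^ 2 = 4 * ℓ ^ 2 * G₁ + (n : ℝ) ^ 2 := Real.sq_sqrt hG.le

/-- The moments obey a two-term recursion, so that the first non-vanishing moment of a solution has
its index `j` at the frequency: `ω² = ω_{k,j}²`. -/
theorem IsEigensolution.moment_eq_zero (hℓ : 0 < ℓ) {G₁ δ ω : ℝ}
    (hG : 0 < 4 * ℓ ^ 2 * G₁ + (n : ℝ) ^ 2) (hδ : δ < sExp n ℓ G₁ / 2)
    {ψ : EuclideanSpace ℝ (Fin n) → ℂ} (hψ : IsEigensolution n ℓ G₁ δ ω ψ) {k : ℕ}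
    {H : MvPolynomial (Fin n) ℂ} (hH : IsSolidHarmonic k H) {j : ℕ}
    (hj : ∀ i < j, moment ℓ G₁ k H ψ i = 0) (hω : ω ^ 2 ≠ freq n ℓ G₁ k j ^ 2) :
    moment ℓ G₁ k H ψ j = 0 := by
  set a : ℝ := ((n : ℝ) + sExp n ℓ G₁) / 4 with ha
  have had : (n : ℝ) / 2 < 2 * a - δ := by rw [ha]; linarith
  set b := ℓ * freq n ℓ G₁ k j / 2 with hb
  have hb' : b = a + k / 2 + j := mul_freq_div_two hℓ G₁ k j
  have hab : a + k / 2 ≤ b := by rw [hb']; linarith [(Nat.cast_nonneg j : (0 : ℝ) ≤ j)]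
  have h := hψ.integral_rpow_mul hℓ hH had hab
  have i1 := (hasDecay_rpow_mul_polyEval hℓ hH.1 hab).integrable_mul hℓ had hψ.1
  have i2 := (hasDecay_rpow_mul_polyEval hℓ hH.1 (hab.trans (by linarith : b ≤ b + 1))).integrable_mul
    hℓ had hψ.1
  have e (x : EuclideanSpace ℝ (Fin n)) :
      (((((2 * b - k) * (2 * b - k - n) / ℓ ^ 2 - G₁) * (ℓ ^ 2 + ‖x‖ ^ 2) ^ (-b) +
      (ω ^ 2 * ℓ ^ 2 - 4 * b ^ 2) * ((ℓ ^ 2 + ‖x‖ ^ 2) ^ (-b) / (ℓ ^ 2 + ‖x‖ ^ 2)) : ℝ) : ℂ) *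
        polyEval H x) * ψ x =
      (((2 * b - k) * (2 * b - k - n) / ℓ ^ 2 - G₁ : ℝ) : ℂ) *
        ((((ℓ ^ 2 + ‖x‖ ^ 2) ^ (-b) : ℝ) : ℂ) * polyEval H x * ψ x) +
      ((ω ^ 2 * ℓ ^ 2 - 4 * b ^ 2 : ℝ) : ℂ) *
        ((((ℓ ^ 2 + ‖x‖ ^ 2) ^ (-(b + 1)) : ℝ) : ℂ) * polyEval H x * ψ x) := by
    rw [rpow_div_self_eq hℓ]; push_cast; ring
  simp only [e] at h
  rw [integral_add (i1.const_mul _) (i2.const_mul _), integral_const_mul, integral_const_mul] at h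
  have hM : moment ℓ G₁ k H ψ j =
      ∫ x, ((((ℓ ^ 2 + ‖x‖ ^ 2) ^ (-(b + 1)) : ℝ) : ℂ) * polyEval H x) * ψ x := by
    simp only [moment, ← hb, rpow_div_self_eq hℓ]
  have h0 : (((2 * b - k) * (2 * b - k - n) / ℓ ^ 2 - G₁ : ℝ) : ℂ) *
        ∫ x, ((((ℓ ^ 2 + ‖x‖ ^ 2) ^ (-b) : ℝ) : ℂ) * polyEval H x * ψ x) = 0 := by
    -- for `j = 0` the exponent `b` is a root of the indicial polynomial, and for `j > 0` the
    -- integral is the preceding moment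
    rcases Nat.eq_zero_or_pos j with h0 | hpos
    · have : (2 * b - k) * (2 * b - k - n) / ℓ ^ 2 - G₁ = 0 := by
        have hs := sExp_sq hG
        rw [hb', h0, ha]
        field_simp
        push_cast
        linear_combination 4 * hs
      rw [this]; simp
    · obtain ⟨i, rfl⟩ := Nat.exists_eq_succ_of_ne_zero hpos.ne'
      have h1 := hj i (Nat.lt_succ_self i)
      have h2 : b = ℓ * freq n ℓ G₁ k i / 2 + 1 := mul_freq_succ_div_two hℓ G₁ k i
      simp only [moment, rpow_div_self_eq hℓ, ← h2] at h1
      rw [h1, mul_zero]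
  rw [h0, zero_add, ← hM] at h
  refine (mul_eq_zero.mp h).resolve_left ?_
  have hb2 : 4 * b ^ 2 = ℓ ^ 2 * freq n ℓ G₁ k j ^ 2 := by rw [hb]; ring
  rw [hb2, mul_comm, ← mul_sub]
  exact_mod_cast mul_ne_zero (by positivity) (sub_ne_zero.mpr hω)

/-! ### Decomposition of polynomials into solid harmonics -/

open MvPolynomial in
/-- The polynomial `r² = x₁² + ⋯ + xₙ²`. -/
def sqPoly (n : ℕ) : MvPolynomial (Fin n) ℂ := ∑ i, X i * X i

open MvPolynomial in
/-- The Laplacian on polynomials. -/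
def lapPoly : MvPolynomial (Fin n) ℂ →ₗ[ℂ] MvPolynomial (Fin n) ℂ :=
  ∑ i, (pderiv i).toLinearMap ∘ₗ (pderiv i).toLinearMap

open MvPolynomial in
theorem lapPoly_apply (p : MvPolynomial (Fin n) ℂ) : lapPoly p = ∑ i, pderiv i (pderiv i p) := by
  simp [lapPoly]

open MvPolynomial in
theorem isHomogeneous_sqPoly : (sqPoly n).IsHomogeneous 2 :=
  IsHomogeneous.sum _ _ _ fun i _ => (isHomogeneous_X ℂ i).mul (isHomogeneous_X ℂ i)

open MvPolynomial in
theorem pderiv_sqPoly (i : Fin n) : pderiv i (sqPoly n) = 2 * X i := by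
  classical
  unfold sqPoly
  rw [map_sum, Finset.sum_eq_single i]
  · simp [Derivation.leibniz]; ring
  · intro j _ hj
    simp [Derivation.leibniz, pderiv_X_of_ne hj]
  · simp

open MvPolynomial in
theorem lapPoly_sqPoly_mul {d : ℕ} {q : MvPolynomial (Fin n) ℂ} (hq : q.IsHomogeneous d) :
    lapPoly (sqPoly n * q) = ((2 * n + 4 * d : ℕ) : MvPolynomial (Fin n) ℂ) * q +
      sqPoly n * lapPoly q := by
  rw [lapPoly_apply, lapPoly_apply]
  have h (i : Fin n) : pderiv i (pderiv i (sqPoly n * q)) =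
      2 * q + 4 * (X i * pderiv i q) + sqPoly n * pderiv i (pderiv i q) := by
    have h2 : pderiv i (2 * X i : MvPolynomial (Fin n) ℂ) = 2 := by
      rw [← map_ofNat (C : ℂ →+* MvPolynomial (Fin n) ℂ) 2, pderiv_C_mul, pderiv_X_self]; simp
    simp only [Derivation.leibniz, pderiv_sqPoly, map_add, smul_eq_mul, h2]
    ring
  simp only [h, Finset.sum_add_distrib, ← Finset.mul_sum, hq.sum_X_mul_pderiv]
  simp only [Finset.sum_const, Finset.card_univ, Fintype.card_fin, nsmul_eq_mul]
  push_cast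
  ring

open MvPolynomial in
theorem isHomogeneous_sqPoly_pow_mul {m : ℕ} {H : MvPolynomial (Fin n) ℂ}
    (hH : H.IsHomogeneous m) (j : ℕ) : (sqPoly n ^ j * H).IsHomogeneous (2 * j + m) :=
  (isHomogeneous_sqPoly.pow j).mul hH

open MvPolynomial in
theorem lapPoly_sqPoly_pow_mul (hn : 2 ≤ n) {m : ℕ} {H : MvPolynomial (Fin n) ℂ}
    (hH : IsSolidHarmonic m H) (j : ℕ) :
    ∃ c : ℕ, 0 < c ∧ lapPoly (sqPoly n ^ (j + 1) * H) =
      (c : MvPolynomial (Fin n) ℂ) * (sqPoly n ^ j * H) := by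
  have hz : lapPoly H = 0 := by rw [lapPoly_apply]; exact hH.2
  induction j with
  | zero =>
    refine ⟨2 * n + 4 * m, by omega, ?_⟩
    rw [zero_add, pow_one, lapPoly_sqPoly_mul hH.1, hz]
    simp
  | succ j ih =>
    obtain ⟨c, hc, h⟩ := ih
    refine ⟨2 * n + 4 * (2 * (j + 1) + m) + c, by omega, ?_⟩
    rw [pow_succ' _ (j + 1), mul_assoc, lapPoly_sqPoly_mul (isHomogeneous_sqPoly_pow_mul hH.1 _), h]
    push_cast
    ring

/-- The span of the products `r^{2i} H` of total degree `k` with `H` a solid harmonic. -/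
def harmonicSpan (n k : ℕ) : Submodule ℂ (MvPolynomial (Fin n) ℂ) :=
  Submodule.span ℂ {q | ∃ (i m : ℕ) (H : MvPolynomial (Fin n) ℂ), 2 * i + m = k ∧
    IsSolidHarmonic m H ∧ q = sqPoly n ^ i * H}

theorem isHomogeneous_of_mem_harmonicSpan {k : ℕ} {q : MvPolynomial (Fin n) ℂ}
    (hq : q ∈ harmonicSpan n k) : q.IsHomogeneous k := by
  have : harmonicSpan n k ≤ MvPolynomial.homogeneousSubmodule (Fin n) ℂ k := by
    refine Submodule.span_le.mpr ?_
    rintro _ ⟨i, m, H, rfl, hH, rfl⟩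
    exact isHomogeneous_sqPoly_pow_mul hH.1 i
  exact this hq

theorem exists_lapPoly_eq (hn : 2 ≤ n) {k : ℕ} {q : MvPolynomial (Fin n) ℂ}
    (hq : q ∈ harmonicSpan n k) : ∃ p ∈ harmonicSpan n (k + 2), lapPoly p = q := by
  have : harmonicSpan n k ≤ (harmonicSpan n (k + 2)).map lapPoly := by
    refine Submodule.span_le.mpr ?_
    rintro _ ⟨i, m, H, rfl, hH, rfl⟩
    obtain ⟨c, hc, h⟩ := lapPoly_sqPoly_pow_mul hn hH i
    refine ⟨(c : ℂ)⁻¹ • (sqPoly n ^ (i + 1) * H),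
      Submodule.smul_mem _ _ (Submodule.subset_span ⟨i + 1, m, H, by ring, hH, rfl⟩), ?_⟩
    rw [map_smul, h, ← nsmul_eq_mul, ← Nat.cast_smul_eq_nsmul ℂ, smul_smul,
      inv_mul_cancel₀ (by exact_mod_cast hc.ne'), one_smul]
  exact this hq

/-- Every homogeneous polynomial of degree `k` is a sum of products `r^{2i} H` with `H` a solid
harmonic: the Laplacian maps such sums of degree `k` onto those of degree `k - 2`, so that any
polynomial can be corrected to a harmonic one. -/
theorem mem_harmonicSpan (hn : 2 ≤ n) (k : ℕ) {p : MvPolynomial (Fin n) ℂ}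
    (hp : p.IsHomogeneous k) : p ∈ harmonicSpan n k := by
  have hharm (k : ℕ) (p : MvPolynomial (Fin n) ℂ) (hp : p.IsHomogeneous k) (h : lapPoly p = 0) :
      p ∈ harmonicSpan n k :=
    Submodule.subset_span ⟨0, k, p, by ring, ⟨hp, by rwa [lapPoly_apply] at h⟩, by simp⟩
  have hlow (k : ℕ) (hk : k ≤ 1) (p : MvPolynomial (Fin n) ℂ) (hp : p.IsHomogeneous k) :
      lapPoly p = 0 := by
    rw [lapPoly_apply]
    refine Finset.sum_eq_zero fun i _ => ?_
    have h0 : (MvPolynomial.pderiv i p).IsHomogeneous 0 := by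
      have := hp.pderiv (i := i)
      rwa [Nat.sub_eq_zero_of_le hk] at this
    rw [MvPolynomial.totalDegree_eq_zero_iff_eq_C.mp (Nat.le_zero.mp h0.totalDegree_le),
      MvPolynomial.pderiv_C]
  induction k using Nat.strong_induction_on generalizing p with
  | _ k ih =>
    rcases Nat.lt_or_ge 1 k with hk | hk
    · obtain ⟨m, rfl⟩ := Nat.exists_eq_add_of_le' hk
      have h1 : (lapPoly p).IsHomogeneous m := by
        rw [lapPoly_apply]
        exact MvPolynomial.IsHomogeneous.sum _ _ _ fun i _ => hp.pderiv.pderiv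
      obtain ⟨q, hq, hqp⟩ := exists_lapPoly_eq hn (ih m (by omega) h1)
      have h2 := hharm (m + 2) (p - q) (hp.sub (isHomogeneous_of_mem_harmonicSpan hq))
        (by rw [map_sub, hqp, sub_self])
      simpa using Submodule.add_mem _ h2 hq
    · exact hharm k p hp (hlow k hk p hp)

/-- A submodule that contains all products `r^{2i} H` with `H` a solid harmonic contains every
polynomial. -/
theorem mem_of_sqPoly_pow_mul_mem (hn : 2 ≤ n) {S : Submodule ℂ (MvPolynomial (Fin n) ℂ)}
    (hS : ∀ (i m : ℕ) (H : MvPolynomial (Fin n) ℂ), IsSolidHarmonic m H → sqPoly n ^ i * H ∈ S)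
    (p : MvPolynomial (Fin n) ℂ) : p ∈ S := by
  rw [← MvPolynomial.sum_homogeneousComponent p]
  refine Submodule.sum_mem _ fun k _ => ?_
  have h := mem_harmonicSpan hn k (MvPolynomial.homogeneousComponent_isHomogeneous k p)
  refine (Submodule.span_le.mpr ?_ : harmonicSpan n k ≤ S) h
  rintro _ ⟨i, m, H, -, hH, rfl⟩
  exact hS i m H hH

/-! ### Completeness of polynomials on the unit ball -/

open BoundedContinuousFunction in
/-- If `y` is a bounded, continuous and injective map to `ℝⁿ`, then an integrable function that is
orthogonal to all polynomials in `y` vanishes almost everywhere. -/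
theorem ae_eq_zero_of_integral_eval_eq_zero {y : EuclideanSpace ℝ (Fin n) → EuclideanSpace ℝ (Fin n)}
    (hy : Continuous y) (hb : ∀ x, ‖y x‖ ≤ 1) (hinj : Function.Injective y)
    {g : EuclideanSpace ℝ (Fin n) → ℝ} (hg : Integrable g volume)
    (h : ∀ p : MvPolynomial (Fin n) ℝ, ∫ x, MvPolynomial.eval (fun i => y x i) p * g x = 0) :
    g =ᵐ[volume] 0 := by
  have hc (i : Fin n) : Continuous fun x => y x i := by fun_prop
  set Y : Fin n → EuclideanSpace ℝ (Fin n) →ᵇ ℝ := fun i =>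
    BoundedContinuousFunction.ofNormedAddCommGroup (fun x => y x i) (hc i) 1
      fun x => (PiLp.norm_apply_le (y x) i).trans (hb x) with hY
  have hev (p : MvPolynomial (Fin n) ℝ) (x : EuclideanSpace ℝ (Fin n)) :
      MvPolynomial.aeval Y p x = MvPolynomial.eval (fun i => y x i) p := by
    induction p using MvPolynomial.induction_on with
    | C a => simp
    | add p q hp hq => simp [hp, hq]
    | mul_X p i hp =>
      rw [map_mul, map_mul, BoundedContinuousFunction.mul_apply, hp]
      simp [hY]
  set A : StarSubalgebra ℝ (EuclideanSpace ℝ (Fin n) →ᵇ ℝ) :=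
    { (MvPolynomial.aeval (R := ℝ) Y).range with
      star_mem' := fun {a} ha => by
        have : star a = a := by ext x; simp
        rw [this]; exact ha } with hA
  have hmem (f : EuclideanSpace ℝ (Fin n) →ᵇ ℝ) (hf : f ∈ A) :
      ∃ p : MvPolynomial (Fin n) ℝ, MvPolynomial.aeval Y p = f := hf
  have hsep : (A.map (toContinuousMapStarₐ ℝ)).SeparatesPoints := by
    intro a b hab
    have h1 : ∃ i, y a i ≠ y b i := by
      by_contra hcon
      push Not at hcon
      exact hab (hinj (PiLp.ext hcon))
    obtain ⟨i, hi⟩ := h1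
    refine ⟨fun x => y x i, ⟨(Y i).toContinuousMap, ⟨Y i, ?_, rfl⟩, rfl⟩, hi⟩
    exact ⟨MvPolynomial.X i, by simp⟩
  have hfin (f : EuclideanSpace ℝ (Fin n) → ℝ) (hf : Integrable f volume) :
      IsFiniteMeasure (volume.withDensity fun x => ENNReal.ofReal (f x)) :=
    isFiniteMeasure_withDensity_ofReal hf.2
  have := hfin g hg
  have := hfin (fun x => -g x) hg.neg
  have hint (f : EuclideanSpace ℝ (Fin n) → ℝ) (hf : Integrable f volume)
      (q : EuclideanSpace ℝ (Fin n) →ᵇ ℝ) :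
      ∫ x, q x ∂(volume.withDensity fun x => ENNReal.ofReal (f x)) = ∫ x, max (f x) 0 * q x := by
    rw [integral_withDensity_eq_integral_toReal_smul₀ hf.1.aemeasurable.ennreal_ofReal
      (Filter.Eventually.of_forall fun _ => ENNReal.ofReal_lt_top)]
    refine integral_congr_ae (Filter.Eventually.of_forall fun x => ?_)
    simp [ENNReal.toReal_ofReal']
  have hmul (f : EuclideanSpace ℝ (Fin n) → ℝ) (hf : Integrable f volume)
      (q : EuclideanSpace ℝ (Fin n) →ᵇ ℝ) : Integrable (fun x => max (f x) 0 * q x) volume :=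
    hf.pos_part.mul_bdd (c := ‖q‖) q.continuous.aestronglyMeasurable
      (Filter.Eventually.of_forall fun x => q.norm_coe_le_norm x)
  -- the measures with densities the positive and the negative part of `g` agree on the separating
  -- algebra of polynomials in `y`, hence they are equal
  have heq := ext_of_forall_mem_subalgebra_integral_eq_of_polish
    (P := volume.withDensity fun x => ENNReal.ofReal (g x))
    (P' := volume.withDensity fun x => ENNReal.ofReal (-g x)) hsep (fun q hq => by
      rw [hint g hg, hint (fun x => -g x) hg.neg, ← sub_eq_zero,
        ← integral_sub (hmul g hg q) (hmul (fun x => -g x) hg.neg q)]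
      obtain ⟨p, rfl⟩ := hmem q hq
      refine (integral_congr_ae (Filter.Eventually.of_forall fun x => ?_)).trans (h p)
      simp only [hev]
      rw [← sub_mul, mul_comm]
      congr 1
      rcases le_total (g x) 0 with hx | hx
      · rw [max_eq_right hx, max_eq_left (by simpa using hx)]; ring
      · rw [max_eq_left hx, max_eq_right (by simpa using hx)]; ring)
  have hae := (withDensity_eq_iff hg.1.aemeasurable.ennreal_ofReal
    (g := fun x => ENNReal.ofReal (-g x)) hg.neg.1.aemeasurable.ennreal_ofReal (by
      have := this.measure_univ_lt_top
      have h2 := (hfin g hg).measure_univ_lt_top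
      rw [withDensity_apply _ MeasurableSet.univ, Measure.restrict_univ] at h2
      exact h2.ne)).mp heq
  filter_upwards [hae] with x hx
  rcases le_total (g x) 0 with h0 | h0
  · have : ENNReal.ofReal (g x) = 0 := ENNReal.ofReal_of_nonpos h0
    rw [this] at hx
    have := ENNReal.ofReal_eq_zero.mp hx.symm
    simp only [Pi.zero_apply]
    linarith
  · have : ENNReal.ofReal (-g x) = 0 := ENNReal.ofReal_of_nonpos (by linarith)
    rw [this] at hx
    have := ENNReal.ofReal_eq_zero.mp hx
    simp only [Pi.zero_apply]
    linarith

/-- The map `x ↦ x / √(ℓ² + r²)`, a homeomorphism from `ℝⁿ` to the open unit ball. -/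
def ballMap (ℓ : ℝ) (x : EuclideanSpace ℝ (Fin n)) : EuclideanSpace ℝ (Fin n) :=
  (Real.sqrt (ℓ ^ 2 + ‖x‖ ^ 2))⁻¹ • x

theorem norm_ballMap_sq (hℓ : 0 < ℓ) (x : EuclideanSpace ℝ (Fin n)) :
    ‖ballMap ℓ x‖ ^ 2 = 1 - ℓ ^ 2 / (ℓ ^ 2 + ‖x‖ ^ 2) := by
  have hu := sq_add_norm_sq_pos hℓ x
  rw [ballMap, norm_smul, mul_pow, norm_inv, Real.norm_eq_abs, inv_pow, sq_abs, Real.sq_sqrt hu.le]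
  field_simp
  ring

theorem norm_ballMap_le (hℓ : 0 < ℓ) (x : EuclideanSpace ℝ (Fin n)) : ‖ballMap ℓ x‖ ≤ 1 := by
  have hu := sq_add_norm_sq_pos hℓ x
  have h := norm_ballMap_sq hℓ x
  have : 0 ≤ ℓ ^ 2 / (ℓ ^ 2 + ‖x‖ ^ 2) := by positivity
  nlinarith [norm_nonneg (ballMap ℓ x)]

theorem continuous_ballMap (hℓ : 0 < ℓ) :
    Continuous (ballMap ℓ : EuclideanSpace ℝ (Fin n) → EuclideanSpace ℝ (Fin n)) :=
  Continuous.smul (Continuous.inv₀ (by fun_prop)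
    fun x => (Real.sqrt_pos.mpr (sq_add_norm_sq_pos hℓ x)).ne') continuous_id

theorem ballMap_injective (hℓ : 0 < ℓ) :
    Function.Injective (ballMap ℓ : EuclideanSpace ℝ (Fin n) → EuclideanSpace ℝ (Fin n)) := by
  intro x y hxy
  have h1 := norm_ballMap_sq hℓ x
  have h2 := norm_ballMap_sq hℓ y
  have hx := sq_add_norm_sq_pos hℓ x
  have hy := sq_add_norm_sq_pos hℓ y
  rw [hxy, h2] at h1
  have h3 : ℓ ^ 2 / (ℓ ^ 2 + ‖y‖ ^ 2) = ℓ ^ 2 / (ℓ ^ 2 + ‖x‖ ^ 2) := by linarith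
  have h4 : ℓ ^ 2 + ‖y‖ ^ 2 = ℓ ^ 2 + ‖x‖ ^ 2 := by
    have hl : ℓ ^ 2 ≠ 0 := by positivity
    rw [div_eq_div_iff hy.ne' hx.ne'] at h3
    exact (mul_left_cancel₀ hl h3).symm
  unfold ballMap at hxy
  rw [h4] at hxy
  exact smul_right_injective _ (inv_ne_zero (Real.sqrt_pos.mpr hx).ne') hxy

theorem polyEval_ballMap {k : ℕ} {H : MvPolynomial (Fin n) ℂ} (hH : H.IsHomogeneous k) (hℓ : 0 < ℓ)
    (x : EuclideanSpace ℝ (Fin n)) :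
    polyEval H (ballMap ℓ x) = (((ℓ ^ 2 + ‖x‖ ^ 2) ^ (-((k : ℝ) / 2)) : ℝ) : ℂ) * polyEval H x := by
  have hu := sq_add_norm_sq_pos hℓ x
  have h1 : (ℓ ^ 2 + ‖x‖ ^ 2) ^ (-((k : ℝ) / 2)) = (Real.sqrt (ℓ ^ 2 + ‖x‖ ^ 2))⁻¹ ^ k := by
    rw [Real.sqrt_eq_rpow, ← Real.rpow_neg hu.le, ← Real.rpow_mul_natCast hu.le]
    congr 1
    ring
  rw [h1, Complex.ofReal_pow, polyEval, polyEval, ← eval_mul_of_isHomogeneous hH]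
  simp [ballMap]

theorem polyEval_sqPoly (x : EuclideanSpace ℝ (Fin n)) :
    polyEval (sqPoly n) x = ((‖x‖ ^ 2 : ℝ) : ℂ) := by
  rw [Complex.ofReal_pow, ofReal_norm_sq]
  simp [polyEval, sqPoly]

/-- A function all of whose moments vanish is zero. In the variable `y = x / √(ℓ² + r²)` the moments
are integrals against the products of solid harmonics in `y` and powers of `1 - |y|²`, which span
all polynomials. -/
theorem ae_eq_zero_of_moment_eq_zero (hn : 2 ≤ n) (hℓ : 0 < ℓ) {G₁ δ : ℝ}
    (hδ : δ < sExp n ℓ G₁ / 2) {ψ : EuclideanSpace ℝ (Fin n) → ℂ}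
    (hψ : MemWeightedL2 ℓ (δ - 1 / 2) ψ)
    (h : ∀ (k : ℕ) (H : MvPolynomial (Fin n) ℂ) (j : ℕ), IsSolidHarmonic k H →
      moment ℓ G₁ k H ψ j = 0) : ψ =ᵐ[volume] 0 := by
  set a : ℝ := ((n : ℝ) + sExp n ℓ G₁) / 4 with ha
  have had : (n : ℝ) / 2 < 2 * (a + 1) - δ := by rw [ha]; linarith
  set f : EuclideanSpace ℝ (Fin n) → ℂ :=
    fun x => (((ℓ ^ 2 + ‖x‖ ^ 2) ^ (-(a + 1)) : ℝ) : ℂ) * ψ x with hf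
  have hfi : Integrable f volume := by
    have := (hasDecay_rpow_mul_polyEval (n := n) hℓ (MvPolynomial.isHomogeneous_one (Fin n) ℂ)
      (a := a + 1) (b := a + 1) (by simp)).integrable_mul hℓ had hψ
    simpa [polyEval, hf] using this
  have hpi (p : MvPolynomial (Fin n) ℂ) :
      Integrable (fun x => polyEval p (ballMap ℓ x) * f x) volume := by
    obtain ⟨C, hC⟩ := (isCompact_closedBall (0 : EuclideanSpace ℝ (Fin n)) 1).exists_bound_of_continuousOn
      (contDiff_polyEval p (m := 0)).continuous.continuousOn
    exact hfi.bdd_mul (c := C) ((contDiff_polyEval p (m := 0)).continuous.comp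
      (continuous_ballMap hℓ)).aestronglyMeasurable (Filter.Eventually.of_forall fun x =>
        hC _ (mem_closedBall_zero_iff.mpr (norm_ballMap_le hℓ x)))
  set S : Submodule ℂ (MvPolynomial (Fin n) ℂ) :=
    { carrier := {p | ∫ x, polyEval p (ballMap ℓ x) * f x = 0}
      zero_mem' := by simp [polyEval]
      add_mem' := fun {p q} hp hq => by
        simp only [Set.mem_ofPred_eq] at hp hq ⊢
        simp only [polyEval_add, add_mul]
        rw [integral_add (hpi p) (hpi q), hp, hq, add_zero]
      smul_mem' := fun c p hp => by
        simp only [Set.mem_ofPred_eq] at hp ⊢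
        have (x : EuclideanSpace ℝ (Fin n)) : polyEval (c • p) (ballMap ℓ x) * f x =
            c * (polyEval p (ballMap ℓ x) * f x) := by simp [polyEval, mul_assoc]
        simp only [this]
        rw [integral_const_mul, hp, mul_zero] } with hS
  have hmemS (p : MvPolynomial (Fin n) ℂ) :
      p ∈ S ↔ ∫ x, polyEval p (ballMap ℓ x) * f x = 0 := Iff.rfl
  have hbase (m k : ℕ) (H : MvPolynomial (Fin n) ℂ) (hH : IsSolidHarmonic k H) :
      (1 - sqPoly n) ^ m * H ∈ S := by
    rw [hmemS]
    have e (x : EuclideanSpace ℝ (Fin n)) : polyEval ((1 - sqPoly n) ^ m * H) (ballMap ℓ x) * f x =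
        (((ℓ ^ 2) ^ m : ℝ) : ℂ) * (((((ℓ ^ 2 + ‖x‖ ^ 2) ^ (-(ℓ * freq n ℓ G₁ k m / 2)) /
          (ℓ ^ 2 + ‖x‖ ^ 2) : ℝ) : ℂ) * polyEval H x) * ψ x) := by
      have hu := sq_add_norm_sq_pos hℓ x
      have h1 : polyEval ((1 - sqPoly n) ^ m) (ballMap ℓ x) =
          (((ℓ ^ 2) ^ m * (ℓ ^ 2 + ‖x‖ ^ 2) ^ (-(m : ℝ)) : ℝ) : ℂ) := by
        have h2 : polyEval ((1 - sqPoly n) ^ m) (ballMap ℓ x) =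
            (1 - polyEval (sqPoly n) (ballMap ℓ x)) ^ m := by simp [polyEval]
        have h3 : (ℓ ^ 2) ^ m * (ℓ ^ 2 + ‖x‖ ^ 2) ^ (-(m : ℝ)) = (1 - ‖ballMap ℓ x‖ ^ 2) ^ m := by
          rw [norm_ballMap_sq hℓ, sub_sub_cancel, Real.rpow_neg hu.le, Real.rpow_natCast, div_pow,
            div_eq_mul_inv]
        rw [h2, polyEval_sqPoly, h3]
        push_cast
        rfl
      have h4 : (ℓ ^ 2 + ‖x‖ ^ 2) ^ (-(ℓ * freq n ℓ G₁ k m / 2)) / (ℓ ^ 2 + ‖x‖ ^ 2) =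
          (ℓ ^ 2 + ‖x‖ ^ 2) ^ (-(m : ℝ)) * (ℓ ^ 2 + ‖x‖ ^ 2) ^ (-((k : ℝ) / 2)) *
            (ℓ ^ 2 + ‖x‖ ^ 2) ^ (-(a + 1)) := by
        rw [rpow_div_self_eq hℓ, mul_freq_div_two hℓ, ← ha, ← Real.rpow_add hu, ← Real.rpow_add hu]
        congr 1
        ring
      rw [polyEval_mul, h1, polyEval_ballMap hH.1 hℓ, h4, hf]
      push_cast
      ring
    simp only [e]
    rw [integral_const_mul]
    have := h k H m hH
    rw [moment] at this
    rw [this, mul_zero]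
  -- `r²` is `1 - (1 - r²)`, so that the factors `r²` can be traded for powers of `1 - r²`
  have hall (i : ℕ) : ∀ (m k : ℕ) (H : MvPolynomial (Fin n) ℂ), IsSolidHarmonic k H →
      sqPoly n ^ i * ((1 - sqPoly n) ^ m * H) ∈ S := by
    induction i with
    | zero => intro m k H hH; simpa using hbase m k H hH
    | succ i ih =>
      intro m k H hH
      have : sqPoly n ^ (i + 1) * ((1 - sqPoly n) ^ m * H) =
          sqPoly n ^ i * ((1 - sqPoly n) ^ m * H) - sqPoly n ^ i * ((1 - sqPoly n) ^ (m + 1) * H) := by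
        ring
      rw [this]
      exact Submodule.sub_mem _ (ih m k H hH) (ih (m + 1) k H hH)
  have htop (p : MvPolynomial (Fin n) ℂ) : ∫ x, polyEval p (ballMap ℓ x) * f x = 0 :=
    (hmemS p).mp (mem_of_sqPoly_pow_mul_mem hn (fun i m H hH => by simpa using hall i 0 m H hH) p)
  have hreal (L : ℂ →L[ℝ] ℝ) : (fun x => L (f x)) =ᵐ[volume] 0 := by
    refine ae_eq_zero_of_integral_eval_eq_zero (continuous_ballMap hℓ) (norm_ballMap_le hℓ)
      (ballMap_injective hℓ) (L.integrable_comp hfi) fun p => ?_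
    have h1 := congrArg L (htop (MvPolynomial.map Complex.ofRealHom p))
    rw [map_zero, ← L.integral_comp_comm (hpi _)] at h1
    rw [← h1]
    refine integral_congr_ae (Filter.Eventually.of_forall fun x => ?_)
    have h2 : polyEval (MvPolynomial.map Complex.ofRealHom p) (ballMap ℓ x) =
        ((MvPolynomial.eval (fun i => ballMap ℓ x i) p : ℝ) : ℂ) := by
      rw [polyEval, MvPolynomial.eval_map]
      exact (MvPolynomial.eval₂_comp_left Complex.ofRealHom (RingHom.id ℝ)
        (fun i => ballMap ℓ x i) p).symm
    simp only [h2, ← Complex.real_smul, map_smul, smul_eq_mul]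
  filter_upwards [hreal Complex.reCLM, hreal Complex.imCLM] with x h1 h2
  have h3 : f x = 0 := Complex.ext h1 h2
  have hu := sq_add_norm_sq_pos hℓ x
  refine (mul_eq_zero.mp h3).resolve_left ?_
  exact_mod_cast (Real.rpow_pos_of_pos hu _).ne'

/-! ### The hypergeometric polynomial -/

/-- The terminating hypergeometric series `₂F₁(a, -K; c; z)` as a polynomial in `z`. -/
def hypPoly (a c : ℝ) (K : ℕ) : Polynomial ℝ :=
  ∑ i ∈ Finset.range (K + 1), Polynomial.monomial i (ordinaryHypergeometricCoefficient a (-(K : ℝ)) c i)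

theorem hypCoeff_succ {a b c : ℝ} (hc : 0 < c) (i : ℕ) :
    ((i : ℝ) + 1) * (c + i) * ordinaryHypergeometricCoefficient a b c (i + 1) =
      (a + i) * (b + i) * ordinaryHypergeometricCoefficient a b c i := by
  have hci : c + i ≠ 0 := by positivity
  have hp : (ascPochhammer ℝ i).eval c ≠ 0 := (ascPochhammer_pos i c hc).ne'
  have hf : (i.factorial : ℝ) ≠ 0 := by positivity
  simp only [ordinaryHypergeometricCoefficient, ascPochhammer_succ_eval, Nat.factorial_succ]
  push_cast
  field_simp

theorem hypCoeff_eq_zero {a c : ℝ} {K i : ℕ} (hi : K < i) :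
    ordinaryHypergeometricCoefficient a (-(K : ℝ)) c i = 0 := by
  simp [ordinaryHypergeometricCoefficient,
    (ascPochhammer_eval_eq_zero_iff i (-(K : ℝ))).2 ⟨K, hi, by simp⟩]

theorem coeff_hypPoly (a c : ℝ) (K i : ℕ) :
    (hypPoly a c K).coeff i = ordinaryHypergeometricCoefficient a (-(K : ℝ)) c i := by
  rw [hypPoly, Polynomial.finsetSum_coeff]
  simp only [Polynomial.coeff_monomial]
  rw [Finset.sum_ite_eq']
  split_ifs with h
  · rfl
  · rw [hypCoeff_eq_zero]
    simp at h; omega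

theorem natDegree_hypPoly_le (a c : ℝ) (K : ℕ) : (hypPoly a c K).natDegree ≤ K := by
  rw [Polynomial.natDegree_le_iff_coeff_eq_zero]
  intro i hi
  rw [coeff_hypPoly, hypCoeff_eq_zero hi]

theorem ordinaryHypergeometric_eq_eval_hypPoly (a c : ℝ) (K : ℕ) (z : ℝ) :
    ordinaryHypergeometric a (-(K : ℝ)) c z = (hypPoly a c K).eval z := by
  rw [ordinaryHypergeometric_eq_tsum, hypPoly, Polynomial.eval_finsetSum]
  simp only [Polynomial.eval_monomial, smul_eq_mul]
  refine tsum_eq_sum fun i hi => ?_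
  rw [← ordinaryHypergeometricCoefficient, hypCoeff_eq_zero (by simp at hi; omega), zero_mul]

open Polynomial in
/-- The hypergeometric equation. -/
theorem hypPoly_ode {a c : ℝ} (hc : 0 < c) (K : ℕ) (z : ℝ) :
    z * (1 - z) * (derivative (derivative (hypPoly a c K))).eval z +
      (c - (a - K + 1) * z) * (derivative (hypPoly a c K)).eval z +
      a * K * (hypPoly a c K).eval z = 0 := by
  set p := hypPoly a c K with hp
  have h : X * derivative (derivative p) + C c * derivative p =
      X * (X * derivative (derivative p)) + C (a - K + 1) * (X * derivative p) -
        C (a * K) * p := by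
    ext i
    have hr := hypCoeff_succ (a := a) (b := -(K : ℝ)) hc i
    rw [← coeff_hypPoly, ← coeff_hypPoly, ← hp] at hr
    rcases i with _ | _ | i <;>
    · simp only [coeff_add, coeff_sub, coeff_C_mul, coeff_X_mul, mul_coeff_zero, coeff_X_zero, coeff_C_zero,
        zero_mul, coeff_derivative] at hr ⊢
      push_cast at hr ⊢
      linear_combination hr
  have h2 := congrArg (Polynomial.eval z) h
  simp only [eval_add, eval_sub, eval_mul, eval_X, eval_C] at h2
  linear_combination h2

/-- The value at `1` is positive, all coefficients being non-negative. -/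
theorem eval_one_hypPoly_pos {a c : ℝ} {K : ℕ} (hc : 0 < c) (ha : a + K ≤ 0) :
    0 < (hypPoly a c K).eval 1 := by
  have h0 : ordinaryHypergeometricCoefficient a (-(K : ℝ)) c 0 = 1 := by
    simp [ordinaryHypergeometricCoefficient]
  have hnn (i : ℕ) : 0 ≤ ordinaryHypergeometricCoefficient a (-(K : ℝ)) c i := by
    induction i with
    | zero => rw [h0]; norm_num
    | succ i ih =>
      rcases lt_or_ge K (i + 1) with hi | hi
      · rw [hypCoeff_eq_zero hi]
      · have hr := hypCoeff_succ (a := a) (b := -(K : ℝ)) hc i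
        have hiK : (i : ℝ) + 1 ≤ K := by exact_mod_cast hi
        have h1 : 0 ≤ (a + i) * (-(K : ℝ) + i) :=
          mul_nonneg_of_nonpos_of_nonpos (by linarith) (by linarith)
        have h2 : 0 < ((i : ℝ) + 1) * (c + i) := by positivity
        exact nonneg_of_mul_nonneg_right (hr ▸ mul_nonneg h1 ih) h2
  rw [hypPoly, Polynomial.eval_finsetSum]
  simp only [Polynomial.eval_monomial, one_pow, mul_one]
  exact Finset.sum_pos' (fun i _ => hnn i) ⟨0, by simp, by rw [h0]; norm_num⟩

theorem eval_zero_hypPoly (a c : ℝ) (K : ℕ) : (hypPoly a c K).eval 0 = 1 := by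
  rw [← Polynomial.coeff_zero_eq_eval_zero, coeff_hypPoly]
  simp [ordinaryHypergeometricCoefficient]

/-! ### The modes -/

/-- The hypergeometric factor of the mode `(k, K)`, as a polynomial in `-r²/ℓ²`. -/
def modePoly (n : ℕ) (ℓ G₁ : ℝ) (k K : ℕ) : Polynomial ℝ :=
  hypPoly (-(sExp n ℓ G₁) / 2 - K) ((k : ℝ) + (n : ℝ) / 2) K

theorem eventually_eval_modePoly_ne_zero (G₁ : ℝ) (k K : ℕ) :
    ∀ᶠ t in nhds (0 : ℝ), (modePoly n ℓ G₁ k K).eval (t ^ 2 / -ℓ ^ 2) ≠ 0 := by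
  have hc : Continuous fun t : ℝ => (modePoly n ℓ G₁ k K).eval (t ^ 2 / -ℓ ^ 2) :=
    (Polynomial.continuous _).comp (by fun_prop)
  refine hc.continuousAt.eventually_ne ?_
  simp [modePoly, eval_zero_hypPoly]

theorem radial_eq (G₁ : ℝ) (k K : ℕ) (r : ℝ) :
    radial n ℓ G₁ k K r = (ℓ ^ 2 + r ^ 2) ^ (-(ℓ * freq n ℓ G₁ k K / 2)) * r ^ k *
      (modePoly n ℓ G₁ k K).eval (r ^ 2 / -ℓ ^ 2) := by
  rw [radial, ordinaryHypergeometric_eq_eval_hypPoly, modePoly, neg_div, neg_div, div_neg]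

theorem mode_eq {G₁ : ℝ} {k K : ℕ} {H : MvPolynomial (Fin n) ℂ} (hH : H.IsHomogeneous k)
    (x : EuclideanSpace ℝ (Fin n)) :
    mode n ℓ G₁ k K H x = (((ℓ ^ 2 + ‖x‖ ^ 2) ^ (-(ℓ * freq n ℓ G₁ k K / 2)) *
      (modePoly n ℓ G₁ k K).eval (‖x‖ ^ 2 / -ℓ ^ 2) : ℝ) : ℂ) * polyEval H x := by
  rw [mode, radial_eq, ← norm_pow_mul_angular hH]
  push_cast
  ring

theorem contDiff_mode (hℓ : 0 < ℓ) {G₁ : ℝ} {k K : ℕ} {H : MvPolynomial (Fin n) ℂ}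
    (hH : H.IsHomogeneous k) : ContDiff ℝ (⊤ : ℕ∞) (mode n ℓ G₁ k K H) := by
  rw [funext (mode_eq hH)]
  refine (Complex.ofRealCLM.contDiff.comp (ContDiff.mul ?_ ?_)).mul (contDiff_polyEval H)
  · exact (contDiff_const.add (contDiff_norm_sq ℝ)).rpow_const_of_ne
      fun x => (sq_add_norm_sq_pos hℓ x).ne'
  · exact (Polynomial.contDiff_aeval (modePoly n ℓ G₁ k K) _).comp ((contDiff_norm_sq ℝ).div_const _)

/-- If `F` solves the hypergeometric equation in the variable `z = -w/ℓ²`, then `(ℓ² + w)^{-b} F`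
solves the radial equation; `U` stands for the power `(ℓ² + w)^{-b}`. -/
theorem radOp_eq_of_ode (hℓ : 0 < ℓ) {k K : ℕ} {b s G₁ ω w U F F₁ F₂ : ℝ}
    (hs : s ^ 2 = 4 * ℓ ^ 2 * G₁ + (n : ℝ) ^ 2) (hb : b = ((n : ℝ) + s) / 4 + k / 2 + K)
    (hω : ω = 2 * b / ℓ) (hw : 0 ≤ w)
    (ode : w / -ℓ ^ 2 * (1 - w / -ℓ ^ 2) * F₂ +
      (k + (n : ℝ) / 2 - (-s / 2 - K - K + 1) * (w / -ℓ ^ 2)) * F₁ + (-s / 2 - K) * K * F = 0) :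
    radOp n ℓ k w (U * F) (U / (ℓ ^ 2 + w) * (-b * F + (ℓ ^ 2 + w) * F₁ / -ℓ ^ 2))
      (U / (ℓ ^ 2 + w) ^ 2 * (b * (b + 1) * F - 2 * b * ((ℓ ^ 2 + w) * F₁ / -ℓ ^ 2) +
        (ℓ ^ 2 + w) ^ 2 * F₂ / (-ℓ ^ 2) ^ 2)) =
      (G₁ - ω ^ 2 * ℓ ^ 2 / (ℓ ^ 2 + w)) * (U * F) := by
  have hu : 0 < ℓ ^ 2 + w := by positivity
  have hG1 : G₁ = (s ^ 2 - (n : ℝ) ^ 2) / (4 * ℓ ^ 2) := by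
    rw [hs]; field_simp; ring
  subst hb hω hG1
  have : radOp n ℓ k w (U * F)
      (U / (ℓ ^ 2 + w) * (-(((n : ℝ) + s) / 4 + k / 2 + K) * F + (ℓ ^ 2 + w) * F₁ / -ℓ ^ 2))
      (U / (ℓ ^ 2 + w) ^ 2 * ((((n : ℝ) + s) / 4 + k / 2 + K) * (((n : ℝ) + s) / 4 + k / 2 + K + 1) * F -
        2 * (((n : ℝ) + s) / 4 + k / 2 + K) * ((ℓ ^ 2 + w) * F₁ / -ℓ ^ 2) +
        (ℓ ^ 2 + w) ^ 2 * F₂ / (-ℓ ^ 2) ^ 2)) -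
      ((s ^ 2 - (n : ℝ) ^ 2) / (4 * ℓ ^ 2) - (2 * (((n : ℝ) + s) / 4 + k / 2 + K) / ℓ) ^ 2 * ℓ ^ 2 /
        (ℓ ^ 2 + w)) * (U * F) =
      -4 * U / ℓ ^ 2 * (w / -ℓ ^ 2 * (1 - w / -ℓ ^ 2) * F₂ +
        (k + (n : ℝ) / 2 - (-s / 2 - K - K + 1) * (w / -ℓ ^ 2)) * F₁ + (-s / 2 - K) * K * F) := by
    unfold radOp
    field_simp
    ring
  rw [← sub_eq_zero, this, ode, mul_zero]

/-- The modes satisfy the equation `L ψ = (G'(0) - ω² / V²) ψ`; in the variable `-r²/ℓ²` this is the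
hypergeometric equation. -/
theorem divOp_mode (hn : 2 ≤ n) (hℓ : 0 < ℓ) {G₁ : ℝ} (hG : 0 < 4 * ℓ ^ 2 * G₁ + (n : ℝ) ^ 2)
    {k K : ℕ} {H : MvPolynomial (Fin n) ℂ} (hH : IsSolidHarmonic k H)
    (x : EuclideanSpace ℝ (Fin n)) :
    divOp ℓ (mode n ℓ G₁ k K H) x =
      potential ℓ G₁ (freq n ℓ G₁ k K) x * mode n ℓ G₁ k K H x := by
  set p := modePoly n ℓ G₁ k K with hp
  have hd (q : Polynomial ℝ) (t : ℝ) : HasDerivAt (fun t => q.eval t) (q.derivative.eval t) t :=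
    q.hasDerivAt t
  have hu := sq_add_norm_sq_pos hℓ x
  have hpos : ∀ᶠ w in nhds (‖x‖ ^ 2), 0 < ℓ ^ 2 + w :=
    (continuous_const.add continuous_id).continuousAt.eventually (lt_mem_nhds hu)
  have h := divOp_radial_mul (ℓ := ℓ) hH (x := x)
    (hpos.mono fun w hw => (hasDerivAt_rpow_mul_comp_div (hd p) (hd _)
      (ℓ * freq n ℓ G₁ k K / 2) (-ℓ ^ 2) hw).1)
    (hasDerivAt_rpow_mul_comp_div (hd p) (hd _) (ℓ * freq n ℓ G₁ k K / 2) (-ℓ ^ 2) hu).2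
  rw [mode_eq hH.1, funext (mode_eq hH.1), h, ← mul_assoc, ← Complex.ofReal_mul]
  congr 2
  have hc : 0 < (k : ℝ) + (n : ℝ) / 2 := by
    have : (2 : ℝ) ≤ n := by exact_mod_cast hn
    positivity
  have ode := hypPoly_ode (a := -(sExp n ℓ G₁) / 2 - K) hc K (‖x‖ ^ 2 / -ℓ ^ 2)
  rw [← modePoly, ← hp] at ode
  exact radOp_eq_of_ode hℓ (sExp_sq hG) (mul_freq_div_two hℓ G₁ k K) (by field_simp) (sq_nonneg _) ode

theorem opP_mode (hn : 2 ≤ n) (hℓ : 0 < ℓ) {G₁ : ℝ} (hG : 0 < 4 * ℓ ^ 2 * G₁ + (n : ℝ) ^ 2)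
    {k K : ℕ} {H : MvPolynomial (Fin n) ℂ} (hH : IsSolidHarmonic k H)
    (x : EuclideanSpace ℝ (Fin n)) :
    opP ℓ (mode n ℓ G₁ k K H) x =
      (-freq n ℓ G₁ k K ^ 2 + lapse ℓ x ^ 2 * G₁) • mode n ℓ G₁ k K H x := by
  rw [opP_eq hℓ, divOp_mode hn hℓ hG hH, Complex.real_smul, Complex.real_smul, ← mul_assoc,
    ← Complex.ofReal_mul]
  congr 2
  have hu := (sq_add_norm_sq_pos hℓ x).ne'
  rw [lapse_sq hℓ, potential]
  field_simp
  ring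

/-- The functions of size `O((ℓ² + r²)^{-a})` form a vector space. -/
def decaySubmodule (n : ℕ) (ℓ a : ℝ) : Submodule ℂ (EuclideanSpace ℝ (Fin n) → ℂ) where
  carrier := {h | HasDecay ℓ a h}
  zero_mem' := ⟨continuous_const, 0, fun x => by simp⟩
  add_mem' := HasDecay.add
  smul_mem' c _ h := HasDecay.const_smul h c

/-- Expansion of a mode in the powers `(ℓ² + r²)^{-b_j}` with `j ≤ K`; the coefficient of the last
one does not vanish. -/
theorem exists_mode_expansion (hn : 2 ≤ n) (hℓ : 0 < ℓ) {G₁ : ℝ} (k K : ℕ) :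
    ∃ g : ℕ → ℝ, g K ≠ 0 ∧ ∀ (H : MvPolynomial (Fin n) ℂ), H.IsHomogeneous k → ∀ x,
      mode n ℓ G₁ k K H x = ∑ j ∈ Finset.range (K + 1), (g j : ℂ) *
        ((((ℓ ^ 2 + ‖x‖ ^ 2) ^ (-(ℓ * freq n ℓ G₁ k j / 2)) : ℝ) : ℂ) * polyEval H x) := by
  -- as `-r²/ℓ² = 1 - u/ℓ²` with `u = ℓ² + r²`, the hypergeometric factor is a polynomial in `u`,
  -- whose constant term is the value of the factor at `1`
  set q : Polynomial ℝ := (modePoly n ℓ G₁ k K).comp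
    (Polynomial.C 1 - Polynomial.C (ℓ ^ 2)⁻¹ * Polynomial.X) with hq
  have hdeg : q.natDegree ≤ K := by
    refine Polynomial.natDegree_comp_le.trans ?_
    have h1 : (modePoly n ℓ G₁ k K).natDegree ≤ K := natDegree_hypPoly_le _ _ _
    have h2 : (Polynomial.C 1 - Polynomial.C (ℓ ^ 2)⁻¹ * Polynomial.X : Polynomial ℝ).natDegree ≤ 1 := by
      compute_degree
    nlinarith
  have hc : 0 < (k : ℝ) + (n : ℝ) / 2 := by
    have : (2 : ℝ) ≤ n := by exact_mod_cast hn
    positivity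
  refine ⟨fun j => q.coeff (K - j), ?_, fun H hH x => ?_⟩
  · have h1 : q.coeff 0 = (modePoly n ℓ G₁ k K).eval 1 := by
      rw [Polynomial.coeff_zero_eq_eval_zero, hq]; simp
    simp only [Nat.sub_self, h1]
    refine (eval_one_hypPoly_pos hc ?_).ne'
    have : 0 ≤ sExp n ℓ G₁ := Real.sqrt_nonneg _
    linarith
  · have hu := sq_add_norm_sq_pos hℓ x
    have h1 : (modePoly n ℓ G₁ k K).eval (‖x‖ ^ 2 / -ℓ ^ 2) = q.eval (ℓ ^ 2 + ‖x‖ ^ 2) := by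
      rw [hq, Polynomial.eval_comp]
      congr 1
      simp
      field_simp
      ring
    rw [mode_eq hH, h1, Polynomial.eval_eq_sum_range' (Nat.lt_succ_of_le hdeg),
      ← Finset.sum_range_reflect, Finset.mul_sum, Complex.ofReal_sum, Finset.sum_mul]
    refine Finset.sum_congr rfl fun j hj => ?_
    have hjK : j ≤ K := Nat.lt_succ_iff.mp (Finset.mem_range.mp hj)
    have h2 : (ℓ ^ 2 + ‖x‖ ^ 2) ^ (-(ℓ * freq n ℓ G₁ k K / 2)) * (ℓ ^ 2 + ‖x‖ ^ 2) ^ (K - j) =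
        (ℓ ^ 2 + ‖x‖ ^ 2) ^ (-(ℓ * freq n ℓ G₁ k j / 2)) := by
      rw [← Real.rpow_natCast _ (K - j), ← Real.rpow_add hu, mul_freq_div_two hℓ, mul_freq_div_two hℓ,
        Nat.cast_sub hjK]
      congr 1
      ring
    rw [show K + 1 - 1 - j = K - j by omega, ← h2]
    push_cast
    ring

theorem hasDecay_mode (hn : 2 ≤ n) (hℓ : 0 < ℓ) {G₁ : ℝ} {k K : ℕ} {H : MvPolynomial (Fin n) ℂ}
    (hH : H.IsHomogeneous k) : HasDecay ℓ (((n : ℝ) + sExp n ℓ G₁) / 4) (mode n ℓ G₁ k K H) := by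
  obtain ⟨g, -, hg⟩ := exists_mode_expansion (n := n) hn hℓ (G₁ := G₁) k K
  have h : mode n ℓ G₁ k K H = ∑ j ∈ Finset.range (K + 1), (g j : ℂ) • fun x =>
      (((ℓ ^ 2 + ‖x‖ ^ 2) ^ (-(ℓ * freq n ℓ G₁ k j / 2)) : ℝ) : ℂ) * polyEval H x := by
    funext x
    rw [hg H hH x, Finset.sum_apply]
    rfl
  rw [h]
  refine Submodule.sum_mem (decaySubmodule n ℓ _) fun j _ => Submodule.smul_mem _ _ ?_
  refine hasDecay_rpow_mul_polyEval hℓ hH ?_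
  rw [mul_freq_div_two hℓ]
  linarith [(Nat.cast_nonneg j : (0 : ℝ) ≤ j)]

theorem integral_partialD_mul {f g : EuclideanSpace ℝ (Fin n) → ℂ} (hf : ContDiff ℝ (⊤ : ℕ∞) f)
    (hs : HasCompactSupport f) (hg : ContDiff ℝ (⊤ : ℕ∞) g) (i : Fin n) :
    ∫ x, partialD i f x * g x = -∫ x, f x * partialD i g x := by
  have hf' := contDiff_partialD i hf
  have hg' := contDiff_partialD i hg
  rw [eq_neg_iff_add_eq_zero, add_comm, ← eq_neg_iff_add_eq_zero]
  exact integral_mul_fderiv_eq_neg_fderiv_mul_of_integrable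
    ((hf'.continuous.mul hg.continuous).integrable_of_hasCompactSupport
      (hasCompactSupport_partialD i hs).mul_right)
    ((hf.continuous.mul hg'.continuous).integrable_of_hasCompactSupport hs.mul_right)
    ((hf.continuous.mul hg.continuous).integrable_of_hasCompactSupport hs.mul_right)
    (fun x _ => hf.differentiable (by norm_num) x) (fun x _ => hg.differentiable (by norm_num) x)

/-- The operator `L` is formally self-adjoint. -/
theorem integral_divOp_mul {f g : EuclideanSpace ℝ (Fin n) → ℂ} (hf : ContDiff ℝ (⊤ : ℕ∞) f)
    (hs : HasCompactSupport f) (hg : ContDiff ℝ (⊤ : ℕ∞) g) :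
    ∫ x, divOp ℓ f x * g x = ∫ x, f x * divOp ℓ g x := by
  have ff (i : Fin n) := contDiff_flux (ℓ := ℓ) hf i
  have fg (i : Fin n) := contDiff_flux (ℓ := ℓ) hg i
  have fs (i : Fin n) := hasCompactSupport_flux (ℓ := ℓ) hs i
  simp only [divOp_eq, Finset.sum_mul, Finset.mul_sum]
  rw [integral_finsetSum, integral_finsetSum]
  · have h1 (i : Fin n) : ∫ x, partialD i (flux ℓ f i) x * g x =
        -∫ x, flux ℓ f i x * partialD i g x := integral_partialD_mul (ff i) (fs i) hg i
    have h2 (i : Fin n) : ∫ x, f x * partialD i (flux ℓ g i) x =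
        -∫ x, partialD i f x * flux ℓ g i x := by
      rw [integral_partialD_mul hf hs (fg i) i, neg_neg]
    simp only [h1, h2, Finset.sum_neg_distrib]
    rw [← integral_finsetSum, ← integral_finsetSum]
    · congr 1
      refine integral_congr_ae (Filter.Eventually.of_forall fun x => ?_)
      simp only [flux, add_mul, mul_add, Finset.sum_add_distrib]
      congr 1
      simp only [Complex.real_smul, Finset.mul_sum, Finset.sum_mul]
      rw [Finset.sum_comm]
      exact Finset.sum_congr rfl fun i _ => Finset.sum_congr rfl fun j _ => by push_cast; ring
    · exact fun i _ => ((contDiff_partialD i hf).continuous.mul (fg i).continuous)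
        |>.integrable_of_hasCompactSupport (hasCompactSupport_partialD i hs).mul_right
    · exact fun i _ => ((ff i).continuous.mul (contDiff_partialD i hg).continuous)
        |>.integrable_of_hasCompactSupport (fs i).mul_right
  · exact fun i _ => (hf.continuous.mul (contDiff_partialD i (fg i)).continuous)
      |>.integrable_of_hasCompactSupport hs.mul_right
  · exact fun i _ => ((contDiff_partialD i (ff i)).continuous.mul hg.continuous)
      |>.integrable_of_hasCompactSupport (hasCompactSupport_partialD i (fs i)).mul_right

theorem isEigensolution_mode (hn : 2 ≤ n) (hℓ : 0 < ℓ) {G₁ δ : ℝ}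
    (hG : 0 < 4 * ℓ ^ 2 * G₁ + (n : ℝ) ^ 2) (hδ : -(sExp n ℓ G₁) / 2 < δ) {k K : ℕ}
    {H : MvPolynomial (Fin n) ℂ} (hH : IsSolidHarmonic k H) {ω : ℝ}
    (hω : ω = freq n ℓ G₁ k K ∨ ω = -freq n ℓ G₁ k K) :
    IsEigensolution n ℓ G₁ δ ω (mode n ℓ G₁ k K H) := by
  refine (isEigensolution_iff hℓ).mpr
    ⟨(hasDecay_mode hn hℓ hH.1).memWeightedL2 hℓ (by linarith), fun φ hφ hs => ?_⟩
  have hpot (x : EuclideanSpace ℝ (Fin n)) :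
      potential ℓ G₁ ω x = potential ℓ G₁ (freq n ℓ G₁ k K) x := by
    rw [potential, potential, sq_eq_freq_sq_iff.mpr hω]
  have hφ' : ContDiff ℝ (⊤ : ℕ∞) fun x => Complex.ofRealCLM (φ x) := Complex.ofRealCLM.contDiff.comp hφ
  have hs' : HasCompactSupport fun x => Complex.ofRealCLM (φ x) :=
    hs.comp_left (g := Complex.ofRealCLM) (map_zero _)
  have hm := contDiff_mode (n := n) hℓ (G₁ := G₁) (K := K) hH.1
  have h := integral_divOp_mul (ℓ := ℓ) hφ' hs' hm
  simp only [divOp_clm_comp _ hφ, divOp_mode hn hℓ hG hH] at h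
  simp only [Complex.ofRealCLM_apply] at h
  have i1 : Integrable (fun x => ((divOp ℓ φ x : ℝ) : ℂ) * mode n ℓ G₁ k K H x) volume :=
    ((Complex.continuous_ofReal.comp (contDiff_divOp hφ).continuous).mul hm.continuous)
      |>.integrable_of_hasCompactSupport
      ((hasCompactSupport_divOp hs).comp_left (g := Complex.ofReal) Complex.ofReal_zero).mul_right
  have i2 : Integrable (fun x => (φ x : ℂ) * (potential ℓ G₁ (freq n ℓ G₁ k K) x *
      mode n ℓ G₁ k K H x)) volume :=
    (hφ'.continuous.mul ((Complex.continuous_ofReal.comp (continuous_potential hℓ _ _)).mul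
      hm.continuous)).integrable_of_hasCompactSupport hs'.mul_right
  rw [← sub_eq_zero, ← integral_sub i1 i2] at h
  rw [← h]
  refine integral_congr_ae (Filter.Eventually.of_forall fun x => ?_)
  simp only [hpot]
  push_cast
  ring

theorem eq_zero_of_polyEval_eq_zero {H : MvPolynomial (Fin n) ℂ}
    (h : ∀ x : EuclideanSpace ℝ (Fin n), polyEval H x = 0) : H = 0 := by
  refine MvPolynomial.funext_set (fun _ => Set.range ((↑) : ℝ → ℂ))
    (fun _ => Set.infinite_range_of_injective Complex.ofReal_injective) fun v hv => ?_
  choose t ht using fun i => hv i (Set.mem_univ i)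
  have h1 := h (WithLp.toLp 2 t)
  simp only [polyEval, ht] at h1
  rw [h1, map_zero]

/-- A mode determines its solid harmonic, since the radial factor is non-zero near the origin. -/
theorem eq_zero_of_mode_ae_eq_zero (hℓ : 0 < ℓ) {G₁ : ℝ} {k K : ℕ} {H : MvPolynomial (Fin n) ℂ}
    (hH : H.IsHomogeneous k) (h : mode n ℓ G₁ k K H =ᵐ[volume] 0) : H = 0 := by
  have h0 : mode n ℓ G₁ k K H = 0 :=
    Continuous.ae_eq_iff_eq volume (contDiff_mode hℓ hH).continuous continuous_const |>.mp h
  obtain ⟨ε, hε, hball⟩ := Metric.eventually_nhds_iff.mp (eventually_eval_modePoly_ne_zero (n := n) (ℓ := ℓ) G₁ k K)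
  have hzero (x : EuclideanSpace ℝ (Fin n)) : polyEval H x = 0 := by
    have hx : 0 < ‖x‖ + 1 := by positivity
    set c : ℝ := ε / 2 / (‖x‖ + 1) with hcdef
    have hc0 : 0 < c := by positivity
    have h1 : ‖c • x‖ < ε := by
      rw [norm_smul, Real.norm_of_nonneg hc0.le, hcdef, div_mul_eq_mul_div, div_lt_iff₀ hx]
      nlinarith [norm_nonneg x]
    have h2 := congrFun h0 (c • x)
    rw [mode_eq hH, Pi.zero_apply] at h2
    have h3 := hball (y := ‖c • x‖) (by simpa using h1)
    have hu := sq_add_norm_sq_pos hℓ (c • x)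
    have h4 : polyEval H (c • x) = 0 := by
      refine (mul_eq_zero.mp h2).resolve_left ?_
      exact_mod_cast mul_ne_zero (Real.rpow_pos_of_pos hu _).ne' h3
    have h5 : polyEval H (c • x) = (c : ℂ) ^ k * polyEval H x := by
      rw [polyEval, polyEval, ← eval_mul_of_isHomogeneous hH]
      simp
    rw [h5] at h4
    exact (mul_eq_zero.mp h4).resolve_left (pow_ne_zero _ (by exact_mod_cast hc0.ne'))
  exact eq_zero_of_polyEval_eq_zero hzero

/-! ### The eigenspaces -/

/-- The bilinear pairing `∫ f g / (ℓ² + r²) dx`, for which modes of different frequency are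
orthogonal. -/
def pairing (ℓ : ℝ) (f g : EuclideanSpace ℝ (Fin n) → ℂ) : ℂ :=
  ∫ x, (((ℓ ^ 2 + ‖x‖ ^ 2)⁻¹ : ℝ) : ℂ) * f x * g x

theorem HasDecay.inv_mul (hℓ : 0 < ℓ) {a : ℝ} {h : EuclideanSpace ℝ (Fin n) → ℂ}
    (hh : HasDecay ℓ a h) : HasDecay ℓ a fun x => (((ℓ ^ 2 + ‖x‖ ^ 2)⁻¹ : ℝ) : ℂ) * h x := by
  obtain ⟨hc, C, hC⟩ := hh
  refine ⟨(Complex.continuous_ofReal.comp (Continuous.inv₀ (by fun_prop)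
    fun x => (sq_add_norm_sq_pos hℓ x).ne')).mul hc, (ℓ ^ 2)⁻¹ * C, fun x => ?_⟩
  have hu := sq_add_norm_sq_pos hℓ x
  rw [norm_mul, Complex.norm_real, Real.norm_of_nonneg (by positivity), mul_assoc]
  refine mul_le_mul (inv_anti₀ (by positivity) ?_) (hC x) (norm_nonneg _) (by positivity)
  nlinarith [sq_nonneg ‖x‖]

theorem integrable_pairing (hℓ : 0 < ℓ) {a δ : ℝ} (ha : (n : ℝ) / 2 < 2 * a - δ)
    {f g : EuclideanSpace ℝ (Fin n) → ℂ} (hf : HasDecay ℓ a f)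
    (hg : MemWeightedL2 ℓ (δ - 1 / 2) g) :
    Integrable (fun x => (((ℓ ^ 2 + ‖x‖ ^ 2)⁻¹ : ℝ) : ℂ) * f x * g x) volume :=
  (hf.inv_mul hℓ).integrable_mul hℓ ha hg

/-- A solution that is orthogonal to all modes of its frequency is zero: by the recursion the first
non-vanishing moment could only have the index of the frequency, and the pairing with the mode of
that index is a combination of this moment, with a non-zero coefficient, and the preceding ones. -/
theorem IsEigensolution.ae_eq_zero (hn : 2 ≤ n) (hℓ : 0 < ℓ) {G₁ δ ω : ℝ}
    (hG : 0 < 4 * ℓ ^ 2 * G₁ + (n : ℝ) ^ 2) (hδ : δ < sExp n ℓ G₁ / 2)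
    {ψ : EuclideanSpace ℝ (Fin n) → ℂ} (hψ : IsEigensolution n ℓ G₁ δ ω ψ)
    (h : ∀ (k K : ℕ) (H : MvPolynomial (Fin n) ℂ), IsSolidHarmonic k H →
      (ω = freq n ℓ G₁ k K ∨ ω = -freq n ℓ G₁ k K) → pairing ℓ (mode n ℓ G₁ k K H) ψ = 0) :
    ψ =ᵐ[volume] 0 := by
  refine ae_eq_zero_of_moment_eq_zero hn hℓ (G₁ := G₁) hδ hψ.1 fun k H j hH => ?_
  induction j using Nat.strong_induction_on with
  | _ j ih =>
    by_cases hω : ω ^ 2 = freq n ℓ G₁ k j ^ 2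
    · have h1 := h k j H hH (sq_eq_freq_sq_iff.mp hω)
      obtain ⟨g, hg0, hg⟩ := exists_mode_expansion (n := n) hn hℓ (G₁ := G₁) k j
      have e (x : EuclideanSpace ℝ (Fin n)) :
          (((ℓ ^ 2 + ‖x‖ ^ 2)⁻¹ : ℝ) : ℂ) * mode n ℓ G₁ k j H x * ψ x =
          ∑ i ∈ Finset.range (j + 1), (g i : ℂ) *
            (((((ℓ ^ 2 + ‖x‖ ^ 2) ^ (-(ℓ * freq n ℓ G₁ k i / 2)) / (ℓ ^ 2 + ‖x‖ ^ 2) : ℝ) : ℂ) *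
              polyEval H x) * ψ x) := by
        rw [hg H hH.1 x, Finset.mul_sum, Finset.sum_mul]
        refine Finset.sum_congr rfl fun i _ => ?_
        push_cast
        ring
      simp only [pairing, e] at h1
      rw [integral_finsetSum] at h1
      · simp only [integral_const_mul] at h1
        change ∑ i ∈ Finset.range (j + 1), (g i : ℂ) * moment ℓ G₁ k H ψ i = 0 at h1
        rw [Finset.sum_range_succ, Finset.sum_eq_zero, zero_add] at h1
        · exact (mul_eq_zero.mp h1).resolve_left (by exact_mod_cast hg0)
        · intro i hi
          rw [ih i (Finset.mem_range.mp hi), mul_zero]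
      · intro i _
        refine Integrable.const_mul ?_ _
        simp only [rpow_div_self_eq hℓ]
        refine (hasDecay_rpow_mul_polyEval hℓ hH.1 (a := ((n : ℝ) + sExp n ℓ G₁) / 4) ?_).integrable_mul
          hℓ (by linarith) hψ.1
        rw [mul_freq_div_two hℓ]
        linarith [(Nat.cast_nonneg i : (0 : ℝ) ≤ i)]
    · exact hψ.moment_eq_zero hℓ hG hδ hH (fun i hi => ih i hi) hω

/-- The space of solutions of the eigenvalue problem. -/
def eigenSubmodule (n : ℕ) (hℓ : 0 < ℓ) (G₁ δ ω : ℝ) :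
    Submodule ℂ (EuclideanSpace ℝ (Fin n) → ℂ) where
  carrier := {ψ | IsEigensolution n ℓ G₁ δ ω ψ}
  zero_mem' := (isEigensolution_iff hℓ).mpr ⟨MemLp.zero, fun φ _ _ => by simp⟩
  add_mem' := fun {ψ χ} hψ hχ => by
    obtain ⟨m₁, w₁⟩ := (isEigensolution_iff hℓ).mp hψ
    obtain ⟨m₂, w₂⟩ := (isEigensolution_iff hℓ).mp hχ
    refine (isEigensolution_iff hℓ).mpr ⟨m₁.add m₂, fun φ hφ hs => ?_⟩
    simp only [Pi.add_apply, mul_add]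
    rw [integral_add (integrable_weak hℓ m₁ hφ hs) (integrable_weak hℓ m₂ hφ hs), w₁ φ hφ hs,
      w₂ φ hφ hs, add_zero]
  smul_mem' := fun c ψ hψ => by
    obtain ⟨m, w⟩ := (isEigensolution_iff hℓ).mp hψ
    refine (isEigensolution_iff hℓ).mpr ⟨m.const_smul c, fun φ hφ hs => ?_⟩
    simp only [Pi.smul_apply, smul_eq_mul, mul_left_comm _ c]
    rw [integral_const_mul, w φ hφ hs, mul_zero]

theorem IsEigensolution.congr (hℓ : 0 < ℓ) {G₁ δ ω : ℝ} {ψ χ : EuclideanSpace ℝ (Fin n) → ℂ}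
    (hψ : IsEigensolution n ℓ G₁ δ ω ψ) (h : χ =ᵐ[volume] ψ) : IsEigensolution n ℓ G₁ δ ω χ := by
  obtain ⟨m, w⟩ := (isEigensolution_iff hℓ).mp hψ
  obtain ⟨hm, hi⟩ := (memWeightedL2_iff hℓ).mp m
  refine (isEigensolution_iff hℓ).mpr ⟨(memWeightedL2_iff hℓ).mpr ⟨hm.congr h.symm, hi.congr ?_⟩,
    fun φ hφ hs => ?_⟩
  · filter_upwards [h] with x hx
    rw [hx]
  · rw [← w φ hφ hs]
    refine integral_congr_ae ?_
    filter_upwards [h] with x hx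
    rw [hx]

/-- The span of the modes of frequency `±ω`. -/
def modeSpan (n : ℕ) (ℓ G₁ ω : ℝ) : Submodule ℂ (EuclideanSpace ℝ (Fin n) → ℂ) :=
  Submodule.span ℂ {f | ∃ (k K : ℕ) (H : MvPolynomial (Fin n) ℂ),
    (ω = freq n ℓ G₁ k K ∨ ω = -freq n ℓ G₁ k K) ∧ IsSolidHarmonic k H ∧ f = mode n ℓ G₁ k K H}

theorem modeSpan_le_decaySubmodule (hn : 2 ≤ n) (hℓ : 0 < ℓ) (G₁ ω : ℝ) :
    modeSpan n ℓ G₁ ω ≤ decaySubmodule n ℓ (((n : ℝ) + sExp n ℓ G₁) / 4) := by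
  refine Submodule.span_le.mpr ?_
  rintro _ ⟨k, K, H, -, hH, rfl⟩
  exact hasDecay_mode hn hℓ hH.1

theorem modeSpan_le_eigenSubmodule (hn : 2 ≤ n) (hℓ : 0 < ℓ) {G₁ δ : ℝ}
    (hG : 0 < 4 * ℓ ^ 2 * G₁ + (n : ℝ) ^ 2) (hδ : -(sExp n ℓ G₁) / 2 < δ) (ω : ℝ) :
    modeSpan n ℓ G₁ ω ≤ eigenSubmodule n hℓ G₁ δ ω := by
  refine Submodule.span_le.mpr ?_
  rintro _ ⟨k, K, H, hω, hH, rfl⟩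
  exact isEigensolution_mode hn hℓ hG hδ hH hω

theorem IsSolidHarmonic.map_conj {k : ℕ} {H : MvPolynomial (Fin n) ℂ} (hH : IsSolidHarmonic k H) :
    IsSolidHarmonic k (MvPolynomial.map (starRingEnd ℂ) H) := by
  refine ⟨hH.1.map _, ?_⟩
  have := congrArg (MvPolynomial.map (starRingEnd ℂ)) hH.2
  simpa only [map_sum, map_zero, MvPolynomial.pderiv_map] using this

theorem conj_mode {G₁ : ℝ} {k K : ℕ} {H : MvPolynomial (Fin n) ℂ}
    (x : EuclideanSpace ℝ (Fin n)) :
    starRingEnd ℂ (mode n ℓ G₁ k K H x) =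
      mode n ℓ G₁ k K (MvPolynomial.map (starRingEnd ℂ) H) x := by
  rw [mode, mode, map_mul, Complex.conj_ofReal, angular, angular, MvPolynomial.eval_map,
    ← MvPolynomial.eval₂_id, MvPolynomial.eval₂_comp_left]
  congr 2
  funext i
  simp

theorem conj_mem_modeSpan {G₁ ω : ℝ} {f : EuclideanSpace ℝ (Fin n) → ℂ}
    (hf : f ∈ modeSpan n ℓ G₁ ω) : (fun x => starRingEnd ℂ (f x)) ∈ modeSpan n ℓ G₁ ω := by
  induction hf using Submodule.span_induction with
  | mem f hf =>
    obtain ⟨k, K, H, hω, hH, rfl⟩ := hf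
    exact Submodule.subset_span ⟨k, K, _, hω, hH.map_conj, funext fun x => conj_mode x⟩
  | zero =>
    simp only [Pi.zero_apply, map_zero]
    exact Submodule.zero_mem _
  | add f g _ _ hf hg =>
    have := Submodule.add_mem _ hf hg
    simp only [Pi.add_apply, map_add]
    exact this
  | smul c f _ hf =>
    have := Submodule.smul_mem _ (starRingEnd ℂ c) hf
    simp only [Pi.smul_apply, smul_eq_mul, map_mul]
    exact this

theorem IsSolidHarmonic.add {k : ℕ} {H H' : MvPolynomial (Fin n) ℂ} (h : IsSolidHarmonic k H)
    (h' : IsSolidHarmonic k H') : IsSolidHarmonic k (H + H') := by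
  refine ⟨h.1.add h'.1, ?_⟩
  simp only [map_add, Finset.sum_add_distrib, h.2, h'.2, add_zero]

theorem IsSolidHarmonic.smul {k : ℕ} {H : MvPolynomial (Fin n) ℂ} (h : IsSolidHarmonic k H)
    (c : ℂ) : IsSolidHarmonic k (c • H) := by
  refine ⟨(MvPolynomial.homogeneousSubmodule (Fin n) ℂ k).smul_mem c h.1, ?_⟩
  simp only [MvPolynomial.smul_eq_C_mul, MvPolynomial.pderiv_C_mul, ← Finset.mul_sum, h.2, mul_zero]

/-- The space of solid harmonics of degree `k`. -/
def solidHarmonics (n k : ℕ) : Submodule ℂ (MvPolynomial (Fin n) ℂ) where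
  carrier := {H | IsSolidHarmonic k H}
  zero_mem' := ⟨MvPolynomial.isHomogeneous_zero _ _ _, by simp⟩
  add_mem' := IsSolidHarmonic.add
  smul_mem' c _ h := IsSolidHarmonic.smul h c

instance finiteDimensional_solidHarmonics (n k : ℕ) : FiniteDimensional ℂ (solidHarmonics n k) := by
  have h : solidHarmonics n k ≤ MvPolynomial.restrictTotalDegree (Fin n) ℂ k := fun H hH =>
    (MvPolynomial.mem_restrictTotalDegree _ _ _).mpr hH.1.totalDegree_le
  exact Submodule.finiteDimensional_of_le h

theorem angular_add (H H' : MvPolynomial (Fin n) ℂ) (x : EuclideanSpace ℝ (Fin n)) :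
    angular (H + H') x = angular H x + angular H' x := by simp [angular]

theorem angular_smul (c : ℂ) (H : MvPolynomial (Fin n) ℂ) (x : EuclideanSpace ℝ (Fin n)) :
    angular (c • H) x = c * angular H x := by simp [angular]

theorem mode_add (G₁ : ℝ) (k K : ℕ) (H H' : MvPolynomial (Fin n) ℂ) :
    mode n ℓ G₁ k K (H + H') = mode n ℓ G₁ k K H + mode n ℓ G₁ k K H' := by
  funext x; simp [mode, angular_add, mul_add]

theorem mode_smul (G₁ : ℝ) (k K : ℕ) (c : ℂ) (H : MvPolynomial (Fin n) ℂ) :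
    mode n ℓ G₁ k K (c • H) = c • mode n ℓ G₁ k K H := by
  funext x; simp [mode, angular_smul, mul_left_comm]

/-- The mode as a linear function of the solid harmonic. -/
def modeMap (n : ℕ) (ℓ G₁ : ℝ) (k K : ℕ) :
    solidHarmonics n k →ₗ[ℂ] (EuclideanSpace ℝ (Fin n) → ℂ) where
  toFun H := mode n ℓ G₁ k K H
  map_add' H H' := by rw [Submodule.coe_add, mode_add]
  map_smul' c H := by rw [Submodule.coe_smul, mode_smul, RingHom.id_apply]

theorem freq_eq_freq_iff (hℓ : 0 < ℓ) {G₁ : ℝ} {k K k' K' : ℕ} :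
    freq n ℓ G₁ k K = freq n ℓ G₁ k' K' ↔ k + 2 * K = k' + 2 * K' := by
  unfold freq
  rw [div_left_inj' (by positivity)]
  constructor
  · intro h
    have : (k : ℝ) + 2 * K = k' + 2 * K' := by linarith
    exact_mod_cast this
  · intro h
    have : (k : ℝ) + 2 * K = k' + 2 * K' := by exact_mod_cast h
    rw [this]

theorem level_eq (hℓ : 0 < ℓ) {G₁ ω : ℝ} (hG : 0 < 4 * ℓ ^ 2 * G₁ + (n : ℝ) ^ 2) {k K k' K' : ℕ}
    (h : ω = freq n ℓ G₁ k K ∨ ω = -freq n ℓ G₁ k K)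
    (h' : ω = freq n ℓ G₁ k' K' ∨ ω = -freq n ℓ G₁ k' K') : k + 2 * K = k' + 2 * K' := by
  have h1 := (sq_eq_freq_sq_iff.mpr h).symm.trans (sq_eq_freq_sq_iff.mpr h')
  rw [sq_eq_sq₀ (freq_pos hℓ hG k K).le (freq_pos hℓ hG k' K').le] at h1
  exact (freq_eq_freq_iff hℓ).mp h1

/-- The frequency determines the level `N = k + 2K`, and hence one mode for each `K ≤ N / 2` and
each solid harmonic of degree `N - 2K`. -/
theorem modeSpan_le_iSup (hℓ : 0 < ℓ) {G₁ ω : ℝ} (hG : 0 < 4 * ℓ ^ 2 * G₁ + (n : ℝ) ^ 2)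
    {k₀ K₀ : ℕ} (h₀ : ω = freq n ℓ G₁ k₀ K₀ ∨ ω = -freq n ℓ G₁ k₀ K₀) :
    modeSpan n ℓ G₁ ω ≤ ⨆ K ∈ Finset.range ((k₀ + 2 * K₀) / 2 + 1),
      LinearMap.range (modeMap n ℓ G₁ (k₀ + 2 * K₀ - 2 * K) K) := by
  refine Submodule.span_le.mpr ?_
  rintro _ ⟨k, K, H, hω, hH, rfl⟩
  have hN := level_eq hℓ hG hω h₀
  have hk : k = k₀ + 2 * K₀ - 2 * K := by omega
  subst hk
  exact Submodule.mem_iSup_of_mem K (Submodule.mem_iSup_of_mem (Finset.mem_range.mpr (by omega))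
    ⟨⟨H, hH⟩, rfl⟩)

theorem exists_sum_mode_of_mem_modeSpan (hℓ : 0 < ℓ) {G₁ ω : ℝ}
    (hG : 0 < 4 * ℓ ^ 2 * G₁ + (n : ℝ) ^ 2) {k₀ K₀ : ℕ}
    (h₀ : ω = freq n ℓ G₁ k₀ K₀ ∨ ω = -freq n ℓ G₁ k₀ K₀) {χ : EuclideanSpace ℝ (Fin n) → ℂ}
    (hχ : χ ∈ modeSpan n ℓ G₁ ω) :
    ∃ H : ℕ → MvPolynomial (Fin n) ℂ, (∀ K, IsSolidHarmonic (k₀ + 2 * K₀ - 2 * K) (H K)) ∧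
      χ = ∑ K ∈ Finset.range ((k₀ + 2 * K₀) / 2 + 1), mode n ℓ G₁ (k₀ + 2 * K₀ - 2 * K) K (H K) := by
  obtain ⟨μ, hμ⟩ := (Submodule.mem_iSup_finset_iff_exists_sum _ _).mp (modeSpan_le_iSup hℓ hG h₀ hχ)
  choose H hH using fun K => (μ K).2
  refine ⟨fun K => H K, fun K => (H K).2, ?_⟩
  rw [← hμ]
  exact Finset.sum_congr rfl fun K _ => (hH K).symm

theorem exists_freq_of_mem_modeSpan {G₁ ω : ℝ} {χ : EuclideanSpace ℝ (Fin n) → ℂ}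
    (hχ : χ ∈ modeSpan n ℓ G₁ ω) (h0 : χ ≠ 0) :
    ∃ k K : ℕ, ω = freq n ℓ G₁ k K ∨ ω = -freq n ℓ G₁ k K := by
  by_contra h
  have : modeSpan n ℓ G₁ ω = ⊥ := by
    refine Submodule.span_eq_bot.mpr ?_
    rintro _ ⟨k, K, H, hω, -, -⟩
    exact absurd ⟨k, K, hω⟩ h
  rw [this] at hχ
  exact h0 ((Submodule.mem_bot ℂ).mp hχ)

theorem finiteDimensional_modeSpan (hℓ : 0 < ℓ) {G₁ : ℝ} (hG : 0 < 4 * ℓ ^ 2 * G₁ + (n : ℝ) ^ 2)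
    (ω : ℝ) : FiniteDimensional ℂ (modeSpan n ℓ G₁ ω) := by
  by_cases h : modeSpan n ℓ G₁ ω = ⊥
  · rw [h]
    infer_instance
  · obtain ⟨χ, hχ, hχ0⟩ := Submodule.exists_mem_ne_zero_of_ne_bot h
    obtain ⟨k, K, h₀⟩ := exists_freq_of_mem_modeSpan hχ hχ0
    have := modeSpan_le_iSup hℓ hG h₀
    rw [← Finset.sup_eq_iSup] at this
    exact Submodule.finiteDimensional_of_le this

theorem eq_zero_of_pairing_conj_eq_zero (hℓ : 0 < ℓ) {a : ℝ} (ha : (n : ℝ) / 2 < 2 * a)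
    {f : EuclideanSpace ℝ (Fin n) → ℂ} (hf : HasDecay ℓ a f)
    (h : pairing ℓ f (fun x => starRingEnd ℂ (f x)) = 0) : f = 0 := by
  have e (x : EuclideanSpace ℝ (Fin n)) :
      (((ℓ ^ 2 + ‖x‖ ^ 2)⁻¹ : ℝ) : ℂ) * f x * starRingEnd ℂ (f x) =
        (((ℓ ^ 2 + ‖x‖ ^ 2)⁻¹ * ‖f x‖ ^ 2 : ℝ) : ℂ) := by
    rw [mul_assoc, Complex.mul_conj, Complex.normSq_eq_norm_sq]
    push_cast; rfl
  have hfc : HasDecay ℓ a (fun x => starRingEnd ℂ (f x)) := by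
    obtain ⟨hc, C, hC⟩ := hf
    exact ⟨Complex.continuous_conj.comp hc, C, fun x => by simpa using hC x⟩
  have hi := integrable_pairing hℓ (δ := 0) (by linarith) hf (hfc.memWeightedL2 hℓ (by linarith))
  simp only [pairing, e] at h hi
  have hi' : Integrable (fun x => (ℓ ^ 2 + ‖x‖ ^ 2)⁻¹ * ‖f x‖ ^ 2) volume := by
    exact Complex.reCLM.integrable_comp hi
  rw [integral_complex_ofReal] at h
  have h1 := (integral_eq_zero_iff_of_nonneg (fun x => by
    have := sq_add_norm_sq_pos hℓ x
    simp only [Pi.zero_apply]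
    positivity) hi').mp (by exact_mod_cast h)
  have h2 : f =ᵐ[volume] 0 := by
    filter_upwards [h1] with x hx
    have hu := sq_add_norm_sq_pos hℓ x
    simp only [Pi.zero_apply, mul_eq_zero, inv_eq_zero, hu.ne', false_or] at hx
    simpa using hx
  exact (Continuous.ae_eq_iff_eq volume hf.1 continuous_const).mp h2

/-- Every solution is almost everywhere equal to a combination of modes of its frequency. The pairing
is non-degenerate on the finite-dimensional span of these modes, so that it contains a `χ` with the
same pairings as the solution; the difference is orthogonal to all modes. -/
theorem IsEigensolution.exists_mem_modeSpan (hn : 2 ≤ n) (hℓ : 0 < ℓ) {G₁ δ ω : ℝ}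
    (hG : 0 < 4 * ℓ ^ 2 * G₁ + (n : ℝ) ^ 2) (hδ₁ : -(sExp n ℓ G₁) / 2 < δ)
    (hδ₂ : δ < sExp n ℓ G₁ / 2) {ψ : EuclideanSpace ℝ (Fin n) → ℂ}
    (hψ : IsEigensolution n ℓ G₁ δ ω ψ) : ∃ χ ∈ modeSpan n ℓ G₁ ω, ψ =ᵐ[volume] χ := by
  set W := modeSpan n ℓ G₁ ω with hW
  set a : ℝ := ((n : ℝ) + sExp n ℓ G₁) / 4 with ha
  have had : (n : ℝ) / 2 < 2 * a - δ := by rw [ha]; linarith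
  have ha0 : (n : ℝ) / 2 < 2 * a := by
    have : 0 < sExp n ℓ G₁ := Real.sqrt_pos.mpr hG
    rw [ha]; linarith
  have hfd : FiniteDimensional ℂ W := finiteDimensional_modeSpan hℓ hG ω
  have hdec (f : W) : HasDecay ℓ a f.1 := modeSpan_le_decaySubmodule hn hℓ G₁ ω f.2
  have heig (f : W) : IsEigensolution n ℓ G₁ δ ω f.1 :=
    modeSpan_le_eigenSubmodule hn hℓ hG hδ₁ ω f.2
  have hint (f : W) {g : EuclideanSpace ℝ (Fin n) → ℂ} (hg : MemWeightedL2 ℓ (δ - 1 / 2) g) :=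
    integrable_pairing hℓ had (hdec f) hg
  have hadd (f g : W) {u : EuclideanSpace ℝ (Fin n) → ℂ} (hu : MemWeightedL2 ℓ (δ - 1 / 2) u) :
      pairing ℓ (f + g).1 u = pairing ℓ f.1 u + pairing ℓ g.1 u := by
    rw [pairing, pairing, pairing, ← integral_add (hint f hu) (hint g hu)]
    refine integral_congr_ae (Filter.Eventually.of_forall fun x => ?_)
    simp only [Submodule.coe_add, Pi.add_apply]
    ring
  have hsmul (c : ℂ) (f : W) (u : EuclideanSpace ℝ (Fin n) → ℂ) :
      pairing ℓ (c • f).1 u = c * pairing ℓ f.1 u := by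
    rw [pairing, pairing, ← integral_const_mul]
    refine integral_congr_ae (Filter.Eventually.of_forall fun x => ?_)
    simp only [Submodule.coe_smul, Pi.smul_apply, smul_eq_mul]
    ring
  have hcomm (f g : EuclideanSpace ℝ (Fin n) → ℂ) : pairing ℓ f g = pairing ℓ g f := by
    rw [pairing, pairing]
    refine integral_congr_ae (Filter.Eventually.of_forall fun x => ?_)
    simp only
    ring
  set B : W →ₗ[ℂ] Module.Dual ℂ W := LinearMap.mk₂ ℂ (fun f g : W => pairing ℓ f.1 g.1)
    (fun f g u => hadd f g (heig u).1) (fun c f u => hsmul c f u.1)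
    (fun f g u => by
      rw [hcomm f.1, hcomm f.1, hcomm f.1]
      exact hadd g u (heig f).1)
    (fun c f g => by rw [hcomm f.1, hcomm f.1]; exact hsmul c g f.1) with hB
  have hinj : Function.Injective B := by
    rw [← LinearMap.ker_eq_bot, LinearMap.ker_eq_bot']
    intro f hf
    have h1 := LinearMap.congr_fun hf ⟨_, conj_mem_modeSpan f.2⟩
    exact Subtype.ext (eq_zero_of_pairing_conj_eq_zero hℓ ha0 (hdec f) h1)
  obtain ⟨χ, hχ⟩ := (LinearMap.injective_iff_surjective_of_finrank_eq_finrank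
    Subspace.dual_finrank_eq.symm).mp hinj
    { toFun := fun f : W => pairing ℓ f.1 ψ
      map_add' := fun f g => hadd f g hψ.1
      map_smul' := fun c f => hsmul c f ψ }
  refine ⟨χ.1, χ.2, ?_⟩
  have hsub : IsEigensolution n ℓ G₁ δ ω (ψ - χ.1) :=
    Submodule.sub_mem (eigenSubmodule n hℓ G₁ δ ω) hψ (heig χ)
  have h0 := hsub.ae_eq_zero hn hℓ hG hδ₂ fun k K H hH hω => by
    set f : W := ⟨mode n ℓ G₁ k K H, Submodule.subset_span ⟨k, K, H, hω, hH, rfl⟩⟩ with hf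
    have h1 : pairing ℓ χ.1 f.1 = pairing ℓ f.1 ψ := LinearMap.congr_fun hχ f
    have h2 : pairing ℓ f.1 (ψ - χ.1) = pairing ℓ f.1 ψ - pairing ℓ f.1 χ.1 := by
      rw [pairing, pairing, pairing, ← integral_sub (hint f hψ.1) (hint f (heig χ).1)]
      refine integral_congr_ae (Filter.Eventually.of_forall fun x => ?_)
      simp only [Pi.sub_apply]
      ring
    rw [h2, ← h1, hcomm, sub_self]
  filter_upwards [h0] with x hx
  simpa [sub_eq_zero] using hx

/-! ### Solid harmonics of every degree -/

/-- The linear form `∑ cᵢ Xᵢ`. -/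
def linForm (c : Fin n → ℂ) : MvPolynomial (Fin n) ℂ :=
  ∑ i, MvPolynomial.C (c i) * MvPolynomial.X i

theorem eval_linForm (c v : Fin n → ℂ) : MvPolynomial.eval v (linForm c) = ∑ i, c i * v i := by
  simp [linForm]

theorem pderiv_linForm (c : Fin n → ℂ) (i : Fin n) :
    MvPolynomial.pderiv i (linForm c) = MvPolynomial.C (c i) := by
  classical
  simp [linForm, MvPolynomial.pderiv_X, Pi.single_apply]

/-- The powers of a linear form with isotropic coefficient vector are harmonic. -/
theorem isSolidHarmonic_linForm_pow {c : Fin n → ℂ} (hc : ∑ i, c i * c i = 0) (k : ℕ) :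
    IsSolidHarmonic k (linForm c ^ k) := by
  constructor
  · have h1 : (linForm c).IsHomogeneous 1 := MvPolynomial.IsHomogeneous.sum _ _ _ fun i _ => by
      simpa using (MvPolynomial.isHomogeneous_C _ (c i)).mul (MvPolynomial.isHomogeneous_X ℂ i)
    simpa using h1.pow k
  · have h2 (i : Fin n) : MvPolynomial.pderiv i (MvPolynomial.pderiv i (linForm c ^ k)) =
        (k : MvPolynomial (Fin n) ℂ) * ((k - 1 : ℕ) : MvPolynomial (Fin n) ℂ) *
          linForm c ^ (k - 1 - 1) * MvPolynomial.C (c i * c i) := by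
      rw [MvPolynomial.pderiv_pow, pderiv_linForm, mul_comm, MvPolynomial.pderiv_C_mul,
        ← map_natCast (MvPolynomial.C (σ := Fin n) (R := ℂ)) k, MvPolynomial.pderiv_C_mul,
        MvPolynomial.pderiv_pow, pderiv_linForm, MvPolynomial.C_mul]
      ring
    simp only [h2, ← Finset.mul_sum, ← map_sum, hc, map_zero, mul_zero]

/-- The vector `e₀ + z e₁`, isotropic for `z = ±i`. -/
def isoVec (hn : 2 ≤ n) (z : ℂ) : Fin n → ℂ :=
  Pi.single ⟨0, by omega⟩ 1 + Pi.single ⟨1, by omega⟩ z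

theorem sum_isoVec_mul (hn : 2 ≤ n) (z w : ℂ) :
    ∑ i, isoVec hn z i * isoVec hn w i = 1 + z * w := by
  have h : (⟨0, by omega⟩ : Fin n) ≠ ⟨1, by omega⟩ := by simp
  simp [isoVec, add_mul, mul_add, Finset.sum_add_distrib, Pi.single_apply, h, h.symm]

theorem isSolidHarmonic_isoVec_pow (hn : 2 ≤ n) {z : ℂ} (hz : z * z = -1) (k : ℕ) :
    IsSolidHarmonic k (linForm (isoVec hn z) ^ k) :=
  isSolidHarmonic_linForm_pow (by rw [sum_isoVec_mul, hz]; ring) k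

theorem eval_linForm_isoVec_pow_neg (hn : 2 ≤ n) {z : ℂ} (hz : z * z = -1) (k : ℕ) :
    MvPolynomial.eval (isoVec hn (-z)) (linForm (isoVec hn z) ^ k) = 2 ^ k := by
  rw [map_pow, eval_linForm, sum_isoVec_mul, mul_neg, hz]
  norm_num

theorem linForm_isoVec_pow_ne_zero (hn : 2 ≤ n) {z : ℂ} (hz : z * z = -1) (k : ℕ) :
    linForm (isoVec hn z) ^ k ≠ 0 := fun h => by
  have := eval_linForm_isoVec_pow_neg hn hz k
  rw [h, map_zero] at this
  exact pow_ne_zero k two_ne_zero this.symm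

/-! ### The simple eigenvalue -/

theorem isSimpleFrequency_iff (hn : 2 ≤ n) (hℓ : 0 < ℓ) {G₁ δ : ℝ}
    (hG : 0 < 4 * ℓ ^ 2 * G₁ + (n : ℝ) ^ 2) (hδ₁ : -(sExp n ℓ G₁) / 2 < δ)
    (hδ₂ : δ < sExp n ℓ G₁ / 2) (k K : ℕ) :
    IsSimpleFrequency n ℓ G₁ δ (freq n ℓ G₁ k K) ↔ k = 0 ∧ K = 0 := by
  constructor
  · rintro ⟨ψ₀, -, -, h⟩
    by_contra hkK
    -- for `N = k + 2K ≥ 1` the modes `(N, 0)` of two independent solid harmonics have the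
    -- frequency of `(k, K)`
    set N := k + 2 * K with hN
    have hN0 : N ≠ 0 := by omega
    have hω : freq n ℓ G₁ k K = freq n ℓ G₁ N 0 := (freq_eq_freq_iff hℓ).mpr (by omega)
    have hI : Complex.I * Complex.I = -1 := Complex.I_mul_I
    have hI' : -Complex.I * -Complex.I = -1 := by simp
    have hp := isSolidHarmonic_isoVec_pow hn hI N
    have hm := isSolidHarmonic_isoVec_pow hn hI' N
    obtain ⟨c₁, h₁⟩ := h _ (isEigensolution_mode hn hℓ hG hδ₁ hp (Or.inl hω))
    obtain ⟨c₂, h₂⟩ := h _ (isEigensolution_mode hn hℓ hG hδ₁ hm (Or.inl hω))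
    have h0 := eq_zero_of_mode_ae_eq_zero hℓ (G₁ := G₁) (K := 0)
      ((hp.smul c₂).add (hm.smul (-c₁))).1 (by
        filter_upwards [h₁, h₂] with x hx₁ hx₂
        rw [mode_add, mode_smul, mode_smul]
        simp only [Pi.add_apply, Pi.smul_apply, smul_eq_mul, Pi.zero_apply] at hx₁ hx₂ ⊢
        rw [hx₁, hx₂]
        ring)
    have h0' := congrArg (MvPolynomial.eval (isoVec hn (-Complex.I))) h0
    rw [map_add, MvPolynomial.smul_eval, MvPolynomial.smul_eval, eval_linForm_isoVec_pow_neg hn hI,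
      map_pow, eval_linForm, sum_isoVec_mul, hI', add_neg_cancel, zero_pow hN0, mul_zero, add_zero,
      map_zero] at h0'
    have hc₂ := (mul_eq_zero.mp h0').resolve_right (pow_ne_zero N two_ne_zero)
    rw [hc₂, zero_smul] at h₂
    exact linForm_isoVec_pow_ne_zero hn hI' N (eq_zero_of_mode_ae_eq_zero hℓ hm.1 h₂)
  · rintro ⟨rfl, rfl⟩
    have h1 : IsSolidHarmonic 0 (1 : MvPolynomial (Fin n) ℂ) :=
      ⟨MvPolynomial.isHomogeneous_one _ _, by simp⟩
    refine ⟨mode n ℓ G₁ 0 0 1, isEigensolution_mode hn hℓ hG hδ₁ h1 (Or.inl rfl),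
      fun h => one_ne_zero (eq_zero_of_mode_ae_eq_zero hℓ h1.1 h), fun ψ hψ => ?_⟩
    obtain ⟨χ, hχ, hψχ⟩ := hψ.exists_mem_modeSpan hn hℓ hG hδ₁ hδ₂
    obtain ⟨H, hH, rfl⟩ := exists_sum_mode_of_mem_modeSpan hℓ hG (Or.inl rfl) hχ
    obtain ⟨c, hc⟩ : ∃ c : ℂ, H 0 = c • 1 := by
      refine ⟨(H 0).coeff 0, ?_⟩
      rw [MvPolynomial.smul_eq_C_mul, mul_one]
      exact MvPolynomial.totalDegree_eq_zero_iff_eq_C.mp (Nat.le_zero.mp (hH 0).1.totalDegree_le)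
    refine ⟨c, hψχ.trans ?_⟩
    simp [hc, mode_smul]

/-! ### Solutions with a given angular dependence -/

theorem contDiffAt_angular {k : ℕ} {H : MvPolynomial (Fin n) ℂ} (hH : H.IsHomogeneous k)
    {x : EuclideanSpace ℝ (Fin n)} (hx : x ≠ 0) : ContDiffAt ℝ 2 (angular H) x := by
  rw [funext (angular_eq hH)]
  refine ContDiffAt.mul (ContDiffAt.pow (ContDiffAt.inv ?_ ?_) k) (contDiff_polyEval H).contDiffAt
  · exact Complex.ofRealCLM.contDiff.contDiffAt.comp x (contDiffAt_norm ℝ hx)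
  · simpa using hx

theorem angular_inv_norm_smul (H : MvPolynomial (Fin n) ℂ) {x : EuclideanSpace ℝ (Fin n)}
    (hx : x ≠ 0) : angular H (‖x‖⁻¹ • x) = angular H x := by
  have h : ‖‖x‖⁻¹ • x‖ = 1 := by
    rw [norm_smul, norm_inv, norm_norm, inv_mul_cancel₀ (norm_ne_zero_iff.mpr hx)]
  simp only [angular, h, inv_one, one_smul]

theorem angular_smul_of_pos (H : MvPolynomial (Fin n) ℂ) {r : ℝ} (hr : 0 < r)
    {θ : EuclideanSpace ℝ (Fin n)} (hθ : ‖θ‖ = 1) : angular H (r • θ) = angular H θ := by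
  have h : ‖r • θ‖ = r := by rw [norm_smul, hθ, mul_one, Real.norm_of_nonneg hr.le]
  rw [angular, angular, h, hθ, inv_one, one_smul, smul_smul, inv_mul_cancel₀ hr.ne', one_smul]

theorem eq_zero_of_angular_eq_zero {k : ℕ} {H : MvPolynomial (Fin n) ℂ} (hH : H.IsHomogeneous k)
    (h : ∀ θ : EuclideanSpace ℝ (Fin n), ‖θ‖ = 1 → angular H θ = 0) (hn : 2 ≤ n) : H = 0 := by
  have hx {x : EuclideanSpace ℝ (Fin n)} (hx : x ≠ 0) : polyEval H x = 0 := by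
    rw [← norm_pow_mul_angular hH, ← angular_inv_norm_smul H hx, h _ ?_, mul_zero]
    rw [norm_smul, norm_inv, norm_norm, inv_mul_cancel₀ (norm_ne_zero_iff.mpr hx)]
  -- by continuity, the origin being no isolated point
  have : Nontrivial (EuclideanSpace ℝ (Fin n)) :=
    ⟨EuclideanSpace.single ⟨0, by omega⟩ 1, 0, by simp⟩
  have : polyEval H = fun _ => 0 :=
    Continuous.ext_on (dense_compl_singleton (0 : EuclideanSpace ℝ (Fin n)))
      (contDiff_polyEval H (m := 0)).continuous continuous_const fun y hy => hx hy
  exact eq_zero_of_polyEval_eq_zero fun x => congrFun this x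

/-- The eigenvalue of the spherical Laplacian on spherical harmonics of degree `k`, up to sign. -/
def sphEigenvalue (n k : ℕ) : ℂ := (k : ℂ) * ((k : ℂ) + (n : ℂ) - 2)

/-- For `n ≥ 2` the degree is determined by the eigenvalue; for `n = 1` it is not. -/
theorem sphEigenvalue_injective (hn : 2 ≤ n) : Function.Injective (sphEigenvalue n) := by
  intro k m h
  obtain ⟨d, rfl⟩ : ∃ d, n = d + 2 := ⟨n - 2, by omega⟩
  have h1 : ((k * (k + d) : ℕ) : ℂ) = ((m * (m + d) : ℕ) : ℂ) := by
    simp only [sphEigenvalue] at h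
    push_cast at h ⊢
    linear_combination h
  have h2 : k * (k + d) = m * (m + d) := by exact_mod_cast h1
  rcases lt_trichotomy k m with hlt | heq | hgt
  · nlinarith
  · exact heq
  · nlinarith

/-- Applying the spherical Laplacian to a relation between spherical harmonics. -/
theorem sum_sphEigenvalue_mul_angular {ι : Type*} (s : Finset ι) {d : ι → ℕ}
    {G : ι → MvPolynomial (Fin n) ℂ} (hG : ∀ i, IsSolidHarmonic (d i) (G i)) {k : ℕ}
    {H : MvPolynomial (Fin n) ℂ} (hH : IsSolidHarmonic k H)
    (h : ∀ θ : EuclideanSpace ℝ (Fin n), ‖θ‖ = 1 → ∑ i ∈ s, angular (G i) θ = angular H θ)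
    {θ : EuclideanSpace ℝ (Fin n)} (hθ : ‖θ‖ = 1) :
    ∑ i ∈ s, sphEigenvalue n (d i) * angular (G i) θ = sphEigenvalue n k * angular H θ := by
  have hθ0 : θ ≠ 0 := by rintro rfl; simp at hθ
  have e : (∑ i ∈ s, angular (G i)) =ᶠ[nhds θ] angular H := by
    filter_upwards [isOpen_ne.mem_nhds hθ0] with x hx
    rw [Finset.sum_apply, ← angular_inv_norm_smul H hx, ← h]
    · exact Finset.sum_congr rfl fun i _ => (angular_inv_norm_smul (G i) hx).symm
    · rw [norm_smul, norm_inv, norm_norm, inv_mul_cancel₀ (norm_ne_zero_iff.mpr hx)]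
  have hsum : ∀ t : Finset ι, Laplacian.laplacian (∑ i ∈ t, angular (G i)) θ =
      ∑ i ∈ t, -(sphEigenvalue n (d i) * angular (G i) θ) := by
    classical
    intro t
    induction t using Finset.induction_on with
    | empty =>
      have h0 : ContDiffAt ℝ 2 (0 : EuclideanSpace ℝ (Fin n) → ℂ) θ := contDiffAt_const
      rw [Finset.sum_empty, Finset.sum_empty, laplacian_eq_sum_partialD h0]
      have hp (i : Fin n) : partialD i (0 : EuclideanSpace ℝ (Fin n) → ℂ) = 0 := by
        funext x
        simp [partialD]
      simp [hp]
    | insert a t ha ih =>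
      rw [Finset.sum_insert ha, Finset.sum_insert ha, ContDiffAt.laplacian_add
        (contDiffAt_angular (hG a).1 hθ0), ih, laplacian_angular (hG a) hθ, sphEigenvalue, neg_mul]
      rw [show (∑ i ∈ t, angular (G i)) = fun x => ∑ i ∈ t, angular (G i) x by
        funext x; rw [Finset.sum_apply]]
      exact ContDiffAt.sum fun i _ => contDiffAt_angular (hG i).1 hθ0
  have h1 := (InnerProductSpace.laplacian_congr_nhds e).eq_of_nhds
  rw [hsum, laplacian_angular hH hθ, Finset.sum_neg_distrib] at h1
  rw [sphEigenvalue]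
  linear_combination -h1

/-- Spherical harmonics of different degrees are linearly independent. -/
theorem eq_zero_of_sum_angular_eq_zero (hn : 2 ≤ n) {ι : Type*} (s : Finset ι) {d : ι → ℕ}
    (hd : Set.InjOn d s) : ∀ {G : ι → MvPolynomial (Fin n) ℂ},
    (∀ i, IsSolidHarmonic (d i) (G i)) →
    (∀ θ : EuclideanSpace ℝ (Fin n), ‖θ‖ = 1 → ∑ i ∈ s, angular (G i) θ = 0) →
    ∀ i ∈ s, G i = 0 := by
  classical
  induction s using Finset.induction_on with
  | empty => simp
  | insert a s ha ih =>
    intro G hG h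
    have hH : IsSolidHarmonic (d a) ((-1 : ℂ) • G a) := (hG a).smul _
    have h1 : ∀ θ : EuclideanSpace ℝ (Fin n), ‖θ‖ = 1 →
        ∑ i ∈ s, angular (G i) θ = angular ((-1 : ℂ) • G a) θ := fun θ hθ => by
      have := h θ hθ
      rw [Finset.sum_insert ha] at this
      rw [angular_smul]
      linear_combination this
    have h2 : ∀ i ∈ s, G i = 0 := fun i hi => by
      have h3 := ih (hd.mono (by simp)) (G := fun i => (sphEigenvalue n (d i) -
        sphEigenvalue n (d a)) • G i) (fun i => (hG i).smul _) (fun θ hθ => by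
          have := sum_sphEigenvalue_mul_angular s hG hH h1 hθ
          rw [← h1 θ hθ, Finset.mul_sum, ← sub_eq_zero, ← Finset.sum_sub_distrib] at this
          rw [← this]
          exact Finset.sum_congr rfl fun i _ => by rw [angular_smul]; ring) i hi
      refine (smul_eq_zero.mp h3).resolve_left (sub_ne_zero.mpr fun he => ?_)
      have := hd (by simp [hi]) (by simp) (sphEigenvalue_injective hn he)
      exact ha (this ▸ hi)
    intro i hi
    rcases Finset.mem_insert.mp hi with rfl | hi
    · refine eq_zero_of_angular_eq_zero (hG i).1 (fun θ hθ => ?_) hn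
      have := h θ hθ
      rwa [Finset.sum_insert ha, Finset.sum_eq_zero, add_zero] at this
      intro j hj
      rw [h2 j hj]
      simp [angular]
    · exact h2 i hi

/-- If a sum of spherical harmonics of different degrees is a spherical harmonic of degree `k`, then
the terms of other degrees vanish. -/
theorem eq_zero_of_sum_angular_eq (hn : 2 ≤ n) {ι : Type*} {s : Finset ι} {d : ι → ℕ}
    (hd : Set.InjOn d s) {G : ι → MvPolynomial (Fin n) ℂ} (hG : ∀ i, IsSolidHarmonic (d i) (G i))
    {k : ℕ} {H : MvPolynomial (Fin n) ℂ} (hH : IsSolidHarmonic k H)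
    (h : ∀ θ : EuclideanSpace ℝ (Fin n), ‖θ‖ = 1 → ∑ i ∈ s, angular (G i) θ = angular H θ)
    {i : ι} (hi : i ∈ s) (hik : d i ≠ k) : G i = 0 := by
  have h1 := eq_zero_of_sum_angular_eq_zero hn s hd
    (G := fun i => (sphEigenvalue n (d i) - sphEigenvalue n k) • G i) (fun i => (hG i).smul _)
    (fun θ hθ => by
      have := sum_sphEigenvalue_mul_angular s hG hH h hθ
      rw [← h θ hθ, Finset.mul_sum, ← sub_eq_zero, ← Finset.sum_sub_distrib] at this
      rw [← this]
      exact Finset.sum_congr rfl fun i _ => by rw [angular_smul]; ring) i hi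
  exact (smul_eq_zero.mp h1).resolve_left
    (sub_ne_zero.mpr fun he => hik (sphEigenvalue_injective hn he))

/-- A continuous function that is almost everywhere of the form `u(r) Y(θ)` is of this form on every
sphere: the relation `Y(Rθ) χ(rθ) = Y(θ) χ(rRθ)` holds for every isometry `R`, almost everywhere and
hence everywhere. -/
theorem exists_eq_mul_angular {k : ℕ} {H : MvPolynomial (Fin n) ℂ} (hH : H.IsHomogeneous k)
    (hne : ∃ θ : EuclideanSpace ℝ (Fin n), ‖θ‖ = 1 ∧ angular H θ ≠ 0) {u : ℝ → ℂ}
    {χ : EuclideanSpace ℝ (Fin n) → ℂ} (hχ : Continuous χ)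
    (h : (fun x => u ‖x‖ * angular H x) =ᵐ[volume] χ) {r : ℝ} (hr : 0 < r) :
    ∃ w : ℂ, ∀ θ : EuclideanSpace ℝ (Fin n), ‖θ‖ = 1 → χ (r • θ) = w * angular H θ := by
  obtain ⟨θ₀, hθ₀, hY⟩ := hne
  refine ⟨χ (r • θ₀) / angular H θ₀, fun θ hθ => ?_⟩
  -- the reflection that exchanges `θ₀` and `θ`
  set R := (Submodule.span ℝ {θ₀ - θ})ᗮ.reflection with hR
  have hRθ : R θ₀ = θ := Submodule.reflection_sub (by rw [hθ₀, hθ])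
  have hp : Continuous (polyEval H) := (contDiff_polyEval H (m := 0)).continuous
  have hRc : Continuous R := R.continuous
  have hrel : (fun x => polyEval H (R x) * χ x) = fun x => polyEval H x * χ (R x) := by
    refine (Continuous.ae_eq_iff_eq volume ((hp.comp hRc).mul hχ) (hp.mul (hχ.comp hRc))).mp ?_
    filter_upwards [h, R.measurePreserving.quasiMeasurePreserving.ae h] with x h1 h2
    simp only [Pi.mul_apply, Function.comp_apply]
    rw [← h1, ← h2, ← norm_pow_mul_angular hH, ← norm_pow_mul_angular hH, R.norm_map]
    ring
  have h1 := congrFun hrel (r • θ₀)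
  have hn1 : ‖r • θ₀‖ = r := by rw [norm_smul, hθ₀, mul_one, Real.norm_of_nonneg hr.le]
  have hn2 : ‖r • θ‖ = r := by rw [norm_smul, hθ, mul_one, Real.norm_of_nonneg hr.le]
  simp only [map_smul, hRθ] at h1
  rw [← norm_pow_mul_angular hH, ← norm_pow_mul_angular hH, hn1, hn2, angular_smul_of_pos H hr hθ,
    angular_smul_of_pos H hr hθ₀, mul_assoc, mul_assoc] at h1
  have h2 := mul_left_cancel₀ (pow_ne_zero k (Complex.ofReal_ne_zero.mpr hr.ne')) h1
  field_simp
  linear_combination -h2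

theorem eventually_radial_ne_zero (hℓ : 0 < ℓ) (G₁ : ℝ) (k K : ℕ) :
    ∀ᶠ r in nhdsWithin (0 : ℝ) (Set.Ioi 0), radial n ℓ G₁ k K r ≠ 0 := by
  filter_upwards [nhdsWithin_le_nhds (eventually_eval_modePoly_ne_zero G₁ k K), self_mem_nhdsWithin] with r hr hr0
  have hr0 : 0 < r := hr0
  rw [radial_eq]
  exact mul_ne_zero (by positivity) hr

/-- A solution `u(r) Y(θ)` is a combination of modes of degrees `N - 2K`. On a small sphere it is a
multiple of `Y`, so that independence of spherical harmonics leaves a single term. -/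
theorem IsEigensolution.eq_smul_mode (hn : 2 ≤ n) (hℓ : 0 < ℓ) {G₁ δ ω : ℝ}
    (hG : 0 < 4 * ℓ ^ 2 * G₁ + (n : ℝ) ^ 2) (hδ₁ : -(sExp n ℓ G₁) / 2 < δ)
    (hδ₂ : δ < sExp n ℓ G₁ / 2) {k : ℕ} {H : MvPolynomial (Fin n) ℂ} (hH : IsSolidHarmonic k H)
    (hH0 : H ≠ 0) {u : ℝ → ℂ}
    (h : IsEigensolution n ℓ G₁ δ ω fun x => u ‖x‖ * angular H x)
    (h0 : ¬ (fun x => u ‖x‖ * angular H x) =ᵐ[volume] 0) :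
    ∃ K : ℕ, (ω = freq n ℓ G₁ k K ∨ ω = -freq n ℓ G₁ k K) ∧ ∃ c : ℂ, c ≠ 0 ∧
      (fun x => u ‖x‖ * angular H x) =ᵐ[volume] c • mode n ℓ G₁ k K H := by
  obtain ⟨χ, hχ, hψ⟩ := h.exists_mem_modeSpan hn hℓ hG hδ₁ hδ₂
  obtain ⟨k₀, K₀, hω⟩ := exists_freq_of_mem_modeSpan hχ (fun h => h0 (by rwa [h] at hψ))
  obtain ⟨Hs, hHs, rfl⟩ := exists_sum_mode_of_mem_modeSpan hℓ hG hω hχ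
  set N := k₀ + 2 * K₀ with hN
  set s := Finset.range (N / 2 + 1) with hs
  have hd : Set.InjOn (fun K => N - 2 * K) s := by
    intro a ha b hb hab
    simp only [hs, Finset.coe_range, Set.mem_Iio] at ha hb hab
    omega
  obtain ⟨θ₀, hθ₀, hY⟩ : ∃ θ : EuclideanSpace ℝ (Fin n), ‖θ‖ = 1 ∧ angular H θ ≠ 0 := by
    by_contra! hc
    exact hH0 (eq_zero_of_angular_eq_zero hH.1 hc hn)
  -- a radius at which no radial factor of the given level vanishes
  obtain ⟨r, hr, hr0⟩ := (((Filter.eventually_all_finset s).mpr fun K _ =>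
    eventually_radial_ne_zero (n := n) hℓ G₁ (N - 2 * K) K).and self_mem_nhdsWithin).exists
  have hr0 : 0 < r := hr0
  have hcont : Continuous (∑ K ∈ s, mode n ℓ G₁ (N - 2 * K) K (Hs K)) := by
    rw [show (∑ K ∈ s, mode n ℓ G₁ (N - 2 * K) K (Hs K)) =
      fun x => ∑ K ∈ s, mode n ℓ G₁ (N - 2 * K) K (Hs K) x by funext x; rw [Finset.sum_apply]]
    exact continuous_finsetSum _ fun K _ => (contDiff_mode hℓ (hHs K).1).continuous
  obtain ⟨w, hw⟩ := exists_eq_mul_angular hH.1 ⟨θ₀, hθ₀, hY⟩ hcont hψ hr0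
  have hsum (θ : EuclideanSpace ℝ (Fin n)) (hθ : ‖θ‖ = 1) :
      ∑ K ∈ s, angular ((radial n ℓ G₁ (N - 2 * K) K r : ℂ) • Hs K) θ = angular (w • H) θ := by
    rw [angular_smul, ← hw θ hθ, Finset.sum_apply]
    refine Finset.sum_congr rfl fun K _ => ?_
    rw [angular_smul, mode, angular_smul_of_pos _ hr0 hθ, norm_smul, hθ, mul_one,
      Real.norm_of_nonneg hr0.le]
  have hzero {K : ℕ} (hK : K ∈ s) (hKk : N - 2 * K ≠ k) : Hs K = 0 :=
    (smul_eq_zero.mp (eq_zero_of_sum_angular_eq hn hd (fun K => (hHs K).smul _) (hH.smul w) hsum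
      hK hKk)).resolve_left (Complex.ofReal_ne_zero.mpr (hr K hK))
  obtain ⟨K₁, hK₁, hne⟩ : ∃ K ∈ s, Hs K ≠ 0 := by
    by_contra! hc
    refine h0 (hψ.trans (Filter.EventuallyEq.of_eq (Finset.sum_eq_zero fun K hK => ?_)))
    funext x
    simp [hc K hK, mode, angular]
  have hk : N - 2 * K₁ = k := by
    by_contra hc
    exact hne (hzero hK₁ hc)
  have hother {K : ℕ} (hK : K ∈ s) (hKK : K ≠ K₁) : Hs K = 0 :=
    hzero hK fun hc => hKK (hd hK hK₁ (hc.trans hk.symm))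
  set ρ := radial n ℓ G₁ (N - 2 * K₁) K₁ r with hρ
  have hρ0 : (ρ : ℂ) ≠ 0 := Complex.ofReal_ne_zero.mpr (hr K₁ hK₁)
  have hHs₁ : Hs K₁ = (w / ρ) • H := by
    have h1 : (ρ : ℂ) • Hs K₁ + (-w) • H = 0 := by
      refine eq_zero_of_angular_eq_zero (k := k)
        ((hk ▸ (hHs K₁).smul (ρ : ℂ)).add (hH.smul (-w))).1 (fun θ hθ => ?_) hn
      have := hsum θ hθ
      rw [Finset.sum_eq_single_of_mem K₁ hK₁ fun K hK hKK => by simp [hother hK hKK, angular],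
        angular_smul w] at this
      rw [angular_add, angular_smul (-w), this]
      ring
    have h2 : (ρ : ℂ) • Hs K₁ = w • H := by
      rw [neg_smul, ← sub_eq_add_neg, sub_eq_zero] at h1
      exact h1
    rw [div_eq_inv_mul, mul_smul, ← h2, smul_smul, inv_mul_cancel₀ hρ0, one_smul]
  refine ⟨K₁, ?_, w / ρ, ?_, ?_⟩
  · have : freq n ℓ G₁ k K₁ = freq n ℓ G₁ k₀ K₀ := (freq_eq_freq_iff hℓ).mpr (by
      simp only [hs, Finset.mem_range] at hK₁
      omega)
    rwa [this]
  · intro hc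
    rw [hc, zero_smul] at hHs₁
    exact hne hHs₁
  · refine hψ.trans (Filter.EventuallyEq.of_eq ?_)
    rw [Finset.sum_eq_single_of_mem K₁ hK₁ fun K hK hKK => by
      funext x; simp [hother hK hKK, mode, angular], hHs₁, mode_smul, hk]

end AdS

end

theorem mainTheorem6 (n : ℕ) (hn : 2 ≤ n) (ℓ G₁ δ : ℝ) (hℓ : 0 < ℓ)
    (hG : 0 < 4 * ℓ ^ 2 * G₁ + (n : ℝ) ^ 2)
    (hδ₁ : -(AdS.sExp n ℓ G₁) / 2 < δ) (hδ₂ : δ < AdS.sExp n ℓ G₁ / 2) :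
    -- the frequencies of non-trivial solutions
    (∀ ω : ℝ,
      (∃ ψ : EuclideanSpace ℝ (Fin n) → ℂ,
        AdS.IsEigensolution n ℓ G₁ δ ω ψ ∧ ¬ ψ =ᵐ[MeasureTheory.volume] 0) ↔
      ∃ k K : ℕ, ω = AdS.freq n ℓ G₁ k K ∨ ω = -AdS.freq n ℓ G₁ k K) ∧
    -- the modes are smooth, separated, non-trivial solutions
    (∀ (k K : ℕ) (H : MvPolynomial (Fin n) ℂ), AdS.IsSolidHarmonic k H → H ≠ 0 →
      (∀ θ : EuclideanSpace ℝ (Fin n), ‖θ‖ = 1 →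
        Laplacian.laplacian (AdS.angular H) θ =
          -((k : ℂ) * ((k : ℂ) + (n : ℂ) - 2)) * AdS.angular H θ) ∧
      ContDiff ℝ (⊤ : ℕ∞) (AdS.mode n ℓ G₁ k K H) ∧
      (∀ x, AdS.opP ℓ (AdS.mode n ℓ G₁ k K H) x =
        (-AdS.freq n ℓ G₁ k K ^ 2 + AdS.lapse ℓ x ^ 2 * G₁) • AdS.mode n ℓ G₁ k K H x) ∧
      AdS.IsEigensolution n ℓ G₁ δ (AdS.freq n ℓ G₁ k K) (AdS.mode n ℓ G₁ k K H) ∧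
      ¬ AdS.mode n ℓ G₁ k K H =ᵐ[MeasureTheory.volume] 0) ∧
    -- for each spherical harmonic, the solutions with that angular dependence
    (∀ (ω : ℝ) (k : ℕ) (H : MvPolynomial (Fin n) ℂ) (u : ℝ → ℂ),
      AdS.IsSolidHarmonic k H → H ≠ 0 →
      ((AdS.IsEigensolution n ℓ G₁ δ ω (fun x => u ‖x‖ * AdS.angular H x) ∧
          ¬ (fun x => u ‖x‖ * AdS.angular H x) =ᵐ[MeasureTheory.volume] 0) ↔
        ∃ K : ℕ, (ω = AdS.freq n ℓ G₁ k K ∨ ω = -AdS.freq n ℓ G₁ k K) ∧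
          ∃ c : ℂ, c ≠ 0 ∧
            (fun x => u ‖x‖ * AdS.angular H x) =ᵐ[MeasureTheory.volume]
              c • AdS.mode n ℓ G₁ k K H)) ∧
    -- every solution is a finite linear combination of modes of the same frequency
    (∀ (ω : ℝ) (ψ : EuclideanSpace ℝ (Fin n) → ℂ),
      AdS.IsEigensolution n ℓ G₁ δ ω ψ ↔
        ∃ χ ∈ Submodule.span ℂ
          {f : EuclideanSpace ℝ (Fin n) → ℂ | ∃ (k K : ℕ) (H : MvPolynomial (Fin n) ℂ),
            (ω = AdS.freq n ℓ G₁ k K ∨ ω = -AdS.freq n ℓ G₁ k K) ∧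
            AdS.IsSolidHarmonic k H ∧ f = AdS.mode n ℓ G₁ k K H},
          ψ =ᵐ[MeasureTheory.volume] χ) ∧
    -- the simple eigenvalues
    (∀ k K : ℕ, AdS.IsSimpleFrequency n ℓ G₁ δ (AdS.freq n ℓ G₁ k K) ↔ k = 0 ∧ K = 0) := by
  have hex (k K : ℕ) {H : MvPolynomial (Fin n) ℂ} (hH : AdS.IsSolidHarmonic k H) (hH0 : H ≠ 0)
      {ω : ℝ} (hω : ω = AdS.freq n ℓ G₁ k K ∨ ω = -AdS.freq n ℓ G₁ k K) :
      AdS.IsEigensolution n ℓ G₁ δ ω (AdS.mode n ℓ G₁ k K H) ∧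
        ¬ AdS.mode n ℓ G₁ k K H =ᵐ[volume] 0 :=
    ⟨AdS.isEigensolution_mode hn hℓ hG hδ₁ hH hω,
      fun h => hH0 (AdS.eq_zero_of_mode_ae_eq_zero hℓ hH.1 h)⟩
  refine ⟨fun ω => ⟨?_, ?_⟩, fun k K H hH hH0 => ⟨fun θ hθ => AdS.laplacian_angular hH hθ,
    AdS.contDiff_mode hℓ hH.1, AdS.opP_mode hn hℓ hG hH, hex k K hH hH0 (Or.inl rfl)⟩,
    fun ω k H u hH hH0 => ⟨fun h => h.1.eq_smul_mode hn hℓ hG hδ₁ hδ₂ hH hH0 h.2, ?_⟩,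
    fun ω ψ => ⟨fun h => h.exists_mem_modeSpan hn hℓ hG hδ₁ hδ₂, ?_⟩,
    AdS.isSimpleFrequency_iff hn hℓ hG hδ₁ hδ₂⟩
  · rintro ⟨ψ, hψ, hψ0⟩
    obtain ⟨χ, hχ, hψχ⟩ := hψ.exists_mem_modeSpan hn hℓ hG hδ₁ hδ₂
    exact AdS.exists_freq_of_mem_modeSpan hχ fun h => hψ0 (h ▸ hψχ)
  · rintro ⟨k, K, hω⟩
    exact ⟨_, hex k K (AdS.isSolidHarmonic_isoVec_pow hn Complex.I_mul_I k)
      (AdS.linForm_isoVec_pow_ne_zero hn Complex.I_mul_I k) hω⟩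
  · rintro ⟨K, hω, c, hc, h⟩
    obtain ⟨h1, h2⟩ := hex k K hH hH0 hω
    have h3 : AdS.IsEigensolution n ℓ G₁ δ ω (c • AdS.mode n ℓ G₁ k K H) :=
      (AdS.eigenSubmodule n hℓ G₁ δ ω).smul_mem c h1
    refine ⟨h3.congr hℓ h, fun h0 => h2 ?_⟩
    filter_upwards [h.symm.trans h0] with x hx
    exact (smul_eq_zero.mp hx).resolve_left hc
  · rintro ⟨χ, hχ, h⟩
    exact AdS.IsEigensolution.congr hℓ (AdS.modeSpan_le_eigenSubmodule hn hℓ hG hδ₁ ω hχ) h
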